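/- Let $n\ge 1$, write $X=(x,x_{n+1})\in\mathbb R^{n+1}=\mathbb R^n\times\mathbb R$, and $B_r=\{|X|<r\}$. For an open set $D\subset\mathbb R^{n+1}$ put $$E(u,D)=\int_D|\nabla u|^2\,dX+\mathcal H^n(\{(x,0)\in D: u(x,0)>0\}).$$ Pointwise values of an $H^1_{loc}$ function $u$ are the limits $u(X)=\lim_{r\to0}\frac{1}{|B_r(X)|}\int_{B_r(X)}u$ (put $u(X)=0$ where the limit does not exist); on $\{x_{n+1}=0\}$ they exist $\mathcal H^n$-a.e. A function $u$ is a minimizer of $E$ in an open set $\Omega$ if $u\in H^1_{loc}(\Omega)$ and $E(u,D)\le E(v,D)$ for every domain $D\subset\subset\Omega$ and every $v\in H^1_{loc}(\Omega)$ that coincides with $u$ in a neighborhood of $\Omega\setminus D$. Theorem (monotonicity formula for minimizers). Let $R>0$ and let $u\ge 0$, even in $x_{n+1}$, be a minimizer of $E$ in $B_R$. Set $$\Phi_u(r)=r^{-n}E(u,B_r)-\tfrac12 r^{-n-1}\int_{\partial B_r}u^2\,d\sigma,\qquad r\in I,$$ where $I$ is the set of $0<r\le R$ with $E(u,B_r)<\infty$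 and, if $R\in I$, the values of $u$ on $\partial B_R$ are its traces (radial limits $\lim_{s\to1^-}u(sX)$). Then $(0,R)\subset I$, $\int_{\partial B_r}u^2\,d\sigma<\infty$ for every $r\in I$, and $\Phi_u$ is nondecreasing on $I$. Moreover, $\Phi_u$ is constant on $I$ if and only if $u$ is homogeneous of degree $1/2$ in $B_R$, that is, $u(tX)=t^{1/2}u(X)$ whenever $t>0$ and $X,tX\in B_R$. -/

import Mathlib

open MeasureTheory Filter Topology Metric
open scoped ENNReal ContDiff

noncomputable section

namespace ThinOnePhase

/-- The Euclidean space `ℝ^{n+1} = ℝ^n × ℝ`; the last coordinate is `x_{n+1}`. -/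
abbrev Space (n : ℕ) : Type := EuclideanSpace ℝ (Fin (n + 1))

variable {n : ℕ}

/-- `G` is the weak (distributional) gradient of `u` in the open set `Ω`. -/
structure HasWeakGradientOn (u : Space n → ℝ) (G : Space n → Space n) (Ω : Set (Space n)) :
    Prop where
  locInt : LocallyIntegrableOn u Ω
  locInt_grad : LocallyIntegrableOn G Ω
  integral_eq : ∀ φ : Space n → ℝ, ContDiff ℝ ∞ φ → HasCompactSupport φ → tsupport φ ⊆ Ω →
    ∀ e : Space n, ∫ X in Ω, u X * fderiv ℝ φ X e = -∫ X in Ω, inner ℝ (G X) e * φ X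

/-- `u ∈ H¹_loc(Ω)`. -/
def MemH1loc (u : Space n → ℝ) (Ω : Set (Space n)) : Prop :=
  ∃ G : Space n → Space n, HasWeakGradientOn u G Ω ∧
    ∀ K : Set (Space n), IsCompact K → K ⊆ Ω →
      MemLp u 2 (volume.restrict K) ∧ MemLp G 2 (volume.restrict K)

/-- `∫_D |∇u|² dX`. The weak gradient is unique a.e. in `D`, so the infimum is over
a single value (and it is `∞` if `u` is not weakly differentiable in `D`). -/
def dirichletEnergy (u : Space n → ℝ) (D : Set (Space n)) : ℝ≥0∞ :=
  ⨅ (G : Space n → Space n) (_ : HasWeakGradientOn u G D), ∫⁻ X in D, ‖G X‖ₑ ^ 2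

open Classical in
/-- The precise representative of `u`: the limit of the averages of `u` over `B_r(X)` as `r → 0`
(and `0` where there is no limit). For an `H¹_loc` function the limit exists at `ℋⁿ`-almost every
point of the hyperplane `{x_{n+1} = 0}` and equals the trace of the function there. -/
def preciseRep (u : Space n → ℝ) (X : Space n) : ℝ :=
  if h : ∃ l : ℝ, Tendsto (fun r : ℝ => ⨍ Y in ball X r, u Y) (𝓝[>] 0) (𝓝 l) then h.choose else 0

/-- The set `{(x,0) ∈ D : u(x,0) > 0}`. -/
def thinPositivitySet (u : Space n → ℝ) (D : Set (Space n)) : Set (Space n) :=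
  {X | X ∈ D ∧ X (Fin.last n) = 0 ∧ 0 < preciseRep u X}

/-- The energy `E(u, D) = ∫_D |∇u|² dX + ℋⁿ({(x,0) ∈ D : u(x,0) > 0})`, where `ℋⁿ` is normalized
so as to agree with Lebesgue measure on `n`-dimensional Euclidean spaces. -/
def energy (u : Space n → ℝ) (D : Set (Space n)) : ℝ≥0∞ :=
  dirichletEnergy u D + Measure.euclideanHausdorffMeasure n (thinPositivitySet u D)

/-- `u` is a (local) minimizer of `E` in `Ω`: `u ∈ H¹_loc(Ω)`, and `E(u, D) ≤ E(v, D)` for every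
domain `D ⊂⊂ Ω` and every `v ∈ H¹_loc(Ω)` that coincides with `u` in a neighborhood of `Ω \ D`. -/
def IsMinimizer (u : Space n → ℝ) (Ω : Set (Space n)) : Prop :=
  MemH1loc u Ω ∧
    ∀ D : Set (Space n), IsOpen D → IsConnected D → IsCompact (closure D) → closure D ⊆ Ω →
      ∀ v : Space n → ℝ, MemH1loc v Ω →
        (∃ U : Set (Space n), IsOpen U ∧ Ω \ D ⊆ U ∧ ∀ᵐ X ∂volume.restrict (U ∩ Ω), v X = u X) →
          energy u D ≤ energy v D

/-- The reflection `(x, x_{n+1}) ↦ (x, -x_{n+1})`. -/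
def reflectLast (X : Space n) : Space n :=
  WithLp.toLp 2 fun i => if i = Fin.last n then -X i else X i

open Classical in
/-- The pointwise values on the closed ball `{|X| ≤ R}` of a function `u` on `B_R`: the precise
representative inside `B_R`, and its radial limits (the trace of `u`, and `0` where there is no
limit) on `∂B_R`. -/
def closedBallRep (R : ℝ) (u : Space n → ℝ) (X : Space n) : ℝ :=
  if ‖X‖ < R then preciseRep u X
  else if h : ∃ l : ℝ, Tendsto (fun s : ℝ => preciseRep u (s • X)) (𝓝[<] 1) (𝓝 l) then h.choose
  else 0

/-- The surface integral `∫_{∂B_r} f dσ = rⁿ ∫_{∂B_1} f(rθ) dσ(θ)` in `ℝ^{n+1}`. -/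
def sphereIntegral (r : ℝ) (f : Space n → ℝ) : ℝ :=
  r ^ n * ∫ θ : sphere (0 : Space n) 1, f (r • (θ : Space n))
    ∂(volume : Measure (Space n)).toSphere

/-- `Φ_u(r) = r^{-n} E(u, B_r) - ½ r^{-n-1} ∫_{∂B_r} u² dσ`, for `u` given on `B_R` and
`0 < r ≤ R`. -/
def weissEnergy (R : ℝ) (u : Space n → ℝ) (r : ℝ) : ℝ :=
  (r ^ n)⁻¹ * (energy u (ball 0 r)).toReal
    - 1 / 2 * (r ^ (n + 1))⁻¹ * sphereIntegral r (fun X => closedBallRep R u X ^ 2)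

/-- The radii `0 < r ≤ R` for which `E(u, B_r) < ∞`. -/
def admissibleRadii (R : ℝ) (u : Space n → ℝ) : Set ℝ :=
  {r | 0 < r ∧ r ≤ R ∧ energy u (ball 0 r) ≠ ⊤}

/-- `u` is homogeneous of degree `1/2` in `B_R`. -/
def IsHomogeneousHalf (R : ℝ) (u : Space n → ℝ) : Prop :=
  ∀ X ∈ ball (0 : Space n) R, ∀ t : ℝ, 0 < t → t • X ∈ ball (0 : Space n) R →
    preciseRep u (t • X) = t ^ (1 / 2 : ℝ) * preciseRep u X

end ThinOnePhase

end

/-! The proof compares `u` with two one-parameter families built from a radial profile `ζ`, writing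
`ζ = ζ(|X|²)` and `G = ∇u`. The inner variation moves the domain by `X ↦ (1 + εζ)X`. This map
preserves the hyperplane, so the thin measure changes through an `n`-dimensional Jacobian. The outer
variation replaces `u` by `(1 + εζ)u`, which leaves the thin positivity set unchanged up to a null
set. Stationarity at `ε = 0` gives `integral_radialData_inner` and `integral_radialData_outer`. In
their sum the same factor `nζ + 2|X|²ζ'` multiplies both `|G|²` and the thin measure.

The profile is chosen so that this factor becomes explicit: for `|X|^{-n} - b^{-n}`, frozen for `|X|
≤ a` and zero for `|X| ≥ b`, it equals `n a^{-n} 1_{B_a} - n b^{-n} 1_{B_b}` up to null sets. The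
truncation is only Lipschitz, so it is reached through `C¹` cutoffs. The limit,
`IsMinimizer.energy_sub_energy`, expresses `b^{-n}E(u,B_b) - a^{-n}E(u,B_a)` as the annulus integral
of `|X|^{-n-2}(2⟨X,G⟩² - u⟨X,G⟩)`. Differentiating `u(sθ)²/s` along rays expresses the increment of
`s^{-1}∫ u(sθ)² dσ(θ)` as the annulus integral of `|X|^{-n-2}(2u⟨X,G⟩ - u²)`
(`integral_sq_sphere_sub`). Subtracting half of the second from the first completes a square
(`IsMinimizer.weissEnergy_sub`): `Φ(b) - Φ(a) = 2∫ |X|^{-n-2}(⟨X,G⟩ - u/2)²`. Hence `Φ` is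
nondecreasing, and it is constant exactly when Euler's relation `⟨X,G⟩ = u/2` holds a.e., which
integrates along rays to homogeneity of degree 1/2.

The remaining work concerns pointwise values. Where the energy in `B_r(X)` is `O(rⁿ)`, an `L¹`
Poincaré inequality makes the oscillation `O(√r)`, so `X` is a Lebesgue point. Differentiation of
measures gives this growth at almost every point of the hyperplane and at every point of almost
every ray inside the ball away from the origin. So the positivity set can be transported by `C¹`
diffeomorphisms, and `u` is the primitive of its radial derivative on almost every ray. The endpoint
`r = R` is reached by left continuity of `Φ` (`tendsto_weissEnergy`). -/

open MeasureTheory Filter Topology Metric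
open scoped ENNReal ContDiff

noncomputable section

namespace ThinOnePhase

/-! ### Mollification and `L¹` convergence. -/

section Mollification

open ContinuousLinearMap Convolution

variable {E F : Type*} [NormedAddCommGroup E] [InnerProductSpace ℝ E] [FiniteDimensional ℝ E]
  [MeasurableSpace E] [BorelSpace E] [NormedAddCommGroup F] [NormedSpace ℝ F]

/-- Convolution of `f` with a normalized bump function. -/
def mollify (φ : ContDiffBump (0 : E)) (f : E → F) : E → F :=
  φ.normed volume ⋆[lsmul ℝ ℝ, volume] f

lemma mollify_apply (φ : ContDiffBump (0 : E)) (f : E → F) (x : E) :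
    mollify φ f x = ∫ y, φ.normed volume (x - y) • f y := by
  rw [mollify, convolution_lsmul, ← integral_sub_left_eq_self _ volume x]
  simp

lemma integrable_mollify (φ : ContDiffBump (0 : E)) {f : E → F} (hf : Integrable f) :
    Integrable (mollify φ f) :=
  Integrable.integrable_convolution _ φ.integrable_normed hf

lemma mollify_sub (φ : ContDiffBump (0 : E)) {f g : E → F} (hf : LocallyIntegrable f)
    (hg : LocallyIntegrable g) (x : E) :
    mollify φ (f - g) x = mollify φ f x - mollify φ g x := by
  have key : ∀ h : E → F, LocallyIntegrable h →
      Integrable (fun t => φ.normed volume t • h (x - t)) := fun h hh =>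
    (φ.hasCompactSupport_normed.convolutionExists_left (lsmul ℝ ℝ) φ.continuous_normed hh) x
  simp only [mollify, convolution_lsmul, Pi.sub_apply, smul_sub]
  exact integral_sub (key f hf) (key g hg)

lemma contDiff_mollify (φ : ContDiffBump (0 : E)) {f : E → F} (hf : LocallyIntegrable f) :
    ContDiff ℝ ∞ (mollify φ f) :=
  φ.hasCompactSupport_normed.contDiff_convolution_left _ (φ.contDiff_normed (n := ⊤)) hf

/-- The kernel is nonnegative with mass one, so `|φ ⋆ f| ≤ φ ⋆ |f|` and the right side has the same
integral as `|f|`. This contraction lets density of continuous functions suffice for `L¹`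
convergence. -/
lemma integral_norm_mollify_le (φ : ContDiffBump (0 : E)) {f : E → F} (hf : Integrable f) :
    ∫ x, ‖mollify φ f x‖ ≤ ∫ x, ‖f x‖ := by
  have h1 : ∀ x, ‖mollify φ f x‖ ≤ mollify φ (fun y => ‖f y‖) x := by
    intro x
    simp only [mollify, convolution_lsmul]
    refine (norm_integral_le_integral_norm _).trans_eq ?_
    refine integral_congr_ae (Eventually.of_forall fun t => ?_)
    simp [norm_smul, abs_of_nonneg (φ.nonneg_normed t)]
  have h2 : ∫ x, mollify φ (fun y => ‖f y‖) x = ∫ x, ‖f x‖ := by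
    rw [mollify, integral_convolution _ φ.integrable_normed hf.norm, φ.integral_normed]
    simp
  rw [← h2]
  exact integral_mono (integrable_mollify φ hf).norm (integrable_mollify φ hf.norm) h1

variable [CompleteSpace F]

lemma tendsto_integral_norm_mollify_sub_of_continuous {φ : ℕ → ContDiffBump (0 : E)}
    (hφ : Tendsto (fun k => (φ k).rOut) atTop (𝓝 0)) {g : E → F} (hg : Continuous g)
    (hgs : HasCompactSupport g) :
    Tendsto (fun k => ∫ x, ‖mollify (φ k) g x - g x‖) atTop (𝓝 0) := by
  have hS : IsCompact (cthickening 1 (tsupport g)) := hgs.cthickening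
  set S := cthickening 1 (tsupport g) with hSdef
  have hSm : MeasurableSet S := hS.measurableSet
  rw [Metric.tendsto_atTop]
  intro ε hε
  set V := volume.real S
  have hV : 0 ≤ V := measureReal_nonneg
  -- The difference lives on `S`, of volume `V`; this tolerance integrates to less than `ε`, and `V
  -- + 1` covers `V = 0`.
  obtain ⟨δ, hδ, hδ'⟩ := Metric.uniformContinuous_iff.1
    (hgs.uniformContinuous_of_continuous hg) (ε / (2 * (V + 1))) (by positivity)
  obtain ⟨k₀, hk₀⟩ := (Metric.tendsto_atTop.1 hφ) (min δ 1) (by positivity)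
  refine ⟨k₀, fun k hk => ?_⟩
  have hr := hk₀ k hk
  rw [Real.dist_eq, sub_zero, abs_of_pos (φ k).rOut_pos, lt_min_iff] at hr
  have hb : ∀ x, ‖mollify (φ k) g x - g x‖ ≤ S.indicator (fun _ => ε / (2 * (V + 1))) x := by
    intro x
    rw [← dist_eq_norm]
    by_cases hx : x ∈ S
    · rw [Set.indicator_of_mem hx]
      refine ContDiffBump.dist_normed_convolution_le hg.aestronglyMeasurable fun y hy => ?_
      exact (hδ' ((mem_ball.1 hy).trans hr.1)).le
    · rw [Set.indicator_of_notMem hx]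
      refine ContDiffBump.dist_normed_convolution_le hg.aestronglyMeasurable fun y hy => ?_
      have hz : ∀ z, dist z x < 1 → g z = 0 := by
        intro z hz
        by_contra hne
        exact hx (mem_cthickening_of_dist_le x z 1 _ (subset_tsupport g hne)
          (by rw [dist_comm]; exact hz.le))
      rw [hz y ((mem_ball.1 hy).trans hr.2), hz x (by simp)]
      simp
  have hint : ∫ x, ‖mollify (φ k) g x - g x‖ ≤ V * (ε / (2 * (V + 1))) := by
    have h2 : Integrable (S.indicator (fun _ => ε / (2 * (V + 1)))) :=
      (integrableOn_const hS.measure_lt_top.ne).integrable_indicator hSm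
    have h3 := hg.integrable_of_hasCompactSupport hgs (μ := volume)
    refine (integral_mono ((integrable_mollify _ h3).sub h3).norm h2 hb).trans_eq ?_
    rw [integral_indicator hSm, setIntegral_const, smul_eq_mul]
  rw [Real.dist_eq, sub_zero, abs_of_nonneg (integral_nonneg fun _ => norm_nonneg _)]
  refine hint.trans_lt ?_
  rw [mul_div_assoc', div_lt_iff₀ (by positivity)]
  nlinarith

lemma tendsto_integral_norm_mollify_sub {φ : ℕ → ContDiffBump (0 : E)}
    (hφ : Tendsto (fun k => (φ k).rOut) atTop (𝓝 0)) {f : E → F} (hf : Integrable f) :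
    Tendsto (fun k => ∫ x, ‖mollify (φ k) f x - f x‖) atTop (𝓝 0) := by
  rw [Metric.tendsto_atTop]
  intro ε hε
  obtain ⟨g, hgs, hfg, hgc, hgi⟩ := hf.exists_hasCompactSupport_integral_sub_le
    (ε := ε / 4) (by positivity)
  obtain ⟨k₀, hk₀⟩ := Metric.tendsto_atTop.1
    (tendsto_integral_norm_mollify_sub_of_continuous hφ hgc hgs) (ε / 4) (by positivity)
  refine ⟨k₀, fun k hk => ?_⟩
  have h1 := hk₀ k hk
  rw [Real.dist_eq, sub_zero, abs_of_nonneg (integral_nonneg fun _ => norm_nonneg _)] at h1 ⊢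
  have h2 := integral_norm_mollify_le (φ k) (hf.sub hgi)
  have hd : Integrable (fun x => ‖mollify (φ k) (f - g) x‖) := (integrable_mollify _ (hf.sub hgi)).norm
  have he : Integrable (fun x => ‖mollify (φ k) g x - g x‖) := ((integrable_mollify _ hgi).sub hgi).norm
  have hh : Integrable (fun x => ‖f x - g x‖) := (hf.sub hgi).norm
  have h3 : ∫ x, ‖mollify (φ k) f x - f x‖ ≤
      ∫ x, (‖mollify (φ k) (f - g) x‖ + ‖mollify (φ k) g x - g x‖ + ‖f x - g x‖) := by
    refine integral_mono ((integrable_mollify _ hf).sub hf).norm ((hd.add he).add hh) fun x => ?_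
    have : mollify (φ k) f x - f x = mollify (φ k) (f - g) x + (mollify (φ k) g x - g x)
        - (f x - g x) := by
      rw [mollify_sub _ hf.locallyIntegrable hgi.locallyIntegrable]; abel
    simp only
    rw [this]
    exact (norm_sub_le _ _).trans (add_le_add_left (norm_add_le _ _) _)
  have h4 : ∫ x, (‖mollify (φ k) (f - g) x‖ + ‖mollify (φ k) g x - g x‖ + ‖f x - g x‖) =
      (∫ x, ‖mollify (φ k) (f - g) x‖) + (∫ x, ‖mollify (φ k) g x - g x‖) + ∫ x, ‖f x - g x‖ := by
    rw [← integral_add hd he]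
    exact integral_add (hd.add he) hh
  simp only [Pi.sub_apply] at h2
  linarith

lemma fderiv_mollify_apply (φ : ContDiffBump (0 : E)) {f : E → ℝ} (hf : LocallyIntegrable f)
    (x e : E) :
    fderiv ℝ (mollify φ f) x e = ∫ y, fderiv ℝ (φ.normed volume) (x - y) e * f y := by
  have h := (φ.hasCompactSupport_normed (μ := volume)).hasFDerivAt_convolution_left (𝕜 := ℝ)
    (lsmul ℝ ℝ) (φ.contDiff_normed (n := 1)) hf x
  have hci : ConvolutionExistsAt (fderiv ℝ (φ.normed volume)) f x ((lsmul ℝ ℝ).precompL E) volume :=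
    (φ.hasCompactSupport_normed.fderiv ℝ).convolutionExists_left _
      ((φ.contDiff_normed (n := 1)).continuous_fderiv (by simp)) hf x
  rw [mollify, h.fderiv, convolution_def, ContinuousLinearMap.integral_apply hci,
    ← integral_sub_left_eq_self _ volume x]
  simp [precompL_apply]

end Mollification


/-! ### Smooth approximation of weakly differentiable functions. -/

section WeakGradient

open ContinuousLinearMap Convolution

variable {n : ℕ}

/-- `X` is a Lebesgue point of `u` with value `c`. -/
def IsLebesguePoint (u : Space n → ℝ) (c : ℝ) (X : Space n) : Prop :=
  Tendsto (fun r : ℝ => ⨍ Y in ball X r, |u Y - c|) (𝓝[>] 0) (𝓝 0)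

/-- The translate `Y ↦ φ(X - Y)` is supported in `S ⊆ Ω`, hence is an admissible test function. The
sign from differentiating `X - Y` in `Y` cancels the sign in the weak formulation. -/
lemma HasWeakGradientOn.fderiv_mollify {u : Space n → ℝ} {G : Space n → Space n}
    {Ω : Set (Space n)} (h : HasWeakGradientOn u G Ω) {S : Set (Space n)} (hS : IsCompact S)
    (hSΩ : S ⊆ Ω) (φ : ContDiffBump (0 : Space n)) {X : Space n}
    (hX : closedBall X φ.rOut ⊆ S) (e : Space n) :
    fderiv ℝ (mollify φ (S.indicator u)) X e = inner ℝ (mollify φ (S.indicator G) X) e := by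
  have hSm := hS.measurableSet
  have hui : LocallyIntegrable (S.indicator u) :=
    ((h.locInt.integrableOn_compact_subset hSΩ hS).integrable_indicator hSm).locallyIntegrable
  have hGi : LocallyIntegrable (S.indicator G) :=
    ((h.locInt_grad.integrableOn_compact_subset hSΩ hS).integrable_indicator hSm).locallyIntegrable
  set f := φ.normed (volume : Measure (Space n)) with hf
  have hψ : ContDiff ℝ ∞ (fun Y => f (X - Y)) :=
    (φ.contDiff_normed (n := ⊤)).comp (contDiff_const.sub contDiff_id)
  have hsupp : Function.support (fun Y => f (X - Y)) ⊆ closedBall X φ.rOut := by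
    intro Y hY
    have : X - Y ∈ Function.support f := hY
    rw [hf, φ.support_normed_eq, mem_ball_zero_iff, ← dist_eq_norm] at this
    rw [mem_closedBall, dist_comm]; exact this.le
  have htsupp : tsupport (fun Y => f (X - Y)) ⊆ closedBall X φ.rOut :=
    closure_minimal hsupp isClosed_closedBall
  have hderiv : ∀ Y, fderiv ℝ (fun Y => f (X - Y)) Y e = - fderiv ℝ f (X - Y) e := by
    intro Y
    have hd : HasFDerivAt f (fderiv ℝ f (X - Y)) (X - Y) :=
      (((φ.contDiff_normed (n := 1)).differentiable (by simp)) _).hasFDerivAt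
    have := hd.comp Y ((hasFDerivAt_const X Y).sub (hasFDerivAt_id Y))
    rw [show (fun Y => f (X - Y)) = f ∘ (fun Y => X - Y) from rfl]
    erw [this.fderiv]
    simp
  have hzero : ∀ Y ∉ S, f (X - Y) = 0 := fun Y hY => by
    by_contra hne; exact hY (hX (hsupp hne))
  have hzero' : ∀ Y ∉ S, fderiv ℝ (fun Y => f (X - Y)) Y e = 0 := fun Y hY => by
    have : Y ∉ tsupport (fderiv ℝ (fun Y => f (X - Y))) := fun hm =>
      hY (hX (htsupp (tsupport_fderiv_subset ℝ hm)))
    rw [image_eq_zero_of_notMem_tsupport this]; rfl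
  have key := h.integral_eq _ hψ
    (HasCompactSupport.intro hS fun Y hY => hzero Y hY) (htsupp.trans (hX.trans hSΩ)) e
  rw [fderiv_mollify_apply φ hui, mollify_apply]
  have e1 : ∫ Y, fderiv ℝ f (X - Y) e * S.indicator u Y
      = - ∫ Y in Ω, u Y * fderiv ℝ (fun Y => f (X - Y)) Y e := by
    rw [← integral_neg, setIntegral_eq_integral_of_forall_compl_eq_zero]
    · refine integral_congr_ae (Eventually.of_forall fun Y => ?_)
      by_cases hY : Y ∈ S
      · simp [hY, hderiv]; ring
      · have := hzero' Y hY
        simp [hY, this]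
    · intro Y hY
      simp [hzero' Y fun hm => hY (hSΩ hm)]
  have hint : Integrable (fun Y => f (X - Y) • S.indicator G Y) := by
    have := ((φ.hasCompactSupport_normed (μ := volume)).convolutionExists_left (lsmul ℝ ℝ)
      φ.continuous_normed hGi) X
    have h2 := this.integrable.comp_sub_left X
    simpa using h2
  have e2 : inner ℝ (∫ Y, f (X - Y) • S.indicator G Y) e
      = ∫ Y in Ω, inner ℝ (G Y) e * f (X - Y) := by
    rw [real_inner_comm, ← integral_inner hint, setIntegral_eq_integral_of_forall_compl_eq_zero]
    · refine integral_congr_ae (Eventually.of_forall fun Y => ?_)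
      by_cases hY : Y ∈ S
      · simp [hY, inner_smul_right, real_inner_comm, mul_comm]
      · simp [hY, hzero Y hY]
    · intro Y hY
      simp [hzero Y fun hm => hY (hSΩ hm)]
  rw [e1, e2, key, neg_neg]

/-- A bump whose outer radius is at most `C` times its inner radius is bounded by `C^{n+1}/|B_r|`,
with `r` the outer radius. The error at `X` is therefore dominated by the mean of `|u - c|` over
`B_r(X)`. -/
lemma IsLebesguePoint.tendsto_mollify {u f : Space n → ℝ} {c : ℝ} {X : Space n}
    (h : IsLebesguePoint u c X) {φ : ℕ → ContDiffBump (0 : Space n)}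
    (hφ : Tendsto (fun k => (φ k).rOut) atTop (𝓝 0)) {C : ℝ}
    (hC : ∀ k, (φ k).rOut ≤ C * (φ k).rIn) (hf : LocallyIntegrable f)
    (hfu : ∀ k, ∀ Y ∈ ball X (φ k).rOut, f Y = u Y) :
    Tendsto (fun k => mollify (φ k) f X) atTop (𝓝 c) := by
  have hr : Tendsto (fun k => (φ k).rOut) atTop (𝓝[>] 0) :=
    tendsto_nhdsWithin_iff.2 ⟨hφ, Eventually.of_forall fun k => (φ k).rOut_pos⟩
  have h1 := (h.comp hr).const_mul (C ^ Module.finrank ℝ (Space n))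
  rw [mul_zero] at h1
  rw [tendsto_iff_norm_sub_tendsto_zero]
  refine squeeze_zero (fun _ => norm_nonneg _) (fun k => ?_) h1
  set r := (φ k).rOut with hrdef
  have hrpos : 0 < r := (φ k).rOut_pos
  set p := (φ k).normed (volume : Measure (Space n)) with hp
  have hint : Integrable (fun Y => p (X - Y) • f Y) := by
    have := (((φ k).hasCompactSupport_normed (μ := volume)).convolutionExists_left (lsmul ℝ ℝ)
      (φ k).continuous_normed hf) X
    simpa using this.integrable.comp_sub_left X
  have hint1 : Integrable (fun Y => p (X - Y)) := (φ k).integrable_normed.comp_sub_left X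
  have hone : ∫ Y, p (X - Y) = 1 := by
    rw [integral_sub_left_eq_self p volume X]; exact (φ k).integral_normed
  have e1 : mollify (φ k) f X - c = ∫ Y in ball X r, p (X - Y) * (u Y - c) := by
    rw [mollify_apply, setIntegral_eq_integral_of_forall_compl_eq_zero]
    · have : c = ∫ Y, p (X - Y) * c := by rw [integral_mul_const, hone, one_mul]
      conv_lhs => rw [this]
      rw [← integral_sub hint (hint1.mul_const c)]
      refine integral_congr_ae (Eventually.of_forall fun Y => ?_)
      by_cases hY : Y ∈ ball X r
      · simp only [smul_eq_mul, hfu k Y hY]; ring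
      · have : p (X - Y) = 0 := by
          by_contra hne
          have hm : X - Y ∈ Function.support p := hne
          rw [hp, (φ k).support_normed_eq, mem_ball_zero_iff, ← dist_eq_norm, dist_comm] at hm
          exact hY hm
        simp [this]
    · intro Y hY
      have : p (X - Y) = 0 := by
        by_contra hne
        have hm : X - Y ∈ Function.support p := hne
        rw [hp, (φ k).support_normed_eq, mem_ball_zero_iff, ← dist_eq_norm, dist_comm] at hm
        exact hY hm
      simp [this]
  have hui : IntegrableOn (fun Y => u Y - c) (ball X r) := by
    refine Integrable.sub ?_ (integrableOn_const measure_ball_lt_top.ne)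
    exact (((hf.integrableOn_isCompact (isCompact_closedBall X r)).mono_set
      ball_subset_closedBall).congr_fun (fun Y hY => hfu k Y hY) measurableSet_ball)
  rw [e1]
  refine (norm_integral_le_integral_norm _).trans ?_
  have hv : volume.real (closedBall (0 : Space n) r) = volume.real (ball X r) := by
    rw [measureReal_def, measureReal_def, Measure.addHaar_closedBall_eq_addHaar_ball,
      Measure.addHaar_ball_center volume X]
  simp only [Function.comp, setAverage_eq, smul_eq_mul, ← mul_assoc]
  rw [← integral_const_mul]
  refine integral_mono_of_nonneg (Eventually.of_forall fun _ => norm_nonneg _)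
    (hui.abs.const_mul _) (Eventually.of_forall fun Y => ?_)
  simp only [norm_mul, Real.norm_eq_abs]
  gcongr
  rw [abs_of_nonneg ((φ k).nonneg_normed _), ← hv, ← div_eq_mul_inv]
  exact (φ k).normed_le_div_measure_closedBall_rOut volume C (hC k) _

/-- Local `L¹` approximation of a weakly differentiable function by smooth functions. -/
lemma HasWeakGradientOn.exists_smooth_approx {u : Space n → ℝ} {G : Space n → Space n}
    {Ω : Set (Space n)} (h : HasWeakGradientOn u G Ω) (hΩ : IsOpen Ω) {K : Set (Space n)}
    (hK : IsCompact K) (hKΩ : K ⊆ Ω) :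
    ∃ w : ℕ → Space n → ℝ, (∀ k, ContDiff ℝ ∞ (w k)) ∧
      Tendsto (fun k => ∫⁻ X in K, ‖w k X - u X‖ₑ) atTop (𝓝 0) ∧
      Tendsto (fun k => ∫⁻ X in K, ‖gradient (w k) X - G X‖ₑ) atTop (𝓝 0) ∧
      ∀ X ∈ K, ∀ c, IsLebesguePoint u c X → Tendsto (fun k => w k X) atTop (𝓝 c) := by
  obtain ⟨δ, hδ, hδΩ⟩ := hK.exists_cthickening_subset_open hΩ hKΩ
  set S := cthickening δ K
  have hS : IsCompact S := hK.cthickening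
  have hSm := hS.measurableSet
  have hui := (h.locInt.integrableOn_compact_subset hδΩ hS).integrable_indicator hSm
  have hGi := (h.locInt_grad.integrableOn_compact_subset hδΩ hS).integrable_indicator hSm
  -- Outer radii at most `δ` keep the kernels centred in `K` inside `S`; the fixed ratio 2 of the
  -- radii provides the constant for convergence at Lebesgue points.
  let φ : ℕ → ContDiffBump (0 : Space n) := fun k =>
    ⟨δ / (2 * (k + 1)), δ / (k + 1), by positivity, by
      rw [div_lt_div_iff_of_pos_left hδ (by positivity) (by positivity)]
      have : (0 : ℝ) < k + 1 := by positivity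
      linarith⟩
  have hφ : Tendsto (fun k => (φ k).rOut) atTop (𝓝 0) := by
    have := (tendsto_one_div_add_atTop_nhds_zero_nat (𝕜 := ℝ)).const_mul δ
    simpa [φ, div_eq_mul_inv] using this
  have hle : ∀ k, (φ k).rOut ≤ δ := fun k => by
    change δ / ((k : ℝ) + 1) ≤ δ
    exact div_le_self hδ.le (by linarith [(Nat.cast_nonneg k : (0 : ℝ) ≤ k)])
  have hsub : ∀ k, ∀ X ∈ K, closedBall X (φ k).rOut ⊆ S := fun k X hX =>
    (closedBall_subset_closedBall (hle k)).trans (closedBall_subset_cthickening hX δ)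
  have hKS : K ⊆ S := self_subset_cthickening K
  refine ⟨fun k => mollify (φ k) (S.indicator u),
    fun k => contDiff_mollify _ hui.locallyIntegrable, ?_, ?_, ?_⟩
  · have h1 := tendsto_integral_norm_mollify_sub hφ hui
    have h2 := (ENNReal.continuous_ofReal.tendsto 0).comp h1
    rw [ENNReal.ofReal_zero] at h2
    refine tendsto_of_tendsto_of_tendsto_of_le_of_le tendsto_const_nhds h2 (fun _ => zero_le) ?_
    intro k
    simp only [Function.comp]
    have hi : Integrable (fun X => mollify (φ k) (S.indicator u) X - S.indicator u X) :=
      (integrable_mollify _ hui).sub hui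
    rw [ofReal_integral_norm_eq_lintegral_enorm hi]
    refine le_trans ?_ (setLIntegral_le_lintegral K _)
    refine setLIntegral_mono_ae' hK.measurableSet (Eventually.of_forall fun X hX => ?_)
    simp [hKS hX]
  · have h1 := tendsto_integral_norm_mollify_sub hφ hGi
    have h2 := (ENNReal.continuous_ofReal.tendsto 0).comp h1
    rw [ENNReal.ofReal_zero] at h2
    refine tendsto_of_tendsto_of_tendsto_of_le_of_le tendsto_const_nhds h2 (fun _ => zero_le) ?_
    intro k
    simp only [Function.comp]
    have hi : Integrable (fun X => mollify (φ k) (S.indicator G) X - S.indicator G X) :=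
      (integrable_mollify _ hGi).sub hGi
    rw [ofReal_integral_norm_eq_lintegral_enorm hi]
    refine le_trans ?_ (setLIntegral_le_lintegral K _)
    refine setLIntegral_mono_ae' hK.measurableSet (Eventually.of_forall fun X hX => ?_)
    have : gradient (mollify (φ k) (S.indicator u)) X = mollify (φ k) (S.indicator G) X := by
      refine ext_inner_right ℝ fun e => ?_
      rw [← h.fderiv_mollify hS hδΩ (φ k) (hsub k X hX) e, gradient,
        InnerProductSpace.toDual_symm_apply]
    simp [hKS hX, this]
  · intro X hX c hc
    refine hc.tendsto_mollify hφ (C := 2) (fun k => ?_) hui.locallyIntegrable fun k Y hY => ?_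
    · change δ / ((k : ℝ) + 1) ≤ 2 * (δ / (2 * (k + 1)))
      apply le_of_eq; field_simp
    · exact Set.indicator_of_mem (hsub k X hX (ball_subset_closedBall hY)) _

end WeakGradient

/-! ### Poincaré inequality in `L¹` and a criterion for Lebesgue points. -/

section Poincare

variable {n : ℕ}

lemma enorm_gradient (w : Space n → ℝ) (X : Space n) : ‖gradient w X‖ₑ = ‖fderiv ℝ w X‖ₑ := by
  rw [← toDual_gradient (𝕜 := ℝ), LinearIsometryEquiv.enorm_map]

lemma lintegral_comp_smul_add {f : Space n → ℝ≥0∞} (hf : Measurable f) (a : Space n) {t : ℝ}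
    (ht : 0 < t) :
    ∫⁻ y, f (a + t • y) = ENNReal.ofReal ((t ^ (n + 1))⁻¹) * ∫⁻ z, f z := by
  have h1 : ∫⁻ y, f (a + t • y) = ∫⁻ z, f (a + z) ∂(Measure.map (t • ·) volume) := by
    rw [lintegral_map (by fun_prop) (by fun_prop)]
  rw [h1, Measure.map_addHaar_smul volume ht.ne', lintegral_smul_measure,
    lintegral_add_left_eq_self, finrank_euclideanSpace_fin, abs_of_pos (by positivity), smul_eq_mul]

lemma setLIntegral_ball_segment_le {F : Space n → ℝ≥0∞} (hF : Measurable F) (X : Space n) (r : ℝ)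
    {t : ℝ} (ht : 1 / 2 ≤ t) (ht1 : t ≤ 1) {x : Space n} (hx : x ∈ ball X r) :
    ∫⁻ y in ball X r, F ((1 - t) • x + t • y) ≤ 2 ^ (n + 1) * ∫⁻ z in ball X r, F z := by
  have hm : Measurable ((ball X r).indicator F) := hF.indicator measurableSet_ball
  calc ∫⁻ y in ball X r, F ((1 - t) • x + t • y)
      ≤ ∫⁻ y in ball X r, (ball X r).indicator F ((1 - t) • x + t • y) := by
        refine setLIntegral_mono' measurableSet_ball fun y hy => ?_
        rw [Set.indicator_of_mem]
        exact (convex_ball X r) hx hy (by linarith) (by linarith) (by ring)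
    _ ≤ ∫⁻ y, (ball X r).indicator F ((1 - t) • x + t • y) := setLIntegral_le_lintegral _ _
    _ = ENNReal.ofReal ((t ^ (n + 1))⁻¹) * ∫⁻ z in ball X r, F z := by
        rw [lintegral_comp_smul_add hm _ (by linarith), lintegral_indicator measurableSet_ball]
    _ ≤ _ := by
        gcongr
        rw [← ENNReal.ofReal_ofNat, ← ENNReal.ofReal_pow (by norm_num)]
        apply ENNReal.ofReal_le_ofReal
        rw [← inv_pow]
        gcongr
        rw [inv_le_comm₀ (by linarith) (by norm_num)]
        linarith

/-- One of `t`, `1 - t` is at least 1/2. Dilating in the corresponding variable costs a Jacobian of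
at most `2^{n+1}`, and convexity keeps the segment in the ball; Tonelli exchanges the roles of `x`
and `y`. -/
lemma lintegral_lintegral_ball_segment_le {F : Space n → ℝ≥0∞} (hF : Measurable F) (X : Space n)
    (r : ℝ) {t : ℝ} (ht : 0 ≤ t) (ht1 : t ≤ 1) :
    ∫⁻ x in ball X r, ∫⁻ y in ball X r, F ((1 - t) • x + t • y)
      ≤ 2 ^ (n + 1) * volume (ball X r) * ∫⁻ z in ball X r, F z := by
  have hc : ∀ A : ℝ≥0∞, ∫⁻ _ in ball X r, A = A * volume (ball X r) := fun A => by simp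
  rcases le_total (1 / 2) t with h | h
  · calc _ ≤ ∫⁻ x in ball X r, 2 ^ (n + 1) * ∫⁻ z in ball X r, F z :=
          setLIntegral_mono' measurableSet_ball fun x hx => setLIntegral_ball_segment_le hF X r h ht1 hx
      _ = _ := by rw [hc]; ring
  · rw [lintegral_lintegral_swap (by
      apply Measurable.aemeasurable
      exact hF.comp (by fun_prop))]
    calc _ ≤ ∫⁻ x in ball X r, 2 ^ (n + 1) * ∫⁻ z in ball X r, F z := by
          refine setLIntegral_mono' measurableSet_ball fun y hy => ?_
          have := setLIntegral_ball_segment_le hF X r (t := 1 - t) (by linarith) (by linarith) hy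
          simpa [add_comm] using this
      _ = _ := by rw [hc]; ring

/-- The difference is the integral of the derivative along the segment, whose length is at most
`2r`. Integrating over `x` and `y` before `t` reduces the bound to the preceding segment estimate.
-/
lemma lintegral_lintegral_enorm_sub_le_of_contDiff {w : Space n → ℝ} (hw : ContDiff ℝ 1 w)
    (X : Space n) (r : ℝ) :
    ∫⁻ x in ball X r, ∫⁻ y in ball X r, ‖w x - w y‖ₑ ≤
      2 ^ (n + 2) * ENNReal.ofReal r * volume (ball X r) * ∫⁻ z in ball X r, ‖gradient w z‖ₑ := by
  set F : Space n → ℝ≥0∞ := fun z => ‖fderiv ℝ w z‖ₑ with hFdef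
  have hFc : Continuous (fun z => fderiv ℝ w z) := hw.continuous_fderiv (by simp)
  have hF : Measurable F := by fun_prop
  have hpt : ∀ x ∈ ball X r, ∀ y ∈ ball X r, ‖w x - w y‖ₑ ≤
      ∫⁻ t in Set.Ioc (0 : ℝ) 1, F ((1 - t) • x + t • y) * ENNReal.ofReal (2 * r) := by
    intro x hx y hy
    have hd : ∀ t : ℝ, HasDerivAt (fun t : ℝ => w ((1 - t) • x + t • y))
        (fderiv ℝ w ((1 - t) • x + t • y) (y - x)) t := by
      intro t
      have h1 : HasDerivAt (fun t : ℝ => (1 - t) • x + t • y) (y - x) t := by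
        have := (((hasDerivAt_const t (1 : ℝ)).sub (hasDerivAt_id t)).smul_const x).add
          ((hasDerivAt_id t).smul_const y)
        convert! this using 1
        simp; abel
      exact ((hw.differentiable (by simp)) _).hasFDerivAt.comp_hasDerivAt t h1
    have hcont : Continuous fun t : ℝ => fderiv ℝ w ((1 - t) • x + t • y) (y - x) := by
      exact (hFc.comp (by fun_prop)).clm_apply continuous_const
    have hftc := intervalIntegral.integral_eq_sub_of_hasDerivAt (a := 0) (b := 1)
      (fun t _ => hd t) (hcont.intervalIntegrable _ _)
    have hd' : dist y x ≤ 2 * r := by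
      have := dist_triangle_right y x X
      linarith [mem_ball.1 hx, mem_ball.1 hy]
    have hxy : ‖w x - w y‖ₑ = ‖∫ t in Set.Ioc (0 : ℝ) 1,
        fderiv ℝ w ((1 - t) • x + t • y) (y - x)‖ₑ := by
      rw [← intervalIntegral.integral_of_le zero_le_one, hftc, ← enorm_neg]
      simp
    rw [hxy]
    refine (enorm_integral_le_lintegral_enorm _).trans (lintegral_mono fun t => ?_)
    refine (ContinuousLinearMap.le_opENorm _ _).trans ?_
    gcongr
    rw [← ofReal_norm, ← dist_eq_norm]
    exact ENNReal.ofReal_le_ofReal hd'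
  have hmeas : Measurable fun p : Space n × Space n × ℝ =>
      F ((1 - p.2.2) • p.1 + p.2.2 • p.2.1) * ENNReal.ofReal (2 * r) :=
    (hF.comp (by fun_prop)).mul_const _
  calc ∫⁻ x in ball X r, ∫⁻ y in ball X r, ‖w x - w y‖ₑ
      ≤ ∫⁻ x in ball X r, ∫⁻ y in ball X r, ∫⁻ t in Set.Ioc (0 : ℝ) 1,
          F ((1 - t) • x + t • y) * ENNReal.ofReal (2 * r) :=
        setLIntegral_mono' measurableSet_ball fun x hx =>
          setLIntegral_mono' measurableSet_ball fun y hy => hpt x hx y hy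
    _ = ∫⁻ x in ball X r, ∫⁻ t in Set.Ioc (0 : ℝ) 1, ∫⁻ y in ball X r,
          F ((1 - t) • x + t • y) * ENNReal.ofReal (2 * r) := by
        refine lintegral_congr fun x => lintegral_lintegral_swap ?_
        exact (hmeas.comp (f := fun q : Space n × ℝ => (x, q)) (by fun_prop)).aemeasurable
    _ = ∫⁻ t in Set.Ioc (0 : ℝ) 1, ∫⁻ x in ball X r, ∫⁻ y in ball X r,
          F ((1 - t) • x + t • y) * ENNReal.ofReal (2 * r) := by
        refine lintegral_lintegral_swap (Measurable.aemeasurable ?_)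
        refine Measurable.lintegral_prod_right' (f := fun q : (Space n × ℝ) × Space n =>
          F ((1 - q.1.2) • q.1.1 + q.1.2 • q.2) * ENNReal.ofReal (2 * r)) ?_
        exact hmeas.comp (f := fun q : (Space n × ℝ) × Space n => (q.1.1, q.2, q.1.2))
          (by fun_prop)
    _ ≤ ∫⁻ t in Set.Ioc (0 : ℝ) 1, (2 ^ (n + 1) * volume (ball X r) * ∫⁻ z in ball X r, F z) *
          ENNReal.ofReal (2 * r) := by
        refine setLIntegral_mono' measurableSet_Ioc fun t ht => ?_
        have h1 : ∀ x, ∫⁻ y in ball X r, F ((1 - t) • x + t • y) * ENNReal.ofReal (2 * r) =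
            (∫⁻ y in ball X r, F ((1 - t) • x + t • y)) * ENNReal.ofReal (2 * r) := fun x =>
          lintegral_mul_const _ (hF.comp (by fun_prop))
        simp_rw [h1]
        rw [lintegral_mul_const _ (Measurable.lintegral_prod_right'
          (f := fun q : Space n × Space n => F ((1 - t) • q.1 + t • q.2))
          (hF.comp (by fun_prop)))]
        gcongr
        exact lintegral_lintegral_ball_segment_le hF X r ht.1.le ht.2
    _ = _ := by
        simp only [lintegral_const, Measure.restrict_apply_univ, Real.volume_Ioc, sub_zero,
          ENNReal.ofReal_one, mul_one, enorm_gradient]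
        rw [ENNReal.ofReal_mul (by norm_num), ENNReal.ofReal_ofNat]
        ring

/-- An `L¹` Poincaré inequality on balls. -/
lemma HasWeakGradientOn.lintegral_lintegral_enorm_sub_le {u : Space n → ℝ} {G : Space n → Space n}
    {Ω : Set (Space n)} (h : HasWeakGradientOn u G Ω) (hΩ : IsOpen Ω) {X : Space n} {r : ℝ}
    (hX : closedBall X r ⊆ Ω) :
    ∫⁻ x in ball X r, ∫⁻ y in ball X r, ‖u x - u y‖ₑ ≤
      2 ^ (n + 2) * ENNReal.ofReal r * volume (ball X r) * ∫⁻ z in ball X r, ‖G z‖ₑ := by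
  obtain ⟨w, hw, hwu, hwG, -⟩ := h.exists_smooth_approx hΩ (isCompact_closedBall X r) hX
  set B := ball X r
  set C : ℝ≥0∞ := 2 ^ (n + 2) * ENNReal.ofReal r * volume B with hC
  have hVtop : volume B ≠ ⊤ := measure_ball_lt_top.ne
  have hCtop : C ≠ ⊤ := by
    refine ENNReal.mul_ne_top (ENNReal.mul_ne_top (by simp) (by simp)) hVtop
  have hBu : ∀ k, ∫⁻ x in B, ‖w k x - u x‖ₑ ≤ ∫⁻ x in closedBall X r, ‖w k x - u x‖ₑ :=
    fun k => lintegral_mono_set ball_subset_closedBall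
  have hBG : ∀ k, ∫⁻ x in B, ‖gradient (w k) x - G x‖ₑ ≤
      ∫⁻ x in closedBall X r, ‖gradient (w k) x - G x‖ₑ :=
    fun k => lintegral_mono_set ball_subset_closedBall
  -- This bound for the left side differs from the target only by `L¹` errors of `w k` and its
  -- gradient. The factor 2 comes from replacing `u` at both `x` and `y`.
  have hlim : Tendsto (fun k => 2 * volume B * (∫⁻ x in closedBall X r, ‖w k x - u x‖ₑ) +
      C * ((∫⁻ x in closedBall X r, ‖gradient (w k) x - G x‖ₑ) + ∫⁻ z in B, ‖G z‖ₑ)) atTop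
      (𝓝 (2 * volume B * 0 + C * (0 + ∫⁻ z in B, ‖G z‖ₑ))) := by
    refine (ENNReal.Tendsto.const_mul hwu (Or.inr (by finiteness))).add ?_
    exact ENNReal.Tendsto.const_mul (hwG.add tendsto_const_nhds) (Or.inr hCtop)
  rw [mul_zero, zero_add, zero_add] at hlim
  refine ge_of_tendsto' hlim fun k => ?_
  have hwk : Continuous (w k) := (hw k).continuous
  have hgk : Continuous (gradient (w k)) :=
    (InnerProductSpace.toDual ℝ (Space n)).symm.continuous.comp
      ((hw k).continuous_fderiv (by simp))
  have hA : Measurable fun p : Space n × Space n => ‖w k p.1 - w k p.2‖ₑ := by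
    have : Continuous fun p : Space n × Space n => w k p.1 - w k p.2 := by fun_prop
    exact this.measurable.enorm
  have inner : ∀ x, ∫⁻ y in B, ‖u x - u y‖ₑ ≤ (∫⁻ y in B, ‖w k x - w k y‖ₑ) +
      (‖w k x - u x‖ₑ * volume B + ∫⁻ y in B, ‖w k y - u y‖ₑ) := by
    intro x
    have : ∀ y, ‖u x - u y‖ₑ ≤ ‖w k x - w k y‖ₑ + (‖w k x - u x‖ₑ + ‖w k y - u y‖ₑ) := by
      intro y
      have : u x - u y = (w k x - w k y) + (-(w k x - u x) + (w k y - u y)) := by ring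
      rw [this]
      refine (enorm_add_le _ _).trans (add_le_add_right ((enorm_add_le _ _).trans_eq ?_) _)
      rw [enorm_neg]
    have hAx : Measurable fun y => ‖w k x - w k y‖ₑ :=
      hA.comp (g := fun p : Space n × Space n => ‖w k p.1 - w k p.2‖ₑ) (f := fun y => (x, y))
        (by fun_prop)
    refine (lintegral_mono this).trans_eq ?_
    rw [lintegral_add_left hAx,
      lintegral_add_left measurable_const]
    simp
  refine (lintegral_mono inner).trans ?_
  rw [lintegral_add_left (Measurable.lintegral_prod_right' hA),
    lintegral_add_right _ measurable_const, lintegral_mul_const' _ _ hVtop, lintegral_const,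
    Measure.restrict_apply_univ]
  have hG : ∫⁻ z in B, ‖gradient (w k) z‖ₑ ≤
      (∫⁻ x in closedBall X r, ‖gradient (w k) x - G x‖ₑ) + ∫⁻ z in B, ‖G z‖ₑ := by
    refine le_trans ?_ (add_le_add_left (hBG k) _)
    rw [← lintegral_add_right' _ ((h.locInt_grad.integrableOn_compact_subset hX
      (isCompact_closedBall X r)).mono_set ball_subset_closedBall).1.enorm]
    refine lintegral_mono fun z => ?_
    have : gradient (w k) z = (gradient (w k) z - G z) + G z := by abel
    conv_lhs => rw [this]
    exact enorm_add_le _ _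
  calc _ ≤ C * ((∫⁻ x in closedBall X r, ‖gradient (w k) x - G x‖ₑ) + ∫⁻ z in B, ‖G z‖ₑ) +
        ((∫⁻ x in closedBall X r, ‖w k x - u x‖ₑ) * volume B +
          (∫⁻ x in closedBall X r, ‖w k x - u x‖ₑ) * volume B) := by
        gcongr
        · exact (lintegral_lintegral_enorm_sub_le_of_contDiff ((hw k).of_le (by simp)) X r).trans
            (mul_le_mul_right hG _)
        · exact ball_subset_closedBall
        · exact ball_subset_closedBall
    _ = _ := by ring

/-- The real form of the Poincaré inequality, under a growth assumption on the energy. -/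
lemma HasWeakGradientOn.average_abs_sub_average_le {u : Space n → ℝ} {G : Space n → Space n}
    {Ω : Set (Space n)} (h : HasWeakGradientOn u G Ω) (hΩ : IsOpen Ω) {X : Space n} {r M : ℝ}
    (hr : 0 < r) (hM : 0 ≤ M) (hX : closedBall X r ⊆ Ω)
    (hG : ∫⁻ Y in ball X r, ‖G Y‖ₑ ^ 2 ≤ ENNReal.ofReal (M * r ^ n)) :
    ⨍ Y in ball X r, |u Y - ⨍ Z in ball X r, u Z| ≤
      2 ^ (n + 2) * (M / volume.real (ball (0 : Space n) 1) + 1) * √r := by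
  set B := ball X r with hB
  set κ := volume.real (ball (0 : Space n) 1) with hκ
  have hκpos : 0 < κ := ENNReal.toReal_pos (measure_ball_pos _ _ one_pos).ne' measure_ball_lt_top.ne
  have hV : volume.real B = r ^ (n + 1) * κ := by
    rw [hB, measureReal_def, Measure.addHaar_ball _ _ hr.le, finrank_euclideanSpace_fin,
      ENNReal.toReal_mul, ENNReal.toReal_ofReal (by positivity), hκ, measureReal_def]
  have hVpos : 0 < volume.real B := by rw [hV]; positivity
  have hVtop : volume B ≠ ⊤ := measure_ball_lt_top.ne
  have hV' : volume B = ENNReal.ofReal (r ^ (n + 1) * κ) := by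
    rw [← hV, measureReal_def, ENNReal.ofReal_toReal hVtop]
  have hui : IntegrableOn u B := (h.locInt.integrableOn_compact_subset hX
    (isCompact_closedBall X r)).mono_set ball_subset_closedBall
  have hsr : 0 < √r := Real.sqrt_pos.2 hr
  have hG1 : ∫⁻ Y in B, ‖G Y‖ₑ ≤ ENNReal.ofReal ((M + κ) * (r ^ n * √r)) := by
    -- Young's inequality with weight `√r`: the energy `M rⁿ` and the volume `κ r^{n+1}` then
    -- contribute the same power `rⁿ√r`.
    have hpt : ∀ Y, ‖G Y‖ₑ ≤ ENNReal.ofReal (√r) * ‖G Y‖ₑ ^ 2 + ENNReal.ofReal ((√r)⁻¹) := by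
      intro Y
      rw [← ofReal_norm, ← ENNReal.ofReal_pow (norm_nonneg _), ← ENNReal.ofReal_mul hsr.le,
        ← ENNReal.ofReal_add (by positivity) (by positivity)]
      apply ENNReal.ofReal_le_ofReal
      rw [← sub_nonneg]
      have : √r * ‖G Y‖ ^ 2 + (√r)⁻¹ - ‖G Y‖ =
          √r * ((‖G Y‖ - (√r)⁻¹ / 2) ^ 2 + 3 / 4 * (√r)⁻¹ ^ 2) := by
        field_simp; ring
      rw [this]; positivity
    refine (lintegral_mono hpt).trans ?_
    rw [lintegral_add_right _ measurable_const, lintegral_const_mul' _ _ (by simp),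
      lintegral_const, Measure.restrict_apply_univ, hV', ← ENNReal.ofReal_mul (by positivity)]
    refine (add_le_add_left (mul_le_mul_right hG _) _).trans_eq ?_
    rw [← ENNReal.ofReal_mul hsr.le, ← ENNReal.ofReal_add (by positivity) (by positivity)]
    congr 1
    have : r = √r * √r := (Real.mul_self_sqrt hr.le).symm
    rw [pow_succ]
    field_simp
    nlinarith [Real.mul_self_sqrt hr.le]
  have hD := h.lintegral_lintegral_enorm_sub_le hΩ hX
  have hD2 : ∫⁻ x in B, ∫⁻ y in B, ‖u x - u y‖ₑ ≤
      ENNReal.ofReal (2 ^ (n + 2) * r * (r ^ (n + 1) * κ) * ((M + κ) * (r ^ n * √r))) := by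
    refine hD.trans ?_
    rw [ENNReal.ofReal_mul (by positivity), ENNReal.ofReal_mul (by positivity),
      ENNReal.ofReal_mul (by positivity), ENNReal.ofReal_pow (by norm_num), ENNReal.ofReal_ofNat,
      ← hV']
    gcongr
  have hpt : ∀ x, ‖u x - ⨍ Z in B, u Z‖ₑ * volume B ≤ ∫⁻ y in B, ‖u x - u y‖ₑ := by
    intro x
    have h1 : (u x - ⨍ Z in B, u Z) * volume.real B = ∫ y in B, (u x - u y) := by
      have hic : IntegrableOn (fun _ : Space n => u x) B := integrableOn_const hVtop
      rw [integral_sub hic hui, setIntegral_const, setAverage_eq]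
      simp only [smul_eq_mul]; field_simp
    have h2 : volume B = ‖volume.real B‖ₑ := by
      rw [Real.enorm_eq_ofReal measureReal_nonneg, measureReal_def, ENNReal.ofReal_toReal hVtop]
    rw [h2, ← enorm_mul, h1]
    exact enorm_integral_le_lintegral_enorm _
  have hfin : (∫⁻ x in B, ‖u x - ⨍ Z in B, u Z‖ₑ) * volume B ≤
      ENNReal.ofReal (2 ^ (n + 2) * r * (r ^ (n + 1) * κ) * ((M + κ) * (r ^ n * √r))) := by
    rw [← lintegral_mul_const' _ _ hVtop]
    exact (lintegral_mono hpt).trans hD2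
  have hi : IntegrableOn (fun x => u x - ⨍ Z in B, u Z) B := hui.sub (integrableOn_const hVtop)
  rw [← ofReal_integral_norm_eq_lintegral_enorm hi, hV', ← ENNReal.ofReal_mul (by positivity),
    ENNReal.ofReal_le_ofReal_iff (by positivity)] at hfin
  rw [setAverage_eq, hV, smul_eq_mul, inv_mul_le_iff₀ (by positivity)]
  simp only [Real.norm_eq_abs] at hfin
  have hpos : 0 < r ^ (n + 1) * κ := by positivity
  refine le_of_mul_le_mul_right (hfin.trans_eq ?_) hpos
  field_simp
  ring

lemma setAverage_ball_le {f : Space n → ℝ} (hf : ∀ x, 0 ≤ f x) {X : Space n} {r s : ℝ}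
    (hs : 0 < s) (hsr : s ≤ r) (hrs : r ≤ 2 * s) (hi : IntegrableOn f (ball X r)) :
    ⨍ Y in ball X s, f Y ≤ 2 ^ (n + 1) * ⨍ Y in ball X r, f Y := by
  set κ := volume.real (ball (0 : Space n) 1) with hκ
  have hκpos : 0 < κ := ENNReal.toReal_pos (measure_ball_pos _ _ one_pos).ne' measure_ball_lt_top.ne
  have hV : ∀ t, 0 < t → volume.real (ball X t) = t ^ (n + 1) * κ := fun t ht => by
    rw [measureReal_def, Measure.addHaar_ball _ _ ht.le, finrank_euclideanSpace_fin,
      ENNReal.toReal_mul, ENNReal.toReal_ofReal (by positivity), hκ, measureReal_def]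
  have hr : 0 < r := hs.trans_le hsr
  have h1 : ∫ Y in ball X s, f Y ≤ ∫ Y in ball X r, f Y :=
    setIntegral_mono_set hi (Eventually.of_forall hf) (ball_subset_ball hsr).eventuallyLE
  have h0 : 0 ≤ ∫ Y in ball X r, f Y := integral_nonneg hf
  rw [setAverage_eq, setAverage_eq, hV s hs, hV r hr, smul_eq_mul, smul_eq_mul,
    inv_mul_le_iff₀ (by positivity)]
  have h2 : r ^ (n + 1) ≤ 2 ^ (n + 1) * s ^ (n + 1) := by
    rw [← mul_pow]; gcongr
  calc _ ≤ 1 * ∫ Y in ball X r, f Y := by rw [one_mul]; exact h1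
    _ ≤ (2 ^ (n + 1) * s ^ (n + 1) / r ^ (n + 1)) * ∫ Y in ball X r, f Y := by
        gcongr
        rw [le_div_iff₀ (by positivity), one_mul]; exact h2
    _ = _ := by field_simp

lemma abs_average_sub_le {f : Space n → ℝ} {s : Set (Space n)} (hs : volume s ≠ ⊤)
    (hs0 : volume s ≠ 0) (hf : IntegrableOn f s) (c : ℝ) :
    |(⨍ Y in s, f Y) - c| ≤ ⨍ Y in s, |f Y - c| := by
  have hpos : 0 < volume.real s := ENNReal.toReal_pos hs0 hs
  have : (⨍ Y in s, f Y) - c = (volume.real s)⁻¹ * ∫ Y in s, (f Y - c) := by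
    rw [integral_sub hf (integrableOn_const hs), setIntegral_const, setAverage_eq]
    simp only [smul_eq_mul]; field_simp
  rw [this, abs_mul, abs_of_pos (inv_pos.2 hpos), setAverage_eq, smul_eq_mul]
  gcongr
  exact abs_integral_le_integral_abs

/-- Points where the energy grows like `rⁿ` are Lebesgue points. -/
lemma HasWeakGradientOn.exists_isLebesguePoint {u : Space n → ℝ} {G : Space n → Space n}
    {Ω : Set (Space n)} (h : HasWeakGradientOn u G Ω) (hΩ : IsOpen Ω) {X : Space n} {ρ M : ℝ}
    (hρ : 0 < ρ) (hM : 0 ≤ M) (hX : closedBall X ρ ⊆ Ω)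
    (hG : ∀ r, 0 < r → r ≤ ρ → ∫⁻ Y in ball X r, ‖G Y‖ₑ ^ 2 ≤ ENNReal.ofReal (M * r ^ n)) :
    ∃ c, IsLebesguePoint u c X := by
  set C := 2 ^ (n + 2) * (M / volume.real (ball (0 : Space n) 1) + 1) with hC
  have hC0 : 0 ≤ C := by positivity
  have hosc : ∀ r, 0 < r → r ≤ ρ → ⨍ Y in ball X r, |u Y - ⨍ Z in ball X r, u Z| ≤ C * √r :=
    fun r hr hrρ => h.average_abs_sub_average_le hΩ hr hM
      ((closedBall_subset_closedBall hrρ).trans hX) (hG r hr hrρ)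
  have hui : ∀ r, r ≤ ρ → IntegrableOn u (ball X r) := fun r hr =>
    (h.locInt.integrableOn_compact_subset hX (isCompact_closedBall X ρ)).mono_set
      (ball_subset_closedBall.trans (closedBall_subset_closedBall hr))
  have hVtop : ∀ r, volume (ball X r) ≠ ⊤ := fun r => measure_ball_lt_top.ne
  have hV0 : ∀ r, 0 < r → volume (ball X r) ≠ 0 := fun r hr => (measure_ball_pos _ _ hr).ne'
  -- Along dyadic radii the means differ by at most a constant times `√(q k)`, a geometric sequence
  -- of ratio `θ = √(1/2)`. They therefore converge to the candidate value `c`.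
  let q : ℕ → ℝ := fun k => ρ * (1 / 2) ^ k
  have hq : ∀ k, 0 < q k := fun k => by positivity
  have hqρ : ∀ k, q k ≤ ρ := fun k =>
    mul_le_of_le_one_right hρ.le (pow_le_one₀ (by norm_num) (by norm_num))
  have hqs : ∀ k, q (k + 1) = q k / 2 := fun k => by simp only [q, pow_succ]; ring
  let θ : ℝ := √(1 / 2)
  have hθ1 : θ < 1 := by
    rw [show (1 : ℝ) = √1 by simp]; exact Real.sqrt_lt_sqrt (by norm_num) (by norm_num)
  have hqsqrt : ∀ k, √(q k) = √ρ * θ ^ k := fun k => by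
    simp only [q, θ]
    rw [Real.sqrt_mul hρ.le, Real.sqrt_eq_rpow (_ ^ k), Real.sqrt_eq_rpow (1 / 2),
      ← Real.rpow_natCast, ← Real.rpow_natCast, ← Real.rpow_mul (by norm_num),
      ← Real.rpow_mul (by norm_num), mul_comm, mul_comm (k : ℝ)]
    ring
  let m : ℕ → ℝ := fun k => ⨍ Y in ball X (q k), u Y
  have hstep : ∀ k, dist (m k) (m (k + 1)) ≤ 2 ^ (n + 1) * C * √ρ * θ ^ k := by
    intro k
    rw [dist_comm, Real.dist_eq]
    calc _ ≤ ⨍ Y in ball X (q (k + 1)), |u Y - m k| :=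
          abs_average_sub_le (hVtop _) (hV0 _ (hq _)) (hui _ (hqρ _)) _
      _ ≤ 2 ^ (n + 1) * ⨍ Y in ball X (q k), |u Y - m k| := by
          refine setAverage_ball_le (fun _ => abs_nonneg _) (hq _) ?_ ?_ ?_
          · rw [hqs]; linarith [hq k]
          · rw [hqs]; linarith
          · exact ((hui _ (hqρ _)).sub (integrableOn_const (hVtop _))).abs
      _ ≤ 2 ^ (n + 1) * (C * √(q k)) := by
          gcongr; exact hosc _ (hq k) (hqρ k)
      _ = _ := by rw [hqsqrt]; ring
  obtain ⟨c, hc⟩ := cauchySeq_tendsto_of_complete (cauchySeq_of_le_geometric θ _ hθ1 hstep)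
  have hmc := dist_le_of_le_geometric_of_tendsto θ _ hθ1 hstep hc
  refine ⟨c, ?_⟩
  set A := 2 ^ (n + 1) * (C + 2 ^ (n + 1) * C / (1 - θ)) * √2 with hA
  have hbound : ∀ r, 0 < r → r ≤ ρ → ⨍ Y in ball X r, |u Y - c| ≤ A * √r := by
    intro r hr hrρ
    -- An arbitrary radius lies between consecutive dyadic ones; passing to the larger ball costs a
    -- factor `2^{n+1}` in averages.
    obtain ⟨k, hk1, hk2⟩ := exists_nat_pow_near_of_lt_one (x := r / ρ) (y := 1 / 2)
      (by positivity) ((div_le_one hρ).2 hrρ) (by norm_num) (by norm_num)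
    have hk1' : q (k + 1) < r := by
      rw [lt_div_iff₀ hρ] at hk1; simpa [q, mul_comm] using hk1
    have hk2' : r ≤ q k := by
      rw [div_le_iff₀ hρ] at hk2; simpa [q, mul_comm] using hk2
    rw [hqs] at hk1'
    have hiu := hui _ (hqρ k)
    have hi1 : IntegrableOn (fun Y => |u Y - m k|) (ball X (q k)) :=
      (hiu.sub (integrableOn_const (hVtop _))).abs
    calc _ ≤ 2 ^ (n + 1) * ⨍ Y in ball X (q k), |u Y - c| := by
          refine setAverage_ball_le (fun _ => abs_nonneg _) hr hk2' (by linarith) ?_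
          exact (hiu.sub (integrableOn_const (hVtop _))).abs
      _ ≤ 2 ^ (n + 1) * ((⨍ Y in ball X (q k), |u Y - m k|) + |m k - c|) := by
          gcongr
          have hpos : 0 < volume.real (ball X (q k)) := ENNReal.toReal_pos (hV0 _ (hq k)) (hVtop _)
          have : |m k - c| = (volume.real (ball X (q k)))⁻¹ * ∫ _ in ball X (q k), |m k - c| := by
            rw [setIntegral_const, smul_eq_mul]; field_simp
          rw [this, setAverage_eq, setAverage_eq, smul_eq_mul, smul_eq_mul, ← mul_add,
            ← integral_add hi1 (integrableOn_const (hVtop _))]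
          refine mul_le_mul_of_nonneg_left ?_ (inv_nonneg.2 measureReal_nonneg)
          have hic : IntegrableOn (fun Y => |u Y - c|) (ball X (q k)) :=
            (hiu.sub (integrableOn_const (hVtop _))).abs
          exact integral_mono hic (hi1.add (integrableOn_const (hVtop _))) fun Y =>
            abs_sub_le _ _ _
      _ ≤ 2 ^ (n + 1) * (C * √(q k) + 2 ^ (n + 1) * C * √ρ / (1 - θ) * θ ^ k) := by
          gcongr
          · exact hosc _ (hq k) (hqρ k)
          · have := hmc k
            rw [Real.dist_eq] at this
            refine this.trans_eq (by ring)
      _ = 2 ^ (n + 1) * (C + 2 ^ (n + 1) * C / (1 - θ)) * √(q k) := by rw [hqsqrt]; ring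
      _ ≤ 2 ^ (n + 1) * (C + 2 ^ (n + 1) * C / (1 - θ)) * (√2 * √r) := by
          have : 0 < 1 - θ := by linarith
          rw [← Real.sqrt_mul (by norm_num)]
          gcongr
          linarith
      _ = _ := by rw [hA]; ring
  refine squeeze_zero' (Eventually.of_forall fun r => ?_)
    (g := fun r => A * √r) ?_ ?_
  · rw [setAverage_eq]
    exact smul_nonneg (inv_nonneg.2 measureReal_nonneg) (integral_nonneg fun _ => abs_nonneg _)
  · filter_upwards [Ioc_mem_nhdsGT hρ] with r hr using hbound r hr.1 hr.2
  · have : Tendsto (fun r => A * √r) (𝓝 0) (𝓝 (A * √0)) :=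
      (Real.continuous_sqrt.tendsto 0).const_mul A
    rw [Real.sqrt_zero, mul_zero] at this
    exact this.mono_left nhdsWithin_le_nhds

lemma IsLebesguePoint.tendsto_average {u : Space n → ℝ} {c : ℝ} {X : Space n}
    (h : IsLebesguePoint u c X) {ρ : ℝ} (hρ : 0 < ρ) (hu : IntegrableOn u (ball X ρ)) :
    Tendsto (fun r : ℝ => ⨍ Y in ball X r, u Y) (𝓝[>] 0) (𝓝 c) := by
  rw [tendsto_iff_norm_sub_tendsto_zero]
  refine squeeze_zero' (Eventually.of_forall fun r => norm_nonneg _) ?_ h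
  filter_upwards [Ioc_mem_nhdsGT hρ] with r hr
  exact abs_average_sub_le measure_ball_lt_top.ne (measure_ball_pos _ _ hr.1).ne'
    (hu.mono_set (ball_subset_ball hr.2)) c

lemma preciseRep_eq_of_tendsto {u : Space n → ℝ} {c : ℝ} {X : Space n}
    (h : Tendsto (fun r : ℝ => ⨍ Y in ball X r, u Y) (𝓝[>] 0) (𝓝 c)) : preciseRep u X = c := by
  have hex : ∃ l : ℝ, Tendsto (fun r : ℝ => ⨍ Y in ball X r, u Y) (𝓝[>] 0) (𝓝 l) := ⟨c, h⟩
  rw [preciseRep, dif_pos hex]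
  exact tendsto_nhds_unique hex.choose_spec h

lemma IsLebesguePoint.preciseRep_eq {u : Space n → ℝ} {c : ℝ} {X : Space n}
    (h : IsLebesguePoint u c X) {ρ : ℝ} (hρ : 0 < ρ) (hu : IntegrableOn u (ball X ρ)) :
    preciseRep u X = c :=
  preciseRep_eq_of_tendsto (h.tendsto_average hρ hu)

end Poincare

/-! ### Polar coordinates as a measure-preserving map. -/

section Polar

variable {n : ℕ}

/-- The surface measure of the unit sphere. -/
abbrev sphereMeasure (n : ℕ) : Measure (sphere (0 : Space n) 1) :=
  (volume : Measure (Space n)).toSphere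

/-- The radial measure `sⁿ ds` on `(0, ∞)`. -/
def radialMeasure (n : ℕ) : Measure ℝ :=
  (volume.restrict (Set.Ioi (0 : ℝ))).withDensity fun s => ENNReal.ofReal (s ^ n)

instance : SFinite (radialMeasure n) := by unfold radialMeasure; infer_instance

lemma measurePreserving_coe_volumeIoiPow :
    MeasurePreserving ((↑) : Set.Ioi (0 : ℝ) → ℝ) (Measure.volumeIoiPow n) (radialMeasure n) := by
  refine ⟨measurable_subtype_coe, ?_⟩
  ext s hs
  rw [Measure.map_apply measurable_subtype_coe hs, Measure.volumeIoiPow, radialMeasure,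
    withDensity_apply _ (measurable_subtype_coe hs), withDensity_apply _ hs,
    ← map_comap_subtype_coe measurableSet_Ioi, Measure.restrict_map measurable_subtype_coe hs,
    lintegral_map (by fun_prop) measurable_subtype_coe]

/-- Polar coordinates. -/
lemma measurePreserving_polar :
    MeasurePreserving (fun p : sphere (0 : Space n) 1 × ℝ => p.2 • (p.1 : Space n))
      ((sphereMeasure n).prod (radialMeasure n)) volume := by
  have h1 := (Measure.measurePreserving_homeomorphUnitSphereProd (volume : Measure (Space n)))
  have hd : Module.finrank ℝ (Space n) - 1 = n := by simp
  rw [hd] at h1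
  have h2 := (MeasurePreserving.id (sphereMeasure n)).prod
    (measurePreserving_coe_volumeIoiPow (n := n))
  have h3 : MeasurePreserving (Subtype.val : ({0}ᶜ : Set (Space n)) → Space n)
      (Measure.comap Subtype.val volume) volume := by
    refine ⟨measurable_subtype_coe, ?_⟩
    rw [map_comap_subtype_coe (measurableSet_singleton _).compl]
    exact Measure.restrict_eq_self_of_ae_mem (by simp [ae_iff])
  refine ⟨by fun_prop, ?_⟩
  have h4 : MeasurePreserving (homeomorphUnitSphereProd (Space n)).symm
      ((sphereMeasure n).prod (Measure.volumeIoiPow n)) (Measure.comap Subtype.val volume) :=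
    h1.symm (e := (homeomorphUnitSphereProd (Space n)).toMeasurableEquiv)
  rw [← h2.map_eq, Measure.map_map (by fun_prop) h2.measurable, ← (h3.comp h4).map_eq]
  congr 1

lemma ae_ray_of_ae {P : Space n → Prop} (h : ∀ᵐ X, P X) :
    ∀ᵐ θ : sphere (0 : Space n) 1 ∂sphereMeasure n, ∀ᵐ s : ℝ, 0 < s → P (s • (θ : Space n)) := by
  have h1 := measurePreserving_polar.quasiMeasurePreserving.ae h
  have h2 : ∀ᵐ θ : sphere (0 : Space n) 1 ∂sphereMeasure n, ∀ᵐ s ∂radialMeasure n, P (s • (θ : Space n)) :=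
    Measure.ae_ae_of_ae_prod h1
  filter_upwards [h2] with θ hθ
  rw [radialMeasure, ae_withDensity_iff (by fun_prop), ae_restrict_iff' measurableSet_Ioi] at hθ
  filter_upwards [hθ] with s hs hpos
  exact hs hpos (by simp [pow_pos hpos])

lemma lintegral_polar {f : Space n → ℝ≥0∞} (hf : AEMeasurable f) :
    ∫⁻ X, f X = ∫⁻ θ : sphere (0 : Space n) 1, (∫⁻ s in Set.Ioi (0 : ℝ),
      ENNReal.ofReal (s ^ n) * f (s • (θ : Space n))) ∂sphereMeasure n := by
  have hf' : AEMeasurable (fun p : sphere (0 : Space n) 1 × ℝ => f (p.2 • (p.1 : Space n)))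
      ((sphereMeasure n).prod (radialMeasure n)) :=
    hf.comp_quasiMeasurePreserving measurePreserving_polar.quasiMeasurePreserving
  rw [← measurePreserving_polar.map_eq, lintegral_map' (by rwa [measurePreserving_polar.map_eq])
    (by fun_prop), lintegral_prod _ hf']
  refine lintegral_congr_ae ?_
  filter_upwards [hf'.aestronglyMeasurable.prodMk_left] with θ hθ
  rw [radialMeasure, lintegral_withDensity_eq_lintegral_mul₀' (by fun_prop)]
  · rfl
  · exact hθ.aemeasurable

end Polar

/-! ### Energy growth of order `rⁿ` on the hyperplane and on rays. -/

section Density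

variable {n : ℕ}

/-- At almost every point a finite measure grows at most like the volume of balls. -/
lemma ae_exists_measure_closedBall_le {d : ℕ} (ρ : Measure (EuclideanSpace ℝ (Fin d)))
    [IsFiniteMeasure ρ] :
    ∀ᵐ x, ∃ M : ℝ, 0 ≤ M ∧ ∃ δ > 0, ∀ r, 0 < r → r < δ →
      ρ (closedBall x r) ≤ ENNReal.ofReal (M * r ^ d) := by
  filter_upwards [Besicovitch.ae_tendsto_rnDeriv ρ volume, ρ.rnDeriv_lt_top volume] with x hx hlt
  obtain ⟨m, hm1, hm2⟩ := ENNReal.lt_iff_exists_nnreal_btwn.1 hlt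
  have h1 := hx.eventually_lt_const hm1
  obtain ⟨δ, hδ, hδ'⟩ := mem_nhdsGT_iff_exists_Ioo_subset.1 h1
  set κ := volume.real (ball (0 : EuclideanSpace ℝ (Fin d)) 1) with hκ
  refine ⟨m * κ, by positivity, δ, hδ, fun r hr hrδ => ?_⟩
  have h2 : ρ (closedBall x r) / volume (closedBall x r) < m := hδ' ⟨hr, hrδ⟩
  rw [ENNReal.div_lt_iff (Or.inl (measure_closedBall_pos _ _ hr).ne')
    (Or.inl measure_closedBall_lt_top.ne), Measure.addHaar_closedBall volume _ hr.le,
    finrank_euclideanSpace_fin] at h2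
  refine h2.le.trans_eq ?_
  rw [mul_assoc, ENNReal.ofReal_mul (by positivity), ENNReal.ofReal_mul (by positivity),
    ENNReal.ofReal_coe_nnreal, hκ, measureReal_def, ENNReal.ofReal_toReal measure_ball_lt_top.ne,
    mul_comm (volume _)]

/-- The energy density of `G` grows at most like `rⁿ` at `X`. -/
def HasEnergyGrowth (G : Space n → Space n) (X : Space n) : Prop :=
  ∃ M : ℝ, 0 ≤ M ∧ ∃ δ > 0, ∀ r, 0 < r → r < δ →
    ∫⁻ Y in ball X r, ‖G Y‖ₑ ^ 2 ≤ ENNReal.ofReal (M * r ^ n)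

lemma HasWeakGradientOn.exists_isLebesguePoint_of_hasEnergyGrowth {u : Space n → ℝ}
    {G : Space n → Space n} {Ω : Set (Space n)} (h : HasWeakGradientOn u G Ω) (hΩ : IsOpen Ω)
    {X : Space n} (hX : X ∈ Ω) (hG : HasEnergyGrowth G X) : ∃ c, IsLebesguePoint u c X := by
  obtain ⟨M, hM, δ, hδ, hle⟩ := hG
  obtain ⟨ε, hε, hεΩ⟩ := nhds_basis_closedBall.mem_iff.1 (hΩ.mem_nhds hX)
  refine h.exists_isLebesguePoint hΩ (ρ := min ε (δ / 2)) (by positivity) hM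
    ((closedBall_subset_closedBall (min_le_left _ _)).trans hεΩ) fun r hr hr' => hle r hr ?_
  have := hr'.trans (min_le_right _ _)
  linarith

/-- The energy of `G` on `K`, as a measure. -/
def energyMeasure (G : Space n → Space n) (K : Set (Space n)) : Measure (Space n) :=
  (volume.restrict K).withDensity fun X => ‖G X‖ₑ ^ 2

lemma isFiniteMeasure_energyMeasure {G : Space n → Space n} {K : Set (Space n)}
    (h : ∫⁻ X in K, ‖G X‖ₑ ^ 2 ≠ ⊤) : IsFiniteMeasure (energyMeasure G K) :=
  isFiniteMeasure_withDensity h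

lemma lintegral_ball_le_energyMeasure {G : Space n → Space n} {K s : Set (Space n)} {X : Space n}
    {r : ℝ} (hK : ball X r ⊆ K) (hs : ball X r ⊆ s) :
    ∫⁻ Y in ball X r, ‖G Y‖ₑ ^ 2 ≤ energyMeasure G K s := by
  refine le_trans (le_of_eq ?_) (measure_mono hs)
  rw [energyMeasure, withDensity_apply _ measurableSet_ball,
    Measure.restrict_restrict measurableSet_ball, Set.inter_eq_left.2 hK]

/-- The embedding of `ℝⁿ` as the hyperplane `{x_{n+1} = 0}`. -/
def hyperplaneEmb (n : ℕ) (x : EuclideanSpace ℝ (Fin n)) : Space n :=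
  WithLp.toLp 2 (Fin.snoc (α := fun _ => ℝ) (fun i => x i) 0)

/-- The projection of `ℝ^{n+1}` onto `ℝⁿ`. -/
def hyperplaneProj (n : ℕ) (X : Space n) : EuclideanSpace ℝ (Fin n) :=
  WithLp.toLp 2 fun i => X i.castSucc

lemma isometry_hyperplaneEmb : Isometry (hyperplaneEmb n) := by
  refine Isometry.of_dist_eq fun x y => ?_
  simp [EuclideanSpace.dist_eq, hyperplaneEmb, Fin.sum_univ_castSucc]

lemma hyperplaneEmb_last (x : EuclideanSpace ℝ (Fin n)) : hyperplaneEmb n x (Fin.last n) = 0 := by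
  simp [hyperplaneEmb]

lemma norm_hyperplaneEmb (x : EuclideanSpace ℝ (Fin n)) : ‖hyperplaneEmb n x‖ = ‖x‖ := by
  simp [EuclideanSpace.norm_eq, hyperplaneEmb, Fin.sum_univ_castSucc]

lemma hyperplaneEmb_smul (c : ℝ) (x : EuclideanSpace ℝ (Fin n)) :
    hyperplaneEmb n (c • x) = c • hyperplaneEmb n x := by
  ext i
  refine Fin.lastCases ?_ (fun j => ?_) i <;> simp [hyperplaneEmb]

lemma hyperplaneEmb_proj {X : Space n} (hX : X (Fin.last n) = 0) :
    hyperplaneEmb n (hyperplaneProj n X) = X := by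
  ext i
  refine Fin.lastCases ?_ (fun j => ?_) i <;> simp [hyperplaneEmb, hyperplaneProj, hX]

lemma continuous_hyperplaneProj : Continuous (hyperplaneProj n) := by
  unfold hyperplaneProj; fun_prop

lemma dist_hyperplaneProj_le (X : Space n) (x : EuclideanSpace ℝ (Fin n)) :
    dist (hyperplaneProj n X) x ≤ dist X (hyperplaneEmb n x) := by
  simp only [EuclideanSpace.dist_eq, hyperplaneEmb, Fin.sum_univ_castSucc]
  apply Real.sqrt_le_sqrt
  simp [hyperplaneProj]
  positivity

lemma ball_subset_closedBall_of_norm_lt {X : Space n} {r R : ℝ} (h : r ≤ R - ‖X‖) :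
    ball X r ⊆ closedBall 0 R := by
  intro Y hY
  have h1 := mem_ball.1 hY
  have h2 := norm_le_norm_add_norm_sub' Y X
  rw [← dist_eq_norm] at h2
  rw [mem_closedBall_zero_iff]
  linarith

/-- Projecting the energy measure onto `ℝⁿ` gives a finite measure with finite upper density a.e. A
ball centred on the hyperplane projects into the `n`-dimensional ball of the same radius, so its
energy is `O(rⁿ)`. -/
lemma ae_hasEnergyGrowth_hyperplane {G : Space n → Space n} {R : ℝ}
    (hG : ∫⁻ X in closedBall (0 : Space n) R, ‖G X‖ₑ ^ 2 ≠ ⊤) :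
    ∀ᵐ x : EuclideanSpace ℝ (Fin n), ‖x‖ < R → HasEnergyGrowth G (hyperplaneEmb n x) := by
  have := isFiniteMeasure_energyMeasure hG
  filter_upwards [ae_exists_measure_closedBall_le
    ((energyMeasure G (closedBall 0 R)).map (hyperplaneProj n))] with x ⟨M, hM, δ, hδ, hle⟩ hx
  refine ⟨M, hM, min δ (R - ‖x‖), lt_min hδ (by linarith), fun r hr hrδ => ?_⟩
  refine le_trans ?_ (hle r hr (hrδ.trans_le (min_le_left _ _)))
  rw [Measure.map_apply continuous_hyperplaneProj.measurable measurableSet_closedBall]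
  refine lintegral_ball_le_energyMeasure (ball_subset_closedBall_of_norm_lt ?_) fun Y hY => ?_
  · rw [norm_hyperplaneEmb]; exact (hrδ.trans_le (min_le_right _ _)).le
  · exact (dist_hyperplaneProj_le Y x).trans (mem_ball.1 hY).le

lemma dist_normalize_le {X : Space n} {θ : sphere (0 : Space n) 1} {s r : ℝ} (hs : 0 < s)
    (hrs : r ≤ s) (hX : X ∈ ball (s • (θ : Space n)) r) :
    dist (‖X‖⁻¹ • X) (θ : Space n) ≤ 2 * r / s := by
  have hθ : ‖(θ : Space n)‖ = 1 := by simp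
  have h1 : ‖X - s • (θ : Space n)‖ < r := by rw [← dist_eq_norm]; exact hX
  have h2 : |‖X‖ - s| ≤ ‖X - s • (θ : Space n)‖ := by
    have := abs_norm_sub_norm_le X (s • (θ : Space n))
    rwa [norm_smul, hθ, mul_one, Real.norm_of_nonneg hs.le] at this
  have hXpos : 0 < ‖X‖ := by have := (abs_le.1 h2).1; linarith
  have e1 : ‖X‖⁻¹ • X - (θ : Space n) =
      s⁻¹ • (((s - ‖X‖) * ‖X‖⁻¹) • X + (X - s • (θ : Space n))) := by
    rw [smul_add, smul_sub, smul_smul, smul_smul, inv_mul_cancel₀ hs.ne', one_smul]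
    have : ‖X‖⁻¹ = s⁻¹ * ((s - ‖X‖) * ‖X‖⁻¹) + s⁻¹ := by field_simp; ring
    conv_lhs => rw [this, add_smul]
    abel
  rw [dist_eq_norm, e1, norm_smul, norm_inv, Real.norm_of_nonneg hs.le, le_div_iff₀ hs,
    inv_mul_eq_div, div_mul_cancel₀ _ hs.ne']
  refine (norm_add_le _ _).trans ?_
  rw [norm_smul, norm_mul, norm_inv, norm_norm, mul_assoc, inv_mul_cancel₀ hXpos.ne', mul_one,
    Real.norm_eq_abs, abs_sub_comm]
  linarith

/-- To bound densities on the sphere, one radial dimension is added: `ν` is the image of `μ × dt`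
under `(X,t) ↦ tX/|X|`, and differentiation of measures applies to it in `ℝ^{n+1}`. A cap of radius
`r` times an interval of length `2r` is mapped into a ball of radius `4r`, whose `ν`-measure is
`O(r^{n+1})`; dividing by the length leaves `O(rⁿ)`. -/
lemma ae_exists_measure_cap_le (μ : Measure (Space n)) [IsFiniteMeasure μ] :
    ∀ᵐ θ : sphere (0 : Space n) 1 ∂sphereMeasure n, ∃ M : ℝ, 0 ≤ M ∧ ∃ δ > 0,
      ∀ r, 0 < r → r < δ → μ {X | dist (‖X‖⁻¹ • X) (θ : Space n) ≤ r} ≤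
        ENNReal.ofReal (M * r ^ n) := by
  let ν : Measure (Space n) := (μ.prod (volume.restrict (Set.Ioo (1 / 2 : ℝ) 2))).map
    fun p => p.2 • (‖p.1‖⁻¹ • p.1)
  have hmeas : Measurable fun p : Space n × ℝ => p.2 • (‖p.1‖⁻¹ • p.1) := by fun_prop
  have hν := ae_ray_of_ae (ae_exists_measure_closedBall_le ν)
  filter_upwards [hν] with θ hθ
  have hpos : volume (Set.Ioo (1 / 2 : ℝ) 2) ≠ 0 := by
    rw [Real.volume_Ioo]; norm_num
  -- The density bound holds for almost every radius on the ray of `θ`, so some radius in the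
  -- interval can be used.
  obtain ⟨t, htI, ht⟩ := (frequently_ae_mem_iff.2 hpos).and_eventually hθ |>.exists
  obtain ⟨M, hM, δ, hδ, hle⟩ := ht (by linarith [htI.1])
  set ε := min (δ / 4) (min (t - 1 / 2) (2 - t)) with hε
  have hεpos : 0 < ε := by
    refine lt_min (by positivity) (lt_min ?_ ?_) <;> linarith [htI.1, htI.2]
  refine ⟨M * 4 ^ (n + 1), by positivity, ε, hεpos, fun r hr hrε => ?_⟩
  have hr1 : r < δ / 4 := hrε.trans_le (min_le_left _ _)
  have hr2 : r < t - 1 / 2 := hrε.trans_le ((min_le_right _ _).trans (min_le_left _ _))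
  have hr3 : r < 2 - t := hrε.trans_le ((min_le_right _ _).trans (min_le_right _ _))
  have h1 := hle (4 * r) (by positivity) (by linarith)
  rw [Measure.map_apply hmeas measurableSet_closedBall] at h1
  have h2 : {X : Space n | dist (‖X‖⁻¹ • X) (θ : Space n) ≤ r} ×ˢ Set.Ioo (t - r) (t + r) ⊆
      (fun p : Space n × ℝ => p.2 • (‖p.1‖⁻¹ • p.1)) ⁻¹' closedBall (t • (θ : Space n)) (4 * r) := by
    rintro ⟨X, a⟩ ⟨hX, ha⟩
    simp only [Set.mem_ofPred_eq] at hX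
    have ha' : |a - t| ≤ r := abs_le.2 ⟨by linarith [ha.1], by linarith [ha.2]⟩
    have hnorm : ‖‖X‖⁻¹ • X‖ ≤ 1 := by
      rw [norm_smul, norm_inv, norm_norm]
      exact inv_mul_le_one
    simp only [Set.mem_preimage, mem_closedBall, dist_eq_norm] at hX ⊢
    have : a • (‖X‖⁻¹ • X) - t • (θ : Space n) =
        (a - t) • (‖X‖⁻¹ • X) + t • (‖X‖⁻¹ • X - (θ : Space n)) := by
      rw [sub_smul, smul_sub]; abel
    rw [this]
    refine (norm_add_le _ _).trans ?_
    rw [norm_smul (a - t), norm_smul t, Real.norm_eq_abs, Real.norm_eq_abs,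
      abs_of_pos (show 0 < t by linarith [htI.1])]
    nlinarith [abs_nonneg (a - t), norm_nonneg (‖X‖⁻¹ • X), htI.1, htI.2,
      norm_nonneg (‖X‖⁻¹ • X - (θ : Space n))]
  have h3 := (measure_mono h2).trans h1
  rw [Measure.prod_prod, Measure.restrict_apply measurableSet_Ioo, Set.inter_eq_left.2
    (Set.Ioo_subset_Ioo (by linarith) (by linarith)), Real.volume_Ioo,
    show t + r - (t - r) = 2 * r by ring] at h3
  have h4 : ENNReal.ofReal (M * (4 * r) ^ (n + 1)) =
      ENNReal.ofReal (M * 4 ^ (n + 1) * r ^ n) * ENNReal.ofReal r := by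
    rw [← ENNReal.ofReal_mul (by positivity)]; congr 1; ring
  rw [h4] at h3
  refine (ENNReal.mul_le_mul_iff_left (ENNReal.ofReal_pos.2 hr).ne' ENNReal.ofReal_ne_top).1
    (le_trans ?_ h3)
  gcongr
  linarith

/-- For `r ≤ s` the ball `B_r(sθ)` lies in the cone over a cap of angular radius `2r/s`. A single
density bound at `θ` thus controls all points of the ray simultaneously, with no exceptional radii.
-/
lemma ae_hasEnergyGrowth_ray {G : Space n → Space n} {R : ℝ}
    (hG : ∫⁻ X in closedBall (0 : Space n) R, ‖G X‖ₑ ^ 2 ≠ ⊤) :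
    ∀ᵐ θ : sphere (0 : Space n) 1 ∂sphereMeasure n, ∀ s, 0 < s → s < R →
      HasEnergyGrowth G (s • (θ : Space n)) := by
  have := isFiniteMeasure_energyMeasure hG
  filter_upwards [ae_exists_measure_cap_le (energyMeasure G (closedBall 0 R))]
    with θ ⟨M, hM, δ, hδ, hle⟩ s hs hsR
  have hnorm : ‖s • (θ : Space n)‖ = s := by
    rw [norm_smul, Real.norm_of_nonneg hs.le]; simp
  refine ⟨M * (2 / s) ^ n, by positivity, min s (min (δ * s / 2) (R - s)),
    lt_min hs (lt_min (by positivity) (by linarith)), fun r hr hrδ => ?_⟩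
  obtain ⟨h1, h2⟩ := lt_min_iff.1 hrδ
  obtain ⟨h2, h3⟩ := lt_min_iff.1 h2
  have h4 : 2 * r / s < δ := by rw [div_lt_iff₀ hs]; linarith
  refine (lintegral_ball_le_energyMeasure (ball_subset_closedBall_of_norm_lt
    (by rw [hnorm]; exact h3.le)) fun X hX => dist_normalize_le hs h1.le hX).trans
    ((hle _ (by positivity) h4).trans_eq ?_)
  congr 1
  rw [mul_assoc, ← mul_pow]
  congr 2
  ring

end Density

/-! ### The fundamental theorem of calculus along almost every ray. -/

section Rays

variable {n : ℕ}

lemma exists_subseq_ae_tendsto_zero {α : Type*} [MeasurableSpace α] {μ : Measure α}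
    {f : ℕ → α → ℝ≥0∞} (hf : ∀ j, AEMeasurable (f j) μ)
    (h : Tendsto (fun j => ∫⁻ x, f j x ∂μ) atTop (𝓝 0)) :
    ∃ φ : ℕ → ℕ, StrictMono φ ∧ ∀ᵐ x ∂μ, Tendsto (fun j => f (φ j) x) atTop (𝓝 0) := by
  obtain ⟨φ, hφ, hφ'⟩ := extraction_forall_of_eventually
    (P := fun k j => ∫⁻ x, f j x ∂μ ≤ (2⁻¹ : ℝ≥0∞) ^ k)
    (fun k => (h.eventually_lt_const (ENNReal.pow_pos (by simp) k)).mono fun _ => le_of_lt)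
  refine ⟨φ, hφ, ?_⟩
  have hsum : ∫⁻ x, ∑' j, f (φ j) x ∂μ ≠ ⊤ := by
    rw [lintegral_tsum fun j => hf _]
    refine ne_top_of_le_ne_top ?_ (ENNReal.tsum_le_tsum hφ')
    rw [ENNReal.tsum_geometric]
    simp
  have hae := ae_lt_top' (AEMeasurable.tsum fun j => hf (φ j)) hsum
  filter_upwards [hae] with x hx
  exact ENNReal.tendsto_atTop_zero_of_tsum_ne_top hx.ne

lemma restrict_Ioi_absolutelyContinuous :
    volume.restrict (Set.Ioi (0 : ℝ)) ≪ radialMeasure n := by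
  refine withDensity_absolutelyContinuous' (by fun_prop) ?_
  rw [ae_restrict_iff' measurableSet_Ioi]
  refine Eventually.of_forall fun s hs => ?_
  have : 0 < s := hs
  simp [this]

lemma ae_aestronglyMeasurable_ray {F : Type*} [TopologicalSpace F]
    [TopologicalSpace.PseudoMetrizableSpace F] {f : Space n → F} (hf : AEStronglyMeasurable f) :
    ∀ᵐ θ : sphere (0 : Space n) 1 ∂sphereMeasure n,
      AEStronglyMeasurable (fun s : ℝ => f (s • (θ : Space n))) (volume.restrict (Set.Ioi 0)) := by
  have h := (hf.comp_quasiMeasurePreserving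
    (measurePreserving_polar (n := n)).quasiMeasurePreserving).prodMk_left
  filter_upwards [h] with θ hθ
  exact hθ.mono_ac restrict_Ioi_absolutelyContinuous

lemma norm_ray {θ : sphere (0 : Space n) 1} {s : ℝ} (hs : 0 ≤ s) : ‖s • (θ : Space n)‖ = s := by
  rw [norm_smul, Real.norm_of_nonneg hs]; simp

/-- Smooth approximations satisfy the identity on every ray. Polar integration of the `L¹` error of
their gradients gives, along a subsequence, `L¹` convergence on almost every ray, and the endpoint
values converge at Lebesgue points. The exceptional set of directions is independent of `a` and `b`.
-/
lemma HasWeakGradientOn.ae_ray_integral {u : Space n → ℝ} {G : Space n → Space n} {R R' : ℝ}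
    (h : HasWeakGradientOn u G (ball 0 R)) (hR' : R' < R) :
    ∀ᵐ θ : sphere (0 : Space n) 1 ∂sphereMeasure n, ∀ a b cₐ c_b : ℝ, 0 < a → a ≤ b → b ≤ R' →
      IsLebesguePoint u cₐ (a • (θ : Space n)) → IsLebesguePoint u c_b (b • (θ : Space n)) →
      IntegrableOn (fun s : ℝ => G (s • (θ : Space n))) (Set.Icc a b) ∧
        c_b - cₐ = ∫ s in a..b, inner ℝ (G (s • (θ : Space n))) (θ : Space n) := by
  set K := closedBall (0 : Space n) R' with hK
  have hKc : IsCompact K := isCompact_closedBall _ _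
  have hKm : MeasurableSet K := hKc.measurableSet
  have hKΩ : K ⊆ ball 0 R := closedBall_subset_ball hR'
  obtain ⟨w, hw, -, hwG, hwL⟩ := h.exists_smooth_approx isOpen_ball hKc hKΩ
  have hgw : ∀ j, Continuous (gradient (w j)) := fun j =>
    (InnerProductSpace.toDual ℝ (Space n)).symm.continuous.comp
      ((hw j).continuous_fderiv (by simp))
  have hGm : AEStronglyMeasurable G (volume.restrict K) :=
    (h.locInt_grad.integrableOn_compact_subset hKΩ hKc).1
  have hGK : AEStronglyMeasurable (K.indicator G) :=
    (aestronglyMeasurable_indicator_iff hKm).2 hGm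
  have hfm : ∀ j, AEMeasurable (K.indicator fun X => ‖gradient (w j) X - G X‖ₑ) := fun j =>
    (aemeasurable_indicator_iff hKm).2 ((hgw j).aestronglyMeasurable.sub hGm).enorm
  set D : ℕ → sphere (0 : Space n) 1 → ℝ≥0∞ := fun j θ => ∫⁻ s in Set.Ioi (0 : ℝ),
    ENNReal.ofReal (s ^ n) * K.indicator (fun X => ‖gradient (w j) X - G X‖ₑ) (s • (θ : Space n))
  have hDint : ∀ j, ∫⁻ θ, D j θ ∂sphereMeasure n = ∫⁻ X in K, ‖gradient (w j) X - G X‖ₑ :=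
    fun j => by rw [← lintegral_polar (hfm j), lintegral_indicator hKm]
  have hDm : ∀ j, AEMeasurable (D j) (sphereMeasure n) := by
    intro j
    have h1 : AEMeasurable (fun p : sphere (0 : Space n) 1 × ℝ =>
        K.indicator (fun X => ‖gradient (w j) X - G X‖ₑ) (p.2 • (p.1 : Space n)))
        ((sphereMeasure n).prod (volume.restrict (Set.Ioi (0 : ℝ)))) :=
      ((hfm j).comp_quasiMeasurePreserving measurePreserving_polar.quasiMeasurePreserving).mono_ac
        (Measure.AbsolutelyContinuous.rfl.prod restrict_Ioi_absolutelyContinuous)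
    have h2 : Measurable fun p : sphere (0 : Space n) 1 × ℝ => ENNReal.ofReal (p.2 ^ n) := by
      fun_prop
    exact AEMeasurable.lintegral_prod_right' (h2.aemeasurable.mul h1)
  obtain ⟨φ, hmono, hφ⟩ := exists_subseq_ae_tendsto_zero hDm (by simpa only [hDint] using hwG)
  filter_upwards [hφ, ae_aestronglyMeasurable_ray hGK] with θ hθ hmeas a b cₐ c_b ha hab hb hLa hLb
  have hmemK : ∀ s ∈ Set.Icc a b, s • (θ : Space n) ∈ K := fun s hs => by
    rw [hK, mem_closedBall_zero_iff, norm_ray (ha.le.trans hs.1)]; exact hs.2.trans hb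
  have hGab : AEStronglyMeasurable (fun s : ℝ => G (s • (θ : Space n)))
      (volume.restrict (Set.Icc a b)) := by
    refine (hmeas.mono_measure (Measure.restrict_mono_set _ fun s hs => ha.trans_le hs.1)).congr ?_
    refine (ae_restrict_iff' measurableSet_Icc).2 (Eventually.of_forall fun s hs => ?_)
    exact Set.indicator_of_mem (hmemK s hs) G
  have hgc : ∀ j, Continuous fun s : ℝ => gradient (w j) (s • (θ : Space n)) := fun j =>
    (hgw j).comp (by fun_prop)
  have hlim : Tendsto (fun j => ∫⁻ s in Set.Icc a b,
      ‖gradient (w (φ j)) (s • (θ : Space n)) - G (s • (θ : Space n))‖ₑ) atTop (𝓝 0) := by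
    -- On `[a, b]` the polar weight `sⁿ` is at least `aⁿ > 0`, so weighted convergence implies
    -- unweighted convergence.
    have h1 : Tendsto (fun j => (ENNReal.ofReal (a ^ n))⁻¹ * D (φ j) θ) atTop (𝓝 0) := by
      have := ENNReal.Tendsto.const_mul (a := (ENNReal.ofReal (a ^ n))⁻¹) hθ
        (Or.inr (by simp [pow_pos ha]))
      rwa [mul_zero] at this
    refine tendsto_of_tendsto_of_tendsto_of_le_of_le tendsto_const_nhds h1 (fun _ => zero_le) ?_
    intro j
    have ha0 : ENNReal.ofReal (a ^ n) ≠ 0 := by simp [pow_pos ha]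
    simp only
    rw [← ENNReal.mul_le_iff_le_inv ha0 ENNReal.ofReal_ne_top,
      ← lintegral_const_mul' _ _ ENNReal.ofReal_ne_top]
    refine le_trans ?_ (lintegral_mono_set (s := Set.Icc a b) fun s hs => ha.trans_le hs.1)
    refine setLIntegral_mono' measurableSet_Icc fun s hs => ?_
    rw [Set.indicator_of_mem (hmemK s hs)]
    gcongr
    exact hs.1
  have hGi : IntegrableOn (fun s : ℝ => G (s • (θ : Space n))) (Set.Icc a b) := by
    obtain ⟨j, hj⟩ := (hlim.eventually_lt_const ENNReal.zero_lt_top).exists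
    have h1 : IntegrableOn (fun s : ℝ => gradient (w (φ j)) (s • (θ : Space n)))
      (Set.Icc a b) := (hgc _).integrableOn_Icc
    have h2 : IntegrableOn (fun s : ℝ => gradient (w (φ j)) (s • (θ : Space n)) -
        G (s • (θ : Space n))) (Set.Icc a b) :=
      ⟨(hgc _).aestronglyMeasurable.sub hGab, hj⟩
    refine (h1.sub h2).congr (Eventually.of_forall fun s => ?_)
    simp
  refine ⟨hGi, ?_⟩
  have hcL : ∀ c s, s ∈ Set.Icc a b → IsLebesguePoint u c (s • (θ : Space n)) →
      Tendsto (fun j => w (φ j) (s • (θ : Space n))) atTop (𝓝 c) := by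
    intro c s hs hc
    exact (hwL _ (hmemK s hs) c hc).comp hmono.tendsto_atTop
  have hdiff := (hcL c_b b ⟨hab, le_rfl⟩ hLb).sub (hcL cₐ a ⟨le_rfl, hab⟩ hLa)
  have hint : Tendsto (fun j => ∫ s in Set.Icc a b,
      inner ℝ (gradient (w (φ j)) (s • (θ : Space n))) (θ : Space n)) atTop
      (𝓝 (∫ s in Set.Icc a b, inner ℝ (G (s • (θ : Space n))) (θ : Space n))) := by
    refine tendsto_integral_of_L1 _ (hGi.inner_const _).1 (Eventually.of_forall fun j =>
      ((hgc _).integrableOn_Icc).inner_const _) ?_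
    refine tendsto_of_tendsto_of_tendsto_of_le_of_le tendsto_const_nhds hlim
      (fun _ => zero_le) fun j => lintegral_mono fun s => ?_
    rw [← inner_sub_left, ← ofReal_norm, ← ofReal_norm]
    refine ENNReal.ofReal_le_ofReal ((norm_inner_le_norm _ _).trans_eq ?_)
    simp
  have heq : ∀ j, w (φ j) (b • (θ : Space n)) - w (φ j) (a • (θ : Space n)) =
      ∫ s in Set.Icc a b, inner ℝ (gradient (w (φ j)) (s • (θ : Space n))) (θ : Space n) := by
    intro j
    have hd : ∀ s : ℝ, HasDerivAt (fun s : ℝ => w (φ j) (s • (θ : Space n)))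
        (inner ℝ (gradient (w (φ j)) (s • (θ : Space n))) (θ : Space n)) s := by
      intro s
      have h1 := (((hw (φ j)).differentiable (by simp)) (s • (θ : Space n))).hasFDerivAt
      have h2 : HasDerivAt (fun s : ℝ => s • (θ : Space n)) (θ : Space n) s := by
        simpa using (hasDerivAt_id s).smul_const (θ : Space n)
      have h3 := h1.comp_hasDerivAt s h2
      rw [← toDual_gradient (𝕜 := ℝ), InnerProductSpace.toDual_apply_apply] at h3
      exact h3
    rw [integral_Icc_eq_integral_Ioc, ← intervalIntegral.integral_of_le hab,
      intervalIntegral.integral_eq_sub_of_hasDerivAt (fun s _ => hd s)]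
    exact ((hgc _).inner continuous_const).intervalIntegrable _ _
  rw [intervalIntegral.integral_of_le hab, ← integral_Icc_eq_integral_Ioc]
  exact tendsto_nhds_unique (by simpa only [heq] using hdiff) hint

lemma ball_ae_eq_closedBall (X : Space n) {r : ℝ} (hr : r ≠ 0) :
    closedBall X r =ᵐ[volume] ball X r := by
  rw [← ball_union_sphere]
  refine union_ae_eq_left_of_ae_eq_empty ?_
  exact ae_eq_empty.2 (Measure.addHaar_sphere_of_ne_zero _ _ hr)

/-- Lebesgue's differentiation theorem. -/
lemma ae_preciseRep_eq {u : Space n → ℝ} {R' R : ℝ} (hu : LocallyIntegrableOn u (ball 0 R))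
    (hR' : R' < R) : ∀ᵐ X, X ∈ ball (0 : Space n) R' → preciseRep u X = u X := by
  set K := closedBall (0 : Space n) R'
  have hi : LocallyIntegrable (K.indicator u) :=
    ((hu.integrableOn_compact_subset (closedBall_subset_ball hR')
      (isCompact_closedBall _ _)).integrable_indicator measurableSet_closedBall).locallyIntegrable
  filter_upwards [IsUnifLocDoublingMeasure.ae_tendsto_average volume hi 1] with X hX hXR
  have h1 := hX (l := 𝓝[>] (0 : ℝ)) (fun _ => X) id tendsto_id
    (by filter_upwards [self_mem_nhdsWithin] with r (hr : 0 < r); simp [hr.le])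
  rw [Set.indicator_of_mem (ball_subset_closedBall hXR)] at h1
  refine preciseRep_eq_of_tendsto (h1.congr' ?_)
  obtain ⟨ε, hε, hsub⟩ := isOpen_iff.1 isOpen_ball X hXR
  filter_upwards [Ioc_mem_nhdsGT hε] with r hr
  simp only [id]
  rw [setAverage_congr (ball_ae_eq_closedBall X hr.1.ne')]
  refine setAverage_congr_fun measurableSet_ball (Eventually.of_forall fun Y hY => ?_)
  exact Set.indicator_of_mem (ball_subset_closedBall (hsub (ball_subset_ball hr.2 hY))) u

/-- The behaviour of `u` along almost every ray: all points are Lebesgue points, and the precise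
representative is the primitive of the radial derivative. -/
structure IsRegularRay (u : Space n → ℝ) (G : Space n → Space n) (R : ℝ)
    (θ : sphere (0 : Space n) 1) : Prop where
  integrableOn : ∀ a b, 0 < a → a ≤ b → b < R →
    IntegrableOn (fun s : ℝ => G (s • (θ : Space n))) (Set.Icc a b)
  sub_eq : ∀ a b, 0 < a → a ≤ b → b < R →
    preciseRep u (b • (θ : Space n)) - preciseRep u (a • (θ : Space n)) =
      ∫ s in a..b, inner ℝ (G (s • (θ : Space n))) (θ : Space n)
  isLebesguePoint : ∀ s, 0 < s → s < R →
    IsLebesguePoint u (preciseRep u (s • (θ : Space n))) (s • (θ : Space n))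
  ae_eq : ∀ᵐ s : ℝ, 0 < s → s < R →
    preciseRep u (s • (θ : Space n)) = u (s • (θ : Space n))

/-- A sequence of radii increasing to `R`. -/
def exhaust (R : ℝ) (k : ℕ) : ℝ := R - 1 / (k + 1)

lemma exhaust_lt (R : ℝ) (k : ℕ) : exhaust R k < R := by
  have : (0 : ℝ) < 1 / (k + 1) := by positivity
  rw [exhaust]; linarith

lemma exists_lt_exhaust {s R : ℝ} (h : s < R) : ∃ k, s < exhaust R k := by
  obtain ⟨k, hk⟩ := exists_nat_one_div_lt (sub_pos.2 h)
  exact ⟨k, by rw [exhaust]; linarith⟩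

/-- Energy is finite only on smaller balls. The estimates are applied on a countable exhaustion, so
the exceptional directions still form a null set. -/
lemma HasWeakGradientOn.ae_isRegularRay {u : Space n → ℝ} {G : Space n → Space n} {R : ℝ}
    (h : HasWeakGradientOn u G (ball 0 R))
    (hG : ∀ r < R, ∫⁻ X in closedBall (0 : Space n) r, ‖G X‖ₑ ^ 2 ≠ ⊤) :
    ∀ᵐ θ : sphere (0 : Space n) 1 ∂sphereMeasure n, IsRegularRay u G R θ := by
  have h1 := ae_all_iff.2 fun k => h.ae_ray_integral (exhaust_lt R k)
  have h2 := ae_all_iff.2 fun k => ae_hasEnergyGrowth_ray (hG _ (exhaust_lt R k))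
  have h3 := ae_all_iff.2 fun k => ae_ray_of_ae (ae_preciseRep_eq h.locInt (exhaust_lt R k))
  filter_upwards [h1, h2, h3] with θ h1 h2 h3
  have hmem : ∀ s, 0 < s → s < R → s • (θ : Space n) ∈ ball (0 : Space n) R := fun s hs hsR => by
    rw [mem_ball_zero_iff, norm_ray hs.le]; exact hsR
  have hloc : ∀ s, 0 < s → s < R → ∃ ρ > 0, IntegrableOn u (ball (s • (θ : Space n)) ρ) := by
    intro s hs hsR
    obtain ⟨ρ, hρ, hsub⟩ := nhds_basis_closedBall.mem_iff.1 (isOpen_ball.mem_nhds (hmem s hs hsR))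
    exact ⟨ρ, hρ, (h.locInt.integrableOn_compact_subset hsub (isCompact_closedBall _ _)).mono_set
      ball_subset_closedBall⟩
  have hL : ∀ s, 0 < s → s < R →
      IsLebesguePoint u (preciseRep u (s • (θ : Space n))) (s • (θ : Space n)) := by
    intro s hs hsR
    obtain ⟨k, hk⟩ := exists_lt_exhaust hsR
    obtain ⟨c, hc⟩ := h.exists_isLebesguePoint_of_hasEnergyGrowth isOpen_ball (hmem s hs hsR)
      (h2 k s hs hk)
    obtain ⟨ρ, hρ, hi⟩ := hloc s hs hsR
    rwa [hc.preciseRep_eq hρ hi]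
  have hab : ∀ a b, 0 < a → a ≤ b → b < R →
      IntegrableOn (fun s : ℝ => G (s • (θ : Space n))) (Set.Icc a b) ∧
      preciseRep u (b • (θ : Space n)) - preciseRep u (a • (θ : Space n)) =
      ∫ s in a..b, inner ℝ (G (s • (θ : Space n))) (θ : Space n) := by
    intro a b ha hab hb
    obtain ⟨k, hk⟩ := exists_lt_exhaust hb
    exact h1 k a b _ _ ha hab hk.le (hL a ha (hab.trans_lt hb)) (hL b (ha.trans_le hab) hb)
  refine ⟨fun a b ha hb hR => (hab a b ha hb hR).1, fun a b ha hb hR => (hab a b ha hb hR).2,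
    hL, ?_⟩
  · filter_upwards [ae_all_iff.2 h3] with s hs hpos hsR
    obtain ⟨k, hk⟩ := exists_lt_exhaust hsR
    exact hs k hpos (by rw [mem_ball_zero_iff, norm_ray hpos.le]; exact hk)

end Rays

/-! ### Weak gradients of products and compositions. -/

section Competitors

variable {n : ℕ}

lemma HasWeakGradientOn.mono {u : Space n → ℝ} {G : Space n → Space n} {Ω Ω' : Set (Space n)}
    (h : HasWeakGradientOn u G Ω) (hΩ : IsOpen Ω) (hsub : Ω' ⊆ Ω) :
    HasWeakGradientOn u G Ω' := by
  refine ⟨h.locInt.mono_set hsub, h.locInt_grad.mono_set hsub, fun φ hφ hφc hφs e => ?_⟩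
  have key := h.integral_eq φ hφ hφc (hφs.trans hsub) e
  have h1 : ∀ X ∉ Ω', φ X = 0 := fun X hX => image_eq_zero_of_notMem_tsupport fun hm => hX (hφs hm)
  have h2 : ∀ X ∉ Ω', fderiv ℝ φ X = 0 := fun X hX =>
    image_eq_zero_of_notMem_tsupport fun hm => hX (hφs (tsupport_fderiv_subset ℝ hm))
  rw [setIntegral_eq_of_subset_of_forall_sdiff_eq_zero hΩ.measurableSet hsub,
    setIntegral_eq_of_subset_of_forall_sdiff_eq_zero hΩ.measurableSet hsub] at key
  · exact key
  · intro X hX; simp [h1 X hX.2]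
  · intro X hX; simp [h2 X hX.2]

lemma HasWeakGradientOn.ae_eq {u : Space n → ℝ} {G G' : Space n → Space n} {Ω : Set (Space n)}
    (h : HasWeakGradientOn u G Ω) (h' : HasWeakGradientOn u G' Ω) (hΩ : IsOpen Ω) :
    ∀ᵐ X ∂volume.restrict Ω, G X = G' X := by
  rw [ae_restrict_iff' hΩ.measurableSet]
  have hloc : LocallyIntegrableOn (G - G') Ω := h.locInt_grad.sub h'.locInt_grad
  suffices H : ∀ g : Space n → ℝ, ContDiff ℝ ∞ g → HasCompactSupport g → tsupport g ⊆ Ω →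
      ∫ X, g X • (G - G') X = 0 by
    filter_upwards [hΩ.ae_eq_zero_of_integral_contDiff_smul_eq_zero hloc H] with X hX hXΩ
    exact sub_eq_zero.1 (hX hXΩ)
  intro g hg hgc hgs
  have hi : ∀ {F : Space n → Space n}, LocallyIntegrableOn F Ω →
      Integrable (fun X => g X • F X) (volume.restrict Ω) := by
    intro F hF
    refine IntegrableOn.of_forall_sdiff_eq_zero (s := tsupport g)
      ((hF.integrableOn_compact_subset hgs hgc.isCompact).continuousOn_smul hg.continuous.continuousOn
        hgc.isCompact) hΩ.measurableSet fun X hX => ?_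
    rw [image_eq_zero_of_notMem_tsupport hX.2, zero_smul]
  rw [← setIntegral_eq_integral_of_forall_compl_eq_zero (s := Ω) (fun X hX => by
    rw [image_eq_zero_of_notMem_tsupport fun hm => hX (hgs hm), zero_smul])]
  simp only [Pi.sub_apply, smul_sub]
  rw [integral_sub (hi h.locInt_grad) (hi h'.locInt_grad), sub_eq_zero]
  refine ext_inner_right ℝ fun e => ?_
  rw [real_inner_comm, real_inner_comm e, ← integral_inner (hi h.locInt_grad),
    ← integral_inner (hi h'.locInt_grad)]
  have h1 := h.integral_eq g hg hgc hgs e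
  rw [h'.integral_eq g hg hgc hgs e, neg_inj] at h1
  simp only [inner_smul_right]
  simpa only [mul_comm, real_inner_comm] using h1.symm

lemma dirichletEnergy_eq {u : Space n → ℝ} {G : Space n → Space n} {D : Set (Space n)}
    (h : HasWeakGradientOn u G D) (hD : IsOpen D) :
    dirichletEnergy u D = ∫⁻ X in D, ‖G X‖ₑ ^ 2 := by
  refine le_antisymm (iInf₂_le G h) (le_iInf₂ fun G' h' => le_of_eq ?_)
  refine lintegral_congr_ae ?_
  filter_upwards [h.ae_eq h' hD] with X hX
  rw [hX]

/-- For a fixed test function only its compact support matters, and there the test function and its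
derivative are bounded. Integration by parts for the smooth approximants therefore passes to the
`L¹` limit. -/
lemma hasWeakGradientOn_of_approx {v : Space n → ℝ} {H : Space n → Space n} {Ω : Set (Space n)}
    (hΩ : IsOpen Ω) (hv : LocallyIntegrableOn v Ω) (hH : LocallyIntegrableOn H Ω)
    (happ : ∀ K, IsCompact K → K ⊆ Ω → ∃ w : ℕ → Space n → ℝ, (∀ k, ContDiff ℝ 1 (w k)) ∧
      Tendsto (fun k => ∫⁻ X in K, ‖w k X - v X‖ₑ) atTop (𝓝 0) ∧
      Tendsto (fun k => ∫⁻ X in K, ‖gradient (w k) X - H X‖ₑ) atTop (𝓝 0)) :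
    HasWeakGradientOn v H Ω := by
  refine ⟨hv, hH, fun φ hφ hφc hφs e => ?_⟩
  set K := tsupport φ
  have hK : IsCompact K := hφc.isCompact
  obtain ⟨w, hw, hwv, hwH⟩ := happ K hK hφs
  have h1 : ∀ X ∉ K, φ X = 0 := fun X hX => image_eq_zero_of_notMem_tsupport hX
  have h2 : ∀ X ∉ K, fderiv ℝ φ X = 0 := fun X hX =>
    image_eq_zero_of_notMem_tsupport fun hm => hX (tsupport_fderiv_subset ℝ hm)
  rw [setIntegral_eq_of_subset_of_forall_sdiff_eq_zero hΩ.measurableSet hφs (fun X hX => by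
      simp [h2 X hX.2]), setIntegral_eq_of_subset_of_forall_sdiff_eq_zero hΩ.measurableSet hφs
      (fun X hX => by simp [h1 X hX.2])]
  have hdφ : Continuous fun X => fderiv ℝ φ X e :=
    (hφ.continuous_fderiv (by simp)).clm_apply continuous_const
  have hgw : ∀ j, Continuous (gradient (w j)) := fun j =>
    (InnerProductSpace.toDual ℝ (Space n)).symm.continuous.comp
      ((hw j).continuous_fderiv (by simp))
  obtain ⟨C1, hC1⟩ := hK.exists_bound_of_continuousOn hdφ.continuousOn
  obtain ⟨C2, hC2⟩ := hK.exists_bound_of_continuousOn hφ.continuous.continuousOn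
  have hvK := hv.integrableOn_compact_subset hφs hK
  have hHK := hH.integrableOn_compact_subset hφs hK
  have hHe : IntegrableOn (fun X => inner ℝ (H X) e) K := hHK.inner_const e
  have l1 : Tendsto (fun k => ∫ X in K, w k X * fderiv ℝ φ X e) atTop
      (𝓝 (∫ X in K, v X * fderiv ℝ φ X e)) := by
    refine tendsto_integral_of_L1 _ (hvK.mul_continuousOn hdφ.continuousOn hK).1
      (Eventually.of_forall fun k =>
        ((hw k).continuous.mul hdφ).continuousOn.integrableOn_compact hK) ?_
    have h0 := ENNReal.Tendsto.mul_const (b := ENNReal.ofReal C1) hwv (Or.inr (by simp))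
    rw [zero_mul] at h0
    refine tendsto_of_tendsto_of_tendsto_of_le_of_le tendsto_const_nhds h0 (fun _ => zero_le) ?_
    intro k
    simp only
    rw [← lintegral_mul_const' _ _ (by simp)]
    refine setLIntegral_mono' hK.measurableSet fun X hX => ?_
    rw [← sub_mul, enorm_mul]
    gcongr
    rw [← ofReal_norm]
    exact ENNReal.ofReal_le_ofReal (hC1 X hX)
  have l2 : Tendsto (fun k => ∫ X in K, inner ℝ (gradient (w k) X) e * φ X) atTop
      (𝓝 (∫ X in K, inner ℝ (H X) e * φ X)) := by
    refine tendsto_integral_of_L1 _ (hHe.mul_continuousOn hφ.continuous.continuousOn hK).1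
      (Eventually.of_forall fun k =>
        (((hgw k).inner continuous_const).mul hφ.continuous).continuousOn.integrableOn_compact hK) ?_
    have h0 := ENNReal.Tendsto.mul_const (b := ‖e‖ₑ * ENNReal.ofReal C2) hwH (Or.inr (by finiteness))
    rw [zero_mul] at h0
    refine tendsto_of_tendsto_of_tendsto_of_le_of_le tendsto_const_nhds h0 (fun _ => zero_le) ?_
    intro k
    simp only
    rw [← lintegral_mul_const' _ _ (by finiteness)]
    refine setLIntegral_mono' hK.measurableSet fun X hX => ?_
    rw [← sub_mul, enorm_mul, ← inner_sub_left, ← mul_assoc]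
    gcongr
    · rw [← ofReal_norm, ← ofReal_norm, ← ofReal_norm, ← ENNReal.ofReal_mul (norm_nonneg _)]
      exact ENNReal.ofReal_le_ofReal (norm_inner_le_norm _ _)
    · rw [← ofReal_norm]
      exact ENNReal.ofReal_le_ofReal (hC2 X hX)
  have heq : ∀ k, ∫ X in K, w k X * fderiv ℝ φ X e =
      -∫ X in K, inner ℝ (gradient (w k) X) e * φ X := by
    intro k
    rw [setIntegral_eq_integral_of_forall_compl_eq_zero (fun X hX => by simp [h2 X hX]),
      setIntegral_eq_integral_of_forall_compl_eq_zero (fun X hX => by simp [h1 X hX])]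
    have hin : ∀ X, inner ℝ (gradient (w k) X) e = fderiv ℝ (w k) X e := fun X => by
      rw [gradient, InnerProductSpace.toDual_symm_apply]
    simp only [hin]
    have hdw : Continuous fun X => fderiv ℝ (w k) X e :=
      ((hw k).continuous_fderiv (by simp)).clm_apply continuous_const
    refine integral_mul_fderiv_eq_neg_fderiv_mul_of_integrable ?_ ?_ ?_
      (fun X _ => (hw k).differentiable (by simp) X)
      (fun X _ => hφ.differentiable (by simp) X)
    · exact (hdw.mul hφ.continuous).integrable_of_hasCompactSupport hφc.mul_left
    · exact ((hw k).continuous.mul hdφ).integrable_of_hasCompactSupport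
        ((hφc.fderiv_apply ℝ e).mul_left)
    · exact ((hw k).continuous.mul hφ.continuous).integrable_of_hasCompactSupport hφc.mul_left
  simp only [heq] at l1
  exact tendsto_nhds_unique l1 l2.neg

/-- A homeomorphism which is `C¹` together with its inverse. -/
structure IsC1Diffeo {E : Type*} [NormedAddCommGroup E] [NormedSpace ℝ E] (Φ : E ≃ₜ E) : Prop where
  contDiff : ContDiff ℝ 1 Φ
  contDiff_symm : ContDiff ℝ 1 Φ.symm

namespace IsC1Diffeo

variable {E : Type*} [NormedAddCommGroup E] [NormedSpace ℝ E] {Φ : E ≃ₜ E}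

lemma symm (h : IsC1Diffeo Φ) : IsC1Diffeo Φ.symm := ⟨h.2, h.1⟩

lemma differentiable (h : IsC1Diffeo Φ) : Differentiable ℝ Φ := h.contDiff.differentiable (by simp)

lemma refl : IsC1Diffeo (Homeomorph.refl E) := ⟨contDiff_id, contDiff_id⟩

variable [FiniteDimensional ℝ E] [MeasurableSpace E] [BorelSpace E] {μ : Measure E}
  [μ.IsAddHaarMeasure]

lemma quasiMeasurePreserving (h : IsC1Diffeo Φ) : Measure.QuasiMeasurePreserving Φ μ μ := by
  refine ⟨Φ.measurable, Measure.AbsolutelyContinuous.mk fun s hs hs0 => ?_⟩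
  rw [Measure.map_apply Φ.measurable hs, ← Φ.symm_symm, ← Homeomorph.image_eq_preimage_symm]
  exact addHaar_image_eq_zero_of_differentiableOn_of_addHaar_eq_zero μ
    h.symm.differentiable.differentiableOn hs0

lemma setLIntegral_image (h : IsC1Diffeo Φ) {s : Set E} (hs : MeasurableSet s) (f : E → ℝ≥0∞) :
    ∫⁻ Y in Φ '' s, f Y ∂μ = ∫⁻ X in s, ENNReal.ofReal |(fderiv ℝ Φ X).det| * f (Φ X) ∂μ :=
  lintegral_image_eq_lintegral_abs_det_fderiv_mul μ hs
    (fun X _ => (h.differentiable X).hasFDerivAt.hasFDerivWithinAt) Φ.injective.injOn f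

/-- The Jacobian of `Φ.symm` is continuous, hence bounded on the compact image of `K`; this controls
local integrability and `L²` bounds of compositions. -/
lemma exists_setLIntegral_comp_le (h : IsC1Diffeo Φ) {K : Set E} (hK : IsCompact K) :
    ∃ C : ℝ, 0 ≤ C ∧ ∀ s ⊆ K, MeasurableSet s → ∀ f : E → ℝ≥0∞,
      ∫⁻ X in s, f (Φ X) ∂μ ≤ ENNReal.ofReal C * ∫⁻ Y in Φ '' s, f Y ∂μ := by
  have hc : Continuous fun Y => (fderiv ℝ Φ.symm Y).det :=
    ContinuousLinearMap.continuous_det.comp (h.contDiff_symm.continuous_fderiv (by simp))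
  obtain ⟨C, hC⟩ := (hK.image Φ.continuous).exists_bound_of_continuousOn hc.continuousOn
  refine ⟨max C 0, le_max_right _ _, fun s hs hsm f => ?_⟩
  have hm : MeasurableSet (Φ '' s) := (Φ.measurableEmbedding.measurableSet_image).2 hsm
  have h1 := h.symm.setLIntegral_image (μ := μ) hm (fun X => f (Φ X))
  rw [← Set.image_comp, show (Φ.symm ∘ Φ) = id from by ext; simp, Set.image_id] at h1
  rw [h1, ← lintegral_const_mul' _ _ (by simp)]
  refine setLIntegral_mono' hm fun Y hY => ?_
  simp only [Φ.apply_symm_apply]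
  gcongr
  exact (hC Y (Set.image_mono hs hY)).trans (le_max_left _ _)

lemma aestronglyMeasurable_comp (h : IsC1Diffeo Φ) {F : Type*} [NormedAddCommGroup F]
    {K : Set E} (hK : MeasurableSet K) {f : E → F}
    (hf : AEStronglyMeasurable f (μ.restrict (Φ '' K))) :
    AEStronglyMeasurable (fun X => f (Φ X)) (μ.restrict K) := by
  have hm : MeasurableSet (Φ '' K) := (Φ.measurableEmbedding.measurableSet_image).2 hK
  have h1 := ((aestronglyMeasurable_indicator_iff hm).2 hf).comp_quasiMeasurePreserving
    h.quasiMeasurePreserving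
  refine (h1.mono_measure Measure.restrict_le_self).congr ?_
  refine (ae_restrict_iff' hK).2 (Eventually.of_forall fun X hX => ?_)
  exact Set.indicator_of_mem (Set.mem_image_of_mem _ hX) f

lemma integrableOn_comp (h : IsC1Diffeo Φ) {F : Type*} [NormedAddCommGroup F]
    {K : Set E} (hK : IsCompact K) {f : E → F} (hf : IntegrableOn f (Φ '' K) μ) :
    IntegrableOn (fun X => f (Φ X)) K μ := by
  refine ⟨h.aestronglyMeasurable_comp hK.measurableSet hf.1, ?_⟩
  obtain ⟨C, -, hC⟩ := h.exists_setLIntegral_comp_le (μ := μ) hK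
  refine (hC K subset_rfl hK.measurableSet (fun Y => ‖f Y‖ₑ)).trans_lt ?_
  exact ENNReal.mul_lt_top (by simp) hf.2

lemma memLp_two_iff {α F : Type*} [MeasurableSpace α] {μ : Measure α} [NormedAddCommGroup F]
    {f : α → F} : MemLp f 2 μ ↔ AEStronglyMeasurable f μ ∧ ∫⁻ x, ‖f x‖ₑ ^ 2 ∂μ < ⊤ := by
  rw [MemLp, eLpNorm_lt_top_iff_lintegral_rpow_enorm_lt_top (by simp) (by simp)]
  simp

lemma memLp_comp (h : IsC1Diffeo Φ) {F : Type*} [NormedAddCommGroup F]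
    {K : Set E} (hK : IsCompact K) {f : E → F} (hf : MemLp f 2 (μ.restrict (Φ '' K))) :
    MemLp (fun X => f (Φ X)) 2 (μ.restrict K) := by
  rw [memLp_two_iff] at hf ⊢
  refine ⟨h.aestronglyMeasurable_comp hK.measurableSet hf.1, ?_⟩
  obtain ⟨C, -, hC⟩ := h.exists_setLIntegral_comp_le (μ := μ) hK
  refine (hC K subset_rfl hK.measurableSet (fun Y => ‖f Y‖ₑ ^ 2)).trans_lt ?_
  exact ENNReal.mul_lt_top (by simp) hf.2

end IsC1Diffeo

/-- The gradient of `b · (u ∘ Φ)`, when `G` is the gradient of `u`. -/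
def pullbackGradient (b : Space n → ℝ) (Φ : Space n → Space n) (u : Space n → ℝ)
    (G : Space n → Space n) (X : Space n) : Space n :=
  b X • ContinuousLinearMap.adjoint (fderiv ℝ Φ X) (G (Φ X)) + u (Φ X) • gradient b X

lemma gradient_mul_comp {b w : Space n → ℝ} {Φ : Space n → Space n} {X : Space n}
    (hb : DifferentiableAt ℝ b X) (hw : DifferentiableAt ℝ w (Φ X))
    (hΦ : DifferentiableAt ℝ Φ X) :
    gradient (fun X => b X * w (Φ X)) X = pullbackGradient b Φ w (gradient w) X := by
  refine ext_inner_right ℝ fun e => ?_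
  have h1 := hb.hasFDerivAt.mul (hw.hasFDerivAt.comp X hΦ.hasFDerivAt)
  have h2 : fderiv ℝ (fun X => b X * w (Φ X)) X = _ := h1.fderiv
  rw [gradient, InnerProductSpace.toDual_symm_apply, h2, pullbackGradient, inner_add_left,
    inner_smul_left, inner_smul_left, ContinuousLinearMap.adjoint_inner_left]
  simp [gradient, InnerProductSpace.toDual_symm_apply]

lemma exists_norm_pullbackGradient_le {b : Space n → ℝ} (hb : ContDiff ℝ 1 b)
    {Φ : Space n → Space n} (hΦ : ContDiff ℝ 1 Φ) {K : Set (Space n)} (hK : IsCompact K) :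
    ∃ C : ℝ, 0 ≤ C ∧ ∀ (u : Space n → ℝ) (G : Space n → Space n), ∀ X ∈ K,
      ‖pullbackGradient b Φ u G X‖ ≤ C * (‖G (Φ X)‖ + ‖u (Φ X)‖) := by
  have hgb : Continuous (gradient b) :=
    (InnerProductSpace.toDual ℝ (Space n)).symm.continuous.comp (hb.continuous_fderiv (by simp))
  obtain ⟨C1, hC1⟩ := hK.exists_bound_of_continuousOn
    (hb.continuous.smul (hΦ.continuous_fderiv (by simp))).continuousOn
  obtain ⟨C2, hC2⟩ := hK.exists_bound_of_continuousOn hgb.continuousOn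
  refine ⟨max (max C1 C2) 0, le_max_right _ _, fun u G X hX => ?_⟩
  have h1 : ‖b X • ContinuousLinearMap.adjoint (fderiv ℝ Φ X) (G (Φ X))‖ ≤ C1 * ‖G (Φ X)‖ := by
    rw [norm_smul]
    calc _ ≤ ‖b X‖ * (‖fderiv ℝ Φ X‖ * ‖G (Φ X)‖) := by
          gcongr
          refine (ContinuousLinearMap.le_opNorm _ _).trans_eq ?_
          rw [LinearIsometryEquiv.norm_map]
      _ ≤ _ := by
          rw [← mul_assoc]
          gcongr
          rw [← norm_smul]
          exact hC1 X hX
  have h2 : ‖u (Φ X) • gradient b X‖ ≤ C2 * ‖u (Φ X)‖ := by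
    rw [norm_smul, mul_comm]; gcongr; exact hC2 X hX
  rw [pullbackGradient, mul_add]
  refine (norm_add_le _ _).trans (add_le_add (h1.trans ?_) (h2.trans ?_))
  · gcongr; exact (le_max_left _ _).trans (le_max_left _ _)
  · gcongr; exact (le_max_right _ _).trans (le_max_left _ _)

lemma aestronglyMeasurable_pullbackGradient {b : Space n → ℝ} (hb : ContDiff ℝ 1 b)
    {Φ : Space n ≃ₜ Space n} (hΦ : IsC1Diffeo Φ) {K : Set (Space n)} (hK : MeasurableSet K)
    {u : Space n → ℝ} {G : Space n → Space n}
    (hu : AEStronglyMeasurable u (volume.restrict (Φ '' K)))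
    (hG : AEStronglyMeasurable G (volume.restrict (Φ '' K))) :
    AEStronglyMeasurable (pullbackGradient b Φ u G) (volume.restrict K) := by
  have hgb : Continuous (gradient b) :=
    (InnerProductSpace.toDual ℝ (Space n)).symm.continuous.comp (hb.continuous_fderiv (by simp))
  have hadj : Continuous fun X => ContinuousLinearMap.adjoint (fderiv ℝ Φ X) :=
    ContinuousLinearMap.adjoint.continuous.comp (hΦ.contDiff.continuous_fderiv (by simp))
  refine AEStronglyMeasurable.add (hb.continuous.aestronglyMeasurable.smul ?_)
    ((hΦ.aestronglyMeasurable_comp hK hu).smul hgb.aestronglyMeasurable)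
  exact (ContinuousLinearMap.id ℝ (Space n →L[ℝ] Space n)).aestronglyMeasurable_comp₂
    hadj.aestronglyMeasurable (hΦ.aestronglyMeasurable_comp hK hG)

/-- The chain and product rules for weak gradients. -/
lemma HasWeakGradientOn.pullback {u : Space n → ℝ} {G : Space n → Space n} {Ω : Set (Space n)}
    (h : HasWeakGradientOn u G Ω) (hΩ : IsOpen Ω) {b : Space n → ℝ} (hb : ContDiff ℝ 1 b)
    {Φ : Space n ≃ₜ Space n} (hΦ : IsC1Diffeo Φ) (hΦΩ : ∀ X ∈ Ω, Φ X ∈ Ω) :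
    HasWeakGradientOn (fun X => b X * u (Φ X)) (pullbackGradient b Φ u G) Ω := by
  have hloc : ∀ {F : Type} [NormedAddCommGroup F] {f : Space n → F}, LocallyIntegrableOn f Ω →
      ∀ K ⊆ Ω, IsCompact K → IntegrableOn f (Φ '' K) := fun hf K hK hKc =>
    hf.integrableOn_compact_subset (Set.image_subset_iff.2 fun X hX => hΦΩ X (hK hX))
      (hKc.image Φ.continuous)
  refine hasWeakGradientOn_of_approx hΩ ?_ ?_ ?_
  · refine (locallyIntegrableOn_iff hΩ.isLocallyClosed).2 fun K hK hKc => ?_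
    exact (hΦ.integrableOn_comp hKc (hloc h.locInt K hK hKc)).continuousOn_mul
      hb.continuous.continuousOn hKc
  · refine (locallyIntegrableOn_iff hΩ.isLocallyClosed).2 fun K hK hKc => ?_
    obtain ⟨C, hC, hle⟩ := exists_norm_pullbackGradient_le hb hΦ.contDiff hKc
    have h1 := hΦ.integrableOn_comp hKc (hloc h.locInt K hK hKc)
    have h2 := hΦ.integrableOn_comp hKc (hloc h.locInt_grad K hK hKc)
    refine Integrable.mono' ((h2.norm.add h1.norm).const_mul C)
      (aestronglyMeasurable_pullbackGradient hb hΦ hKc.measurableSet (hloc h.locInt K hK hKc).1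
        (hloc h.locInt_grad K hK hKc).1) ?_
    exact (ae_restrict_iff' hKc.measurableSet).2 (Eventually.of_forall fun X hX => hle u G X hX)
  · intro K hKc hK
    obtain ⟨w, hw, hwu, hwG, -⟩ := h.exists_smooth_approx hΩ (hKc.image Φ.continuous)
      (Set.image_subset_iff.2 fun X hX => hΦΩ X (hK hX))
    have hw1 : ∀ k, ContDiff ℝ 1 (w k) := fun k => (hw k).of_le (by simp)
    obtain ⟨C, hC, hle⟩ := hΦ.exists_setLIntegral_comp_le (μ := volume) hKc
    obtain ⟨C1, hC1⟩ := hKc.exists_bound_of_continuousOn hb.continuous.continuousOn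
    obtain ⟨C2, hC2, hle2⟩ := exists_norm_pullbackGradient_le hb hΦ.contDiff hKc
    have hgw : ∀ j, Continuous (gradient (w j)) := fun j =>
      (InnerProductSpace.toDual ℝ (Space n)).symm.continuous.comp
        ((hw j).continuous_fderiv (by simp))
    have lu : Tendsto (fun k => ∫⁻ X in K, ‖w k (Φ X) - u (Φ X)‖ₑ) atTop (𝓝 0) := by
      have h0 := ENNReal.Tendsto.const_mul (a := ENNReal.ofReal C) hwu (Or.inr (by simp))
      rw [mul_zero] at h0
      exact tendsto_of_tendsto_of_tendsto_of_le_of_le tendsto_const_nhds h0 (fun _ => zero_le)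
        fun k => hle K subset_rfl hKc.measurableSet fun Y => ‖w k Y - u Y‖ₑ
    have lG : Tendsto (fun k => ∫⁻ X in K, ‖gradient (w k) (Φ X) - G (Φ X)‖ₑ) atTop (𝓝 0) := by
      have h0 := ENNReal.Tendsto.const_mul (a := ENNReal.ofReal C) hwG (Or.inr (by simp))
      rw [mul_zero] at h0
      exact tendsto_of_tendsto_of_tendsto_of_le_of_le tendsto_const_nhds h0 (fun _ => zero_le)
        fun k => hle K subset_rfl hKc.measurableSet fun Y => ‖gradient (w k) Y - G Y‖ₑ
    refine ⟨fun k X => b X * w k (Φ X), fun k => hb.mul ((hw1 k).comp hΦ.contDiff), ?_, ?_⟩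
    · have h0 := ENNReal.Tendsto.const_mul (a := ENNReal.ofReal C1) lu (Or.inr (by simp))
      rw [mul_zero] at h0
      refine tendsto_of_tendsto_of_tendsto_of_le_of_le tendsto_const_nhds h0 (fun _ => zero_le) ?_
      intro k
      simp only
      rw [← lintegral_const_mul' _ _ (by simp)]
      refine setLIntegral_mono' hKc.measurableSet fun X hX => ?_
      rw [← mul_sub, enorm_mul]
      gcongr
      rw [← ofReal_norm]
      exact ENNReal.ofReal_le_ofReal (hC1 X hX)
    · have h0 := ENNReal.Tendsto.const_mul (a := ENNReal.ofReal C2) (lG.add lu)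
        (Or.inr (by simp))
      rw [add_zero, mul_zero] at h0
      refine tendsto_of_tendsto_of_tendsto_of_le_of_le tendsto_const_nhds h0 (fun _ => zero_le) ?_
      intro k
      simp only
      have hm : AEMeasurable (fun X => ‖gradient (w k) (Φ X) - G (Φ X)‖ₑ) (volume.restrict K) := by
        refine (AEStronglyMeasurable.sub ?_ ?_).enorm
        · exact ((hgw k).comp Φ.continuous).aestronglyMeasurable
        · exact hΦ.aestronglyMeasurable_comp hKc.measurableSet (hloc h.locInt_grad K hK hKc).1
      rw [← lintegral_add_left' hm, ← lintegral_const_mul' _ _ (by simp)]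
      refine setLIntegral_mono' hKc.measurableSet fun X hX => ?_
      -- The pullback is linear in the pair `(u, G)`, so the error is the pullback of the
      -- approximation errors.
      have heq : gradient (fun X => b X * w k (Φ X)) X - pullbackGradient b Φ u G X =
          pullbackGradient b Φ (fun Y => w k Y - u Y) (fun Y => gradient (w k) Y - G Y) X := by
        rw [gradient_mul_comp (hb.differentiable (by simp) X) ((hw1 k).differentiable (by simp) _)
          (hΦ.differentiable X)]
        simp only [pullbackGradient, map_sub, smul_sub, sub_smul]
        abel
      rw [heq, ← ofReal_norm, ← ofReal_norm, ← ofReal_norm,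
        ← ENNReal.ofReal_add (norm_nonneg _) (norm_nonneg _), ← ENNReal.ofReal_mul hC2]
      exact ENNReal.ofReal_le_ofReal (hle2 _ _ X hX)

lemma memH1loc_pullback {u : Space n → ℝ} {Ω : Set (Space n)} (h : MemH1loc u Ω) (hΩ : IsOpen Ω)
    {b : Space n → ℝ} (hb : ContDiff ℝ 1 b) {Φ : Space n ≃ₜ Space n} (hΦ : IsC1Diffeo Φ)
    (hΦΩ : ∀ X ∈ Ω, Φ X ∈ Ω) : MemH1loc (fun X => b X * u (Φ X)) Ω := by
  obtain ⟨G, hG, hL2⟩ := h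
  refine ⟨pullbackGradient b Φ u G, hG.pullback hΩ hb hΦ hΦΩ, fun K hKc hK => ?_⟩
  obtain ⟨hu2, hG2⟩ := hL2 (Φ '' K) (hKc.image Φ.continuous)
    (Set.image_subset_iff.2 fun X hX => hΦΩ X (hK hX))
  have hu3 := hΦ.memLp_comp hKc hu2
  have hG3 := hΦ.memLp_comp hKc hG2
  constructor
  · obtain ⟨C1, hC1⟩ := hKc.exists_bound_of_continuousOn hb.continuous.continuousOn
    refine MemLp.mono (hu3.const_mul C1) (hb.continuous.aestronglyMeasurable.mul hu3.1) ?_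
    refine (ae_restrict_iff' hKc.measurableSet).2 (Eventually.of_forall fun X hX => ?_)
    rw [norm_mul, norm_mul]
    gcongr
    exact (hC1 X hX).trans (le_abs_self _)
  · obtain ⟨C2, hC2, hle2⟩ := exists_norm_pullbackGradient_le hb hΦ.contDiff hKc
    refine MemLp.mono' ((hG3.norm.add hu3.norm).const_mul C2)
      (aestronglyMeasurable_pullbackGradient hb hΦ hKc.measurableSet hu2.1 hG2.1) ?_
    exact (ae_restrict_iff' hKc.measurableSet).2 (Eventually.of_forall fun X hX => hle2 u G X hX)

end Competitors

/-! ### Radial deformations of the domain. -/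

section RadialMap

/-- The one-sided derivative from the right determines `deriv ζ y`; this includes the endpoint `y =
y₀`, which is not interior to the zero set. -/
lemma deriv_eq_zero_of_eq_zero_Ici {ζ : ℝ → ℝ} (hζ : ContDiff ℝ 1 ζ) {y₀ : ℝ}
    (hζb : ∀ y, y₀ ≤ y → ζ y = 0) {y : ℝ} (hy : y₀ ≤ y) : deriv ζ y = 0 := by
  have h1 : HasDerivWithinAt ζ 0 (Set.Ici y) y := by
    refine (hasDerivWithinAt_const y _ (0 : ℝ)).congr_of_mem (fun x hx => ?_) Set.self_mem_Ici
    exact hζb x (hy.trans hx)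
  exact (uniqueDiffOn_Ici y y Set.self_mem_Ici).eq_deriv _
    ((hζ.differentiable (by simp) y).hasDerivAt.hasDerivWithinAt) h1

variable {E : Type*} [NormedAddCommGroup E]

lemma hasCompactSupport_radial [ProperSpace E] {F : Type*} [Zero F] {b : ℝ} (hb : 0 ≤ b) {f : E → F}
    (hf : ∀ X, b ^ 2 ≤ ‖X‖ ^ 2 → f X = 0) : HasCompactSupport f := by
  refine HasCompactSupport.intro (isCompact_closedBall (0 : E) b) fun X hX => hf X ?_
  rw [mem_closedBall_zero_iff, not_le] at hX
  gcongr

/-- Every point outside the ball is its own image, so injectivity forbids a point inside from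
leaving it. -/
lemma image_ball_of_eq_self {Ψ : E ≃ₜ E} {b r : ℝ} (hΨ : ∀ X, b ≤ ‖X‖ → Ψ X = X) (hbr : b ≤ r) :
    Ψ '' ball 0 r = ball 0 r := by
  have key : ∀ X, ‖Ψ X‖ < r ↔ ‖X‖ < r := by
    intro X
    rw [← not_iff_not, not_lt, not_lt]
    constructor
    · intro h
      have := Ψ.injective (hΨ (Ψ X) (hbr.trans h))
      rwa [this] at h
    · intro h
      rwa [hΨ X (hbr.trans h)]
  ext Y
  rw [← Ψ.apply_symm_apply Y, Ψ.injective.mem_set_image, mem_ball_zero_iff, mem_ball_zero_iff, key]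

variable [InnerProductSpace ℝ E]

/-- The radial map `X ↦ (1 + ζ(|X|²)) X`. -/
def radialMap (ζ : ℝ → ℝ) (X : E) : E := (1 + ζ (‖X‖ ^ 2)) • X

/-- The linear map `v ↦ m v + c ⟨X, v⟩ X`. -/
def rankOnePerturbation (m c : ℝ) (X : E) : E →L[ℝ] E :=
  m • ContinuousLinearMap.id ℝ E + c • (innerSL ℝ X).smulRight X

lemma rankOnePerturbation_apply (m c : ℝ) (X v : E) :
    rankOnePerturbation m c X v = m • v + (c * inner ℝ X v) • X := by
  simp [rankOnePerturbation, smul_smul]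

lemma hasFDerivAt_radialMap {ζ : ℝ → ℝ} {z : ℝ} {X : E} (h : HasDerivAt ζ z (‖X‖ ^ 2)) :
    HasFDerivAt (radialMap ζ) (rankOnePerturbation (1 + ζ (‖X‖ ^ 2)) (2 * z) X) X := by
  have h1 : HasFDerivAt (fun Y : E => 1 + ζ (‖Y‖ ^ 2)) (z • (2 • innerSL ℝ X)) X :=
    (h.comp_hasFDerivAt X (hasStrictFDerivAt_norm_sq X).hasFDerivAt).const_add 1
  refine (h1.smul (hasFDerivAt_id X)).congr_fderiv ?_
  ext v
  simp [rankOnePerturbation_apply]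
  ring_nf

lemma contDiff_radialMap {ζ : ℝ → ℝ} (h : ContDiff ℝ 1 ζ) :
    ContDiff ℝ 1 (radialMap ζ : E → E) :=
  (contDiff_const.add (h.comp (contDiff_norm_sq ℝ))).smul contDiff_id

/-- After the factor `m` is extracted, what remains is the identity plus a rank-one map, whose
determinant is one plus the functional evaluated at the vector. -/
lemma det_rankOnePerturbation [FiniteDimensional ℝ E] {m : ℝ} (hm : m ≠ 0) (c : ℝ) (X : E) :
    (rankOnePerturbation m c X).det = m ^ Module.finrank ℝ E * (1 + c * ‖X‖ ^ 2 / m) := by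
  have h1 : ((rankOnePerturbation m c X : E →L[ℝ] E) : E →ₗ[ℝ] E) =
      m • LinearMap.transvection ((c / m) • (innerSL ℝ X : E →L[ℝ] ℝ).toLinearMap) X := by
    ext v
    simp only [ContinuousLinearMap.coe_coe, rankOnePerturbation_apply, LinearMap.smul_apply,
      LinearMap.transvection.apply, smul_add, smul_smul, smul_eq_mul, innerSL_apply_apply]
    congr 2
    field_simp
  rw [ContinuousLinearMap.det, h1, LinearMap.det_smul, LinearMap.transvection.det]
  simp only [LinearMap.smul_apply, ContinuousLinearMap.coe_coe, innerSL_apply_apply, smul_eq_mul,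
    real_inner_self_eq_norm_sq]
  ring

lemma rankOnePerturbation_adjoint [CompleteSpace E] (m c : ℝ) (X : E) :
    ContinuousLinearMap.adjoint (rankOnePerturbation m c X) = rankOnePerturbation m c X := by
  refine ((ContinuousLinearMap.eq_adjoint_iff _ _).2 fun v w => ?_).symm
  rw [rankOnePerturbation_apply, rankOnePerturbation_apply, inner_add_left, inner_add_right,
    inner_smul_left, inner_smul_left, inner_smul_right, inner_smul_right, real_inner_comm X v]
  simp only [RCLike.conj_to_real]
  ring

/-- Pairing the equation with `X` recovers `⟨X, q⟩`, and expanding `‖p‖²` recovers `‖q‖²`. No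
formula for the inverse map is needed. -/
lemma norm_sq_of_rankOnePerturbation_apply_eq {m c : ℝ} {X q p : E} (hm : m ≠ 0)
    (hs : m + c * ‖X‖ ^ 2 ≠ 0) (h : rankOnePerturbation m c X q = p) :
    ‖q‖ ^ 2 = (‖p‖ ^ 2 - c * (2 * m + c * ‖X‖ ^ 2) / (m + c * ‖X‖ ^ 2) ^ 2 * inner ℝ X p ^ 2)
      / m ^ 2 := by
  rw [rankOnePerturbation_apply] at h
  have h1 : inner ℝ X p = (m + c * ‖X‖ ^ 2) * inner ℝ X q := by
    rw [← h, inner_add_right, inner_smul_right, inner_smul_right, real_inner_self_eq_norm_sq]; ring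
  have h2 : ‖p‖ ^ 2 = m ^ 2 * ‖q‖ ^ 2 + c * (2 * m + c * ‖X‖ ^ 2) * inner ℝ X q ^ 2 := by
    rw [← h, ← real_inner_self_eq_norm_sq]
    simp only [inner_add_left, inner_add_right, inner_smul_left, inner_smul_right,
      RCLike.conj_to_real, real_inner_comm X q, real_inner_self_eq_norm_sq]
    ring
  rw [h1, h2]
  field_simp
  ring

lemma radialMap_eq_self {ζ : ℝ → ℝ} {b : ℝ} (hb : 0 ≤ b) (hζ : ∀ y, b ^ 2 ≤ y → ζ y = 0) {X : E}
    (hX : b ≤ ‖X‖) : radialMap ζ X = X := by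
  rw [radialMap, hζ _ (by gcongr), add_zero, one_smul]

/-- The map is the identity plus `ε` times a compactly supported `C¹` field, hence a small Lipschitz
perturbation of the identity. The two positive quantities are the tangential and the radial
eigenvalue of its derivative; their positivity gives a nonzero determinant and so a `C¹` inverse. -/
lemma exists_homeomorph_radialMap [FiniteDimensional ℝ E] {ζ : ℝ → ℝ} (hζ : ContDiff ℝ 1 ζ) {b : ℝ}
    (hb : 0 ≤ b) (hζb : ∀ y, b ^ 2 ≤ y → ζ y = 0) :
    ∀ᶠ ε : ℝ in 𝓝 0, ∃ Ψ : E ≃ₜ E, IsC1Diffeo Ψ ∧ (∀ X, Ψ X = radialMap (fun y => ε * ζ y) X) ∧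
      (∀ X : E, 0 < 1 + ε * ζ (‖X‖ ^ 2) ∧
        0 < 1 + ε * ζ (‖X‖ ^ 2) + 2 * (ε * deriv ζ (‖X‖ ^ 2)) * ‖X‖ ^ 2) := by
  have : ProperSpace E := FiniteDimensional.proper ℝ E
  have hdz : ∀ y, b ^ 2 ≤ y → deriv ζ y = 0 := fun y => deriv_eq_zero_of_eq_zero_Ici hζ hζb
  have hdζ : Continuous (deriv ζ) := hζ.continuous_deriv le_rfl
  have hn2 : Continuous fun X : E => ‖X‖ ^ 2 := continuous_norm.pow 2
  obtain ⟨M, hM⟩ := (hasCompactSupport_radial hb (f := fun X : E => ζ (‖X‖ ^ 2))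
    fun X hX => hζb _ hX).exists_bound_of_continuous (hζ.continuous.comp hn2)
  obtain ⟨M', hM'⟩ := (hasCompactSupport_radial hb (f := fun X : E => deriv ζ (‖X‖ ^ 2) * ‖X‖ ^ 2)
    fun X hX => by simp [hdz _ hX]).exists_bound_of_continuous ((hdζ.comp hn2).mul hn2)
  obtain ⟨L, hL⟩ := ContDiff.lipschitzWith_of_hasCompactSupport (𝕂 := ℝ) (n := 1)
    (f := fun X : E => ζ (‖X‖ ^ 2) • X)
    (hasCompactSupport_radial hb fun X hX => by simp [hζb _ hX])
    ((hζ.comp (contDiff_norm_sq ℝ)).smul contDiff_id) (by simp)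
  have hM0 : 0 ≤ M := (norm_nonneg _).trans (hM 0)
  have hM0' : 0 ≤ M' := (norm_nonneg _).trans (hM' 0)
  have hev : ∀ C : ℝ, ∀ᶠ ε : ℝ in 𝓝 0, |ε| * C < 1 / 4 := fun C => by
    have : Tendsto (fun ε : ℝ => |ε| * C) (𝓝 0) (𝓝 (|0| * C)) :=
      (continuous_abs.mul continuous_const).tendsto 0
    rw [abs_zero, zero_mul] at this
    exact this.eventually_lt_const (by norm_num)
  filter_upwards [hev M, hev M', hev L] with ε h1 h2 h3
  have hpos : ∀ X : E, 0 < 1 + ε * ζ (‖X‖ ^ 2) ∧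
        0 < 1 + ε * ζ (‖X‖ ^ 2) + 2 * (ε * deriv ζ (‖X‖ ^ 2)) * ‖X‖ ^ 2 := by
    intro X
    have e1 : |ε * ζ (‖X‖ ^ 2)| < 1 / 4 := by
      rw [abs_mul]
      exact (mul_le_mul_of_nonneg_left (hM X) (abs_nonneg _)).trans_lt h1
    have e2 : |ε * (deriv ζ (‖X‖ ^ 2) * ‖X‖ ^ 2)| < 1 / 4 := by
      rw [abs_mul]
      exact (mul_le_mul_of_nonneg_left (hM' X) (abs_nonneg _)).trans_lt h2
    rw [abs_lt] at e1 e2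
    constructor <;> linarith
  have hζε : ContDiff ℝ 1 fun y => ε * ζ y := contDiff_const.mul hζ
  have hf : ∀ X : E, HasFDerivAt (radialMap fun y => ε * ζ y)
      (rankOnePerturbation (1 + ε * ζ (‖X‖ ^ 2)) (2 * (ε * deriv ζ (‖X‖ ^ 2))) X) X := fun X =>
    hasFDerivAt_radialMap ((hζ.differentiable (by simp) _).hasDerivAt.const_mul ε)
  have happ : ApproximatesLinearOn (radialMap fun y => ε * ζ y)
      (ContinuousLinearEquiv.refl ℝ E : E →L[ℝ] E) Set.univ (‖ε‖₊ * L) := by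
    intro X _ Y _
    have e : radialMap (fun y => ε * ζ y) X - radialMap (fun y => ε * ζ y) Y -
        (ContinuousLinearEquiv.refl ℝ E : E →L[ℝ] E) (X - Y) =
        ε • (ζ (‖X‖ ^ 2) • X - ζ (‖Y‖ ^ 2) • Y) := by
      simp [radialMap, add_smul, smul_sub, smul_smul]
      abel
    rw [e, norm_smul, NNReal.coe_mul, coe_nnnorm, mul_assoc]
    gcongr
    rw [← dist_eq_norm, ← dist_eq_norm]
    exact hL.dist_le_mul X Y
  have hc : Subsingleton E ∨ ‖ε‖₊ * L <
      ‖((ContinuousLinearEquiv.refl ℝ E).symm : E →L[ℝ] E)‖₊⁻¹ := by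
    refine (subsingleton_or_nontrivial E).imp id fun hE => ?_
    have e : ‖((ContinuousLinearEquiv.refl ℝ E).symm : E →L[ℝ] E)‖₊ = 1 := by
      rw [← NNReal.coe_inj, coe_nnnorm]
      have : NontrivialTopology E :=
        EMetric.nontrivial_iff_nontrivialTopology.1 hE
      exact ContinuousLinearMap.norm_id
    rw [e, inv_one, ← NNReal.coe_lt_coe]
    push_cast
    rw [Real.norm_eq_abs]
    linarith
  refine ⟨happ.toHomeomorph _ hc, ⟨contDiff_radialMap hζε, ?_⟩, fun X => rfl, hpos⟩
  have hdet : ∀ X : E, (rankOnePerturbation (1 + ε * ζ (‖X‖ ^ 2))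
      (2 * (ε * deriv ζ (‖X‖ ^ 2))) X).det ≠ 0 := by
    intro X
    obtain ⟨p1, p2⟩ := hpos X
    rw [det_rankOnePerturbation p1.ne']
    refine mul_ne_zero (pow_ne_zero _ p1.ne') ?_
    rw [one_add_div p1.ne']
    exact (div_pos p2 p1).ne'
  exact Homeomorph.contDiff_symm (𝕜 := ℝ) _
    (f₀' := fun X => ContinuousLinearMap.toContinuousLinearEquivOfDetNeZero _ (hdet X))
    (fun X => hf X) (contDiff_radialMap hζε)

end RadialMap

/-! ### Lebesgue points under change of variables; traces on the hyperplane. -/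

section Traces

variable {n : ℕ}

/-- Locally `Φ` is Lipschitz, so it maps `B_r(X)` into `B_{Kr}(Φ X)`, and the Jacobian of its
inverse is bounded. Mean deviations therefore grow by at most the factor `C K^{n+1}`. -/
lemma IsLebesguePoint.comp {u : Space n → ℝ} {c : ℝ} {X : Space n} {Φ : Space n ≃ₜ Space n}
    (hΦ : IsC1Diffeo Φ) (h : IsLebesguePoint u c (Φ X)) {ρ : ℝ} (hρ : 0 < ρ)
    (hu : IntegrableOn u (ball (Φ X) ρ)) : IsLebesguePoint (fun Y => u (Φ Y)) c X := by
  obtain ⟨L, t, ht, hL⟩ := (hΦ.contDiff.contDiffAt (x := X)).exists_lipschitzOnWith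
  obtain ⟨ε, hε, hεt⟩ := nhds_basis_closedBall.mem_iff.1 ht
  obtain ⟨C, hC, hle⟩ := hΦ.exists_setLIntegral_comp_le (μ := volume) (isCompact_closedBall X ε)
  set K : ℝ := L + 1 with hK
  have hK0 : 0 < K := by positivity
  have himg : ∀ r, 0 < r → r < ε → Φ '' ball X r ⊆ ball (Φ X) (K * r) := by
    rintro r hr hrε _ ⟨Y, hY, rfl⟩
    rw [mem_ball] at hY ⊢
    refine (hL.dist_le_mul Y (hεt (hY.trans hrε).le) X (mem_of_mem_nhds ht)).trans_lt ?_
    have : (L : ℝ) * dist Y X ≤ L * r := by gcongr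
    rw [hK, add_mul]
    linarith
  have hlim : Tendsto (fun r : ℝ => C * K ^ (n + 1) * ⨍ Y in ball (Φ X) (K * r), |u Y - c|)
      (𝓝[>] 0) (𝓝 0) := by
    have h1 : Tendsto (fun r : ℝ => K * r) (𝓝[>] 0) (𝓝[>] 0) := by
      refine tendsto_nhdsWithin_iff.2 ⟨?_, ?_⟩
      · have : Tendsto (fun r : ℝ => K * r) (𝓝 0) (𝓝 (K * 0)) :=
          (continuous_const.mul continuous_id).tendsto 0
        rw [mul_zero] at this
        exact this.mono_left nhdsWithin_le_nhds
      · filter_upwards [self_mem_nhdsWithin] with r hr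
        exact mul_pos hK0 hr
    simpa using (Tendsto.comp h h1).const_mul (C * K ^ (n + 1))
  refine squeeze_zero' (Eventually.of_forall fun r => ?_) ?_ hlim
  · exact integral_nonneg fun _ => abs_nonneg _
  filter_upwards [Ioo_mem_nhdsGT hε, Ioo_mem_nhdsGT (show 0 < ρ / K by positivity)] with r hr hr'
  have hKr : K * r < ρ := by rw [mul_comm]; exact (lt_div_iff₀ hK0).1 hr'.2
  have hui : IntegrableOn (fun Y => u Y - c) (ball (Φ X) (K * r)) := by
    have h1 := hu.mono_set (ball_subset_ball hKr.le)
    have h2 : IntegrableOn (fun _ : Space n => c) (ball (Φ X) (K * r)) :=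
      integrableOn_const measure_ball_lt_top.ne
    exact h1.sub h2
  have hm : AEStronglyMeasurable (fun Y => u (Φ Y) - c) (volume.restrict (ball X r)) :=
    hΦ.aestronglyMeasurable_comp (f := fun Y => u Y - c) measurableSet_ball
      (hui.1.mono_set (himg r hr.1 hr.2))
  have hint : ∫ Y in ball X r, |u (Φ Y) - c| ≤ C * ∫ Y in ball (Φ X) (K * r), |u Y - c| := by
    have e1 := integral_norm_eq_lintegral_enorm hm
    have e2 := integral_norm_eq_lintegral_enorm hui.1
    simp only [Real.norm_eq_abs] at e1 e2
    rw [e1, e2, ← ENNReal.toReal_ofReal hC, ← ENNReal.toReal_mul]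
    refine ENNReal.toReal_mono (ENNReal.mul_ne_top ENNReal.ofReal_ne_top hui.2.ne) ?_
    refine (hle _ (ball_subset_ball hr.2.le |>.trans ball_subset_closedBall) measurableSet_ball
      (fun Y => ‖u Y - c‖ₑ)).trans ?_
    gcongr
    exact himg r hr.1 hr.2
  have hvol : volume.real (ball (Φ X) (K * r)) = K ^ (n + 1) * volume.real (ball X r) := by
    rw [measureReal_def, measureReal_def, Measure.addHaar_ball_mul _ _ hK0.le,
      Measure.addHaar_ball_center _ X, ENNReal.toReal_mul, ENNReal.toReal_ofReal (by positivity)]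
    simp
  have hv0 : 0 < volume.real (ball X r) := ENNReal.toReal_pos (measure_ball_pos _ _ hr.1).ne' measure_ball_lt_top.ne
  rw [setAverage_eq, setAverage_eq, hvol, smul_eq_mul, smul_eq_mul]
  calc _ ≤ (volume.real (ball X r))⁻¹ * (C * ∫ Y in ball (Φ X) (K * r), |u Y - c|) := by gcongr
    _ = _ := by field_simp

lemma IsLebesguePoint.continuous_mul {u b : Space n → ℝ} {c : ℝ} {X : Space n}
    (h : IsLebesguePoint u c X) (hb : Continuous b) {ρ : ℝ} (hρ : 0 < ρ)
    (hu : IntegrableOn u (ball X ρ)) : IsLebesguePoint (fun Y => b Y * u Y) (b X * c) X := by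
  obtain ⟨M, hM⟩ := (isCompact_closedBall X ρ).exists_bound_of_continuousOn hb.continuousOn
  rw [IsLebesguePoint, Metric.tendsto_nhds]
  intro ε hε
  have hlim : Tendsto (fun r : ℝ => M * ⨍ Y in ball X r, |u Y - c|) (𝓝[>] 0) (𝓝 0) := by
    simpa using h.const_mul M
  obtain ⟨δ, hδ, hδ'⟩ := Metric.continuous_iff.1 hb X (ε / 2 / (|c| + 1)) (by positivity)
  filter_upwards [hlim.eventually_lt_const (half_pos hε), Ioo_mem_nhdsGT hδ, Ioo_mem_nhdsGT hρ]
    with r h1 h2 h3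
  have hv0 : 0 < volume.real (ball X r) := ENNReal.toReal_pos (measure_ball_pos _ _ h2.1).ne' measure_ball_lt_top.ne
  have hcst : ∀ k : ℝ, IntegrableOn (fun _ : Space n => k) (ball X r) := fun k =>
    integrableOn_const measure_ball_lt_top.ne
  have hui : IntegrableOn (fun Y => |u Y - c|) (ball X r) :=
    ((hu.mono_set (ball_subset_ball h3.2.le)).sub (hcst c)).abs
  have hav : 0 ≤ ⨍ Y in ball X r, |b Y * u Y - b X * c| := integral_nonneg fun _ => abs_nonneg _
  rw [Real.dist_eq, sub_zero, abs_of_nonneg hav]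
  have hint : ∫ Y in ball X r, |b Y * u Y - b X * c| ≤
      ∫ Y in ball X r, (M * |u Y - c| + ε / 2) := by
    refine setIntegral_mono_of_nonneg ?_ ?_ ?_
    · exact fun _ _ => abs_nonneg _
    · intro Y hY
      have e1 : b Y * u Y - b X * c = b Y * (u Y - c) + (b Y - b X) * c := by ring
      have e2 : |b Y| ≤ M := hM Y (ball_subset_closedBall (ball_subset_ball h3.2.le hY))
      have e3 : |b Y - b X| ≤ ε / 2 / (|c| + 1) := (hδ' Y ((mem_ball.1 hY).trans h2.2)).le
      rw [e1]
      refine (abs_add_le _ _).trans (add_le_add ?_ ?_)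
      · rw [abs_mul]; gcongr
      · rw [abs_mul]
        calc _ ≤ ε / 2 / (|c| + 1) * (|c| + 1) := by gcongr; linarith
          _ = _ := by field_simp
    · exact (hui.const_mul M).add (hcst _)
  rw [integral_add (hui.const_mul M) (hcst _), integral_const_mul, setIntegral_const] at hint
  rw [setAverage_eq, smul_eq_mul] at h1 ⊢
  calc _ ≤ (volume.real (ball X r))⁻¹ *
        (M * (∫ Y in ball X r, |u Y - c|) + volume.real (ball X r) • (ε / 2)) := by gcongr
    _ = M * ((volume.real (ball X r))⁻¹ * ∫ Y in ball X r, |u Y - c|) + ε / 2 := by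
        rw [smul_eq_mul]; field_simp
    _ < ε := by linarith

/-- The positivity set of the trace of `u` on the hyperplane, inside the ball of radius `r`. -/
def traceSet (u : Space n → ℝ) (r : ℝ) : Set (EuclideanSpace ℝ (Fin n)) :=
  {x | ‖x‖ < r ∧ 0 < preciseRep u (hyperplaneEmb n x)}

/-- The thin set is an isometric image of a subset of `ℝⁿ`, where the normalized Hausdorff measure
is Lebesgue measure; the Jacobian formula can then be used in `ℝⁿ`. -/
lemma measure_thinPositivitySet (u : Space n → ℝ) (r : ℝ) :
    Measure.euclideanHausdorffMeasure n (thinPositivitySet u (ball 0 r)) =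
      volume (traceSet u r) := by
  have : thinPositivitySet u (ball 0 r) = hyperplaneEmb n '' traceSet u r := by
    ext X
    constructor
    · rintro ⟨h1, h2, h3⟩
      refine ⟨hyperplaneProj n X, ⟨?_, ?_⟩, hyperplaneEmb_proj h2⟩
      · rw [← norm_hyperplaneEmb, hyperplaneEmb_proj h2]; simpa using h1
      · rwa [hyperplaneEmb_proj h2]
    · rintro ⟨x, ⟨h1, h2⟩, rfl⟩
      exact ⟨by simpa [norm_hyperplaneEmb] using h1, hyperplaneEmb_last x, h2⟩
  rw [this, isometry_hyperplaneEmb.euclideanHausdorffMeasure_image,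
    EuclideanSpace.euclideanHausdorffMeasure_eq_volume]

lemma HasWeakGradientOn.ae_isLebesguePoint_hyperplane {u : Space n → ℝ} {G : Space n → Space n}
    {R : ℝ} (h : HasWeakGradientOn u G (ball 0 R))
    (hG : ∀ r < R, ∫⁻ X in closedBall (0 : Space n) r, ‖G X‖ₑ ^ 2 ≠ ⊤) :
    ∀ᵐ x : EuclideanSpace ℝ (Fin n), ‖x‖ < R →
      IsLebesguePoint u (preciseRep u (hyperplaneEmb n x)) (hyperplaneEmb n x) := by
  have h2 := ae_all_iff.2 fun k => ae_hasEnergyGrowth_hyperplane (hG _ (exhaust_lt R k))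
  filter_upwards [h2] with x hx hxR
  obtain ⟨k, hk⟩ := exists_lt_exhaust hxR
  have hmem : hyperplaneEmb n x ∈ ball (0 : Space n) R := by
    rwa [mem_ball_zero_iff, norm_hyperplaneEmb]
  obtain ⟨c, hc⟩ := h.exists_isLebesguePoint_of_hasEnergyGrowth isOpen_ball hmem (hx k hk)
  obtain ⟨ρ, hρ, hsub⟩ := nhds_basis_closedBall.mem_iff.1 (isOpen_ball.mem_nhds hmem)
  rwa [hc.preciseRep_eq hρ ((h.locInt.integrableOn_compact_subset hsub
    (isCompact_closedBall _ _)).mono_set ball_subset_closedBall)]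

/-- Almost every point of the hyperplane inside the ball is a Lebesgue point, so the trace is an
a.e. limit of smooth functions. -/
lemma HasWeakGradientOn.nullMeasurableSet_traceSet {u : Space n → ℝ} {G : Space n → Space n}
    {R : ℝ} (h : HasWeakGradientOn u G (ball 0 R))
    (hG : ∀ r < R, ∫⁻ X in closedBall (0 : Space n) r, ‖G X‖ₑ ^ 2 ≠ ⊤) {r : ℝ} (hr : r < R) :
    NullMeasurableSet (traceSet u r) := by
  obtain ⟨w, hw, -, -, hL⟩ := h.exists_smooth_approx isOpen_ball
    (isCompact_closedBall (0 : Space n) r) (closedBall_subset_ball hr)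
  have hm : AEMeasurable (fun x => preciseRep u (hyperplaneEmb n x))
      (volume.restrict (ball 0 r)) := by
    refine aemeasurable_of_tendsto_metrizable_ae atTop
      (f := fun k x => w k (hyperplaneEmb n x)) (fun k =>
        ((hw k).continuous.comp isometry_hyperplaneEmb.continuous).aemeasurable) ?_
    refine (ae_restrict_iff' measurableSet_ball).2 ?_
    filter_upwards [h.ae_isLebesguePoint_hyperplane hG] with x hx hxr
    rw [mem_ball_zero_iff] at hxr
    exact hL _ (by rw [mem_closedBall_zero_iff, norm_hyperplaneEmb]; exact hxr.le) _
      (hx (hxr.trans hr))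
  have h1 : NullMeasurableSet {x | 0 < preciseRep u (hyperplaneEmb n x)}
      (volume.restrict (ball 0 r)) := hm.nullMeasurable measurableSet_Ioi
  have h2 : traceSet u r = ball 0 r ∩ {x | 0 < preciseRep u (hyperplaneEmb n x)} := by
    ext x; simp [traceSet]
  rw [h2, Set.inter_comm]
  exact (nullMeasurableSet_restrict measurableSet_ball.nullMeasurableSet).1 h1

end Traces

/-! ### Differentiation of parameter integrals. -/

section Differentiation

variable {α V : Type*} [MeasurableSpace α] {μ : Measure α} [NormedAddCommGroup V] [NormedSpace ℝ V]
  [MeasurableSpace V] [BorelSpace V]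

/-- Since `d` is bounded, `ε • d x` stays in a fixed neighbourhood where `A` is Lipschitz once `ε`
is small. The weight `|w|`, up to a constant, dominates the difference quotients. It serves the two
bulk terms and the thin term of the inner variation. -/
lemma hasDerivAt_integral_smul {A : V → ℝ} (hA : Measurable A) (hA1 : ContDiffAt ℝ 1 A 0)
    {d : α → V} (hd : AEStronglyMeasurable d μ) {M : ℝ} (hdM : ∀ x, ‖d x‖ ≤ M) {w : α → ℝ}
    (hw : Integrable w μ) :
    HasDerivAt (fun ε : ℝ => ∫ x, A (ε • d x) * w x ∂μ) (∫ x, fderiv ℝ A 0 (d x) * w x ∂μ) 0 := by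
  obtain ⟨K, t, ht, hK⟩ := hA1.exists_lipschitzOnWith
  obtain ⟨δ, hδ, hδt⟩ := nhds_basis_ball.mem_iff.1 ht
  have hM1 : 0 < |M| + 1 := by positivity
  have hmem : ∀ ε ∈ ball (0 : ℝ) (δ / (|M| + 1)), ∀ x, ε • d x ∈ t := by
    intro ε hε x
    refine hδt ?_
    rw [mem_ball_zero_iff] at hε ⊢
    rw [norm_smul]
    calc ‖ε‖ * ‖d x‖ ≤ ‖ε‖ * (|M| + 1) := by
          gcongr; linarith [hdM x, le_abs_self M]
      _ < δ := (lt_div_iff₀ hM1).1 hε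
  refine (hasDerivAt_integral_of_dominated_loc_of_lip (bound := fun x => K * |M| * |w x|)
    (ball_mem_nhds 0 (show 0 < δ / (|M| + 1) by positivity)) ?_ ?_ ?_ ?_ ?_ ?_).2
  · refine Eventually.of_forall fun ε => ?_
    exact (hA.comp_aemeasurable (hd.aemeasurable.const_smul ε)).aestronglyMeasurable.mul hw.1
  · simpa using hw.const_mul (A 0)
  · exact ((fderiv ℝ A 0).continuous.comp_aestronglyMeasurable hd).mul hw.1
  · refine Eventually.of_forall fun x => LipschitzOnWith.of_dist_le_mul fun ε hε ε' hε' => ?_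
    have h1 := hK.dist_le_mul _ (hmem ε hε x) _ (hmem ε' hε' x)
    rw [dist_eq_norm, dist_eq_norm, ← sub_smul, norm_smul, Real.norm_eq_abs, Real.norm_eq_abs] at h1
    rw [Real.dist_eq, Real.dist_eq, ← sub_mul, abs_mul, Real.coe_nnabs,
      abs_of_nonneg (show 0 ≤ K * |M| * |w x| by positivity)]
    calc _ ≤ K * (|ε - ε'| * |M|) * |w x| := by
          gcongr
          refine h1.trans ?_
          gcongr
          exact (hdM x).trans (le_abs_self M)
      _ = _ := by ring
  · exact hw.abs.const_mul _
  · refine Eventually.of_forall fun x => ?_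
    have h1 : HasDerivAt (fun ε : ℝ => ε • d x) (d x) 0 := by
      simpa using (hasDerivAt_id (0 : ℝ)).smul_const (d x)
    have h2 : HasFDerivAt A (fderiv ℝ A 0) ((0 : ℝ) • d x) := by
      rw [zero_smul]; exact (hA1.differentiableAt (by simp)).hasFDerivAt
    exact (h2.comp_hasDerivAt 0 h1).mul_const (w x)

end Differentiation

/-! ### Coefficients of the deformed energy and their linearization. -/

section RadialJacobian

/-- The Jacobian of the radial map `X ↦ (1 + x) X` in dimension `d`, where `y` is the additional
radial dilation. -/
def radialJacobian (d : ℕ) (p : ℝ × ℝ × ℝ) : ℝ := (1 + p.1) ^ d * (1 + p.2.1 / (1 + p.1))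

/-- The coefficient of `|G|²` in the energy density after a radial change of variables. -/
def radialCoeff (d : ℕ) (p : ℝ × ℝ × ℝ) : ℝ := radialJacobian d p / (1 + p.1) ^ 2

/-- The coefficient of `-⟨X, G⟩²` in the energy density after a radial change of variables. -/
def radialCoeffInner (d : ℕ) (p : ℝ × ℝ × ℝ) : ℝ :=
  radialCoeff d p * (p.2.2 * (2 * (1 + p.1) + p.2.1) / (1 + p.1 + p.2.1) ^ 2)

lemma measurable_radialJacobian (d : ℕ) : Measurable (radialJacobian d) := by
  unfold radialJacobian; fun_prop

lemma measurable_radialCoeff (d : ℕ) : Measurable (radialCoeff d) := by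
  unfold radialCoeff; have := measurable_radialJacobian d; fun_prop

lemma measurable_radialCoeffInner (d : ℕ) : Measurable (radialCoeffInner d) := by
  unfold radialCoeffInner; have := measurable_radialCoeff d; fun_prop

lemma contDiffAt_radialJacobian (d : ℕ) : ContDiffAt ℝ 1 (radialJacobian d) 0 := by
  unfold radialJacobian; fun_prop (disch := simp)

lemma contDiffAt_radialCoeff (d : ℕ) : ContDiffAt ℝ 1 (radialCoeff d) 0 :=
  (contDiffAt_radialJacobian d).div (by fun_prop) (by simp)

lemma contDiffAt_radialCoeffInner (d : ℕ) : ContDiffAt ℝ 1 (radialCoeffInner d) 0 :=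
  (contDiffAt_radialCoeff d).mul (by fun_prop (disch := simp))

lemma hasDerivAt_comp_smul {V : Type*} [NormedAddCommGroup V] [NormedSpace ℝ V] {A : V → ℝ}
    (hA1 : ContDiffAt ℝ 1 A 0) (v : V) :
    HasDerivAt (fun ε : ℝ => A (ε • v)) (fderiv ℝ A 0 v) 0 := by
  have h1 : HasDerivAt (fun ε : ℝ => ε • v) v 0 := by
    simpa using (hasDerivAt_id (0 : ℝ)).smul_const v
  have h2 : HasFDerivAt A (fderiv ℝ A 0) ((0 : ℝ) • v) := by
    rw [zero_smul]; exact (hA1.differentiableAt (by simp)).hasFDerivAt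
  exact h2.comp_hasDerivAt 0 h1

lemma hasDerivAt_one_add_mul (x : ℝ) : HasDerivAt (fun ε : ℝ => 1 + ε * x) x 0 := by
  simpa using ((hasDerivAt_id (0 : ℝ)).mul_const x).const_add 1

lemma hasDerivAt_radialJacobian (d : ℕ) (v : ℝ × ℝ × ℝ) :
    HasDerivAt (fun ε : ℝ => radialJacobian d (ε • v)) (d * v.1 + v.2.1) 0 := by
  have h1 := hasDerivAt_one_add_mul v.1
  have h2 : HasDerivAt (fun ε : ℝ => ε * v.2.1) v.2.1 0 := by
    simpa using (hasDerivAt_id (0 : ℝ)).mul_const v.2.1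
  have h3 := (h1.pow d).mul ((h2.div h1 (by simp)).const_add 1)
  refine HasDerivAt.congr_deriv h3 ?_
  simp

lemma fderiv_radialJacobian (d : ℕ) (v : ℝ × ℝ × ℝ) :
    fderiv ℝ (radialJacobian d) 0 v = d * v.1 + v.2.1 :=
  (hasDerivAt_comp_smul (contDiffAt_radialJacobian d) v).unique (hasDerivAt_radialJacobian d v)

/-- The volume factor contributes `d` and the squared gradient, which scales by `(1 + x)^{-2}`,
contributes `-2`. -/
lemma hasDerivAt_radialCoeff (d : ℕ) (v : ℝ × ℝ × ℝ) :
    HasDerivAt (fun ε : ℝ => radialCoeff d (ε • v)) ((d - 2) * v.1 + v.2.1) 0 := by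
  have h3 := (hasDerivAt_radialJacobian d v).div ((hasDerivAt_one_add_mul v.1).pow 2) (by simp)
  refine HasDerivAt.congr_deriv h3 ?_
  simp [radialJacobian]
  ring

lemma fderiv_radialCoeff (d : ℕ) (v : ℝ × ℝ × ℝ) :
    fderiv ℝ (radialCoeff d) 0 v = (d - 2) * v.1 + v.2.1 :=
  (hasDerivAt_comp_smul (contDiffAt_radialCoeff d) v).unique (hasDerivAt_radialCoeff d v)

/-- The coefficient contains its third variable as a factor, so only that factor is differentiated;
the remaining one equals 2 at the origin. -/
lemma fderiv_radialCoeffInner (d : ℕ) (v : ℝ × ℝ × ℝ) :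
    fderiv ℝ (radialCoeffInner d) 0 v = 2 * v.2.2 := by
  refine (hasDerivAt_comp_smul (contDiffAt_radialCoeffInner d) v).unique ?_
  have h2 : ∀ y : ℝ, HasDerivAt (fun ε : ℝ => ε * y) y 0 := fun y => by
    simpa using (hasDerivAt_id (0 : ℝ)).mul_const y
  have h1 := hasDerivAt_one_add_mul v.1
  have h3 := (hasDerivAt_radialCoeff d v).mul
    (((h2 v.2.2).mul ((h1.const_mul 2).add (h2 v.2.1))).div ((h1.add (h2 v.2.1)).pow 2) (by simp))
  refine HasDerivAt.congr_deriv h3 ?_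
  simp [radialCoeff, radialJacobian]
  ring

variable {E : Type*} [NormedAddCommGroup E]

/-- The quantities which determine the derivative of the radial map of `ζ`. -/
def radialData (ζ : ℝ → ℝ) (X : E) : ℝ × ℝ × ℝ :=
  (ζ (‖X‖ ^ 2), 2 * deriv ζ (‖X‖ ^ 2) * ‖X‖ ^ 2, 2 * deriv ζ (‖X‖ ^ 2))

lemma continuous_radialData {ζ : ℝ → ℝ} (hζ : ContDiff ℝ 1 ζ) :
    Continuous (radialData ζ : E → ℝ × ℝ × ℝ) := by
  have h1 := hζ.continuous_deriv le_rfl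
  have h2 := hζ.continuous
  unfold radialData
  fun_prop

lemma radialData_eq_zero {ζ : ℝ → ℝ} (hζ : ContDiff ℝ 1 ζ) {b : ℝ}
    (hζb : ∀ y, b ^ 2 ≤ y → ζ y = 0) {X : E} (hX : b ^ 2 ≤ ‖X‖ ^ 2) : radialData ζ X = 0 := by
  simp [radialData, hζb _ hX, deriv_eq_zero_of_eq_zero_Ici hζ hζb hX]

lemma exists_norm_radialData_le [ProperSpace E] {ζ : ℝ → ℝ} (hζ : ContDiff ℝ 1 ζ) {b : ℝ}
    (hb : 0 ≤ b) (hζb : ∀ y, b ^ 2 ≤ y → ζ y = 0) : ∃ M, ∀ X : E, ‖radialData ζ X‖ ≤ M :=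
  (hasCompactSupport_radial hb fun _ hX => radialData_eq_zero hζ hζb hX).exists_bound_of_continuous
    (continuous_radialData hζ)

lemma det_fderiv_radialMap [InnerProductSpace ℝ E] [FiniteDimensional ℝ E] {ζ : ℝ → ℝ}
    (hζ : ContDiff ℝ 1 ζ) {ε : ℝ} {X : E} (hX : 0 < 1 + ε * ζ (‖X‖ ^ 2)) :
    (fderiv ℝ (radialMap fun y => ε * ζ y) X).det =
      radialJacobian (Module.finrank ℝ E) (ε • radialData ζ X) := by
  rw [(hasFDerivAt_radialMap ((hζ.differentiable (by simp) _).hasDerivAt.const_mul ε)).fderiv,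
    det_rankOnePerturbation hX.ne']
  simp only [radialJacobian, radialData, Prod.smul_fst, Prod.smul_snd, smul_eq_mul]
  ring

end RadialJacobian

/-! ### The energy after a radial change of variables. -/

section InnerVariation

lemma eventually_integrable_smul {α V : Type*} [MeasurableSpace α] {μ : Measure α}
    [NormedAddCommGroup V] [NormedSpace ℝ V] [MeasurableSpace V] [BorelSpace V] {A : V → ℝ}
    (hA : Measurable A) (hA1 : ContDiffAt ℝ 1 A 0) {d : α → V} (hd : AEStronglyMeasurable d μ)
    {M : ℝ} (hdM : ∀ x, ‖d x‖ ≤ M) {w : α → ℝ} (hw : Integrable w μ) :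
    ∀ᶠ ε : ℝ in 𝓝 0, Integrable (fun x => A (ε • d x) * w x) μ := by
  have h1 : ∀ᶠ v in 𝓝 (0 : V), ‖A v‖ < ‖A 0‖ + 1 :=
    hA1.continuousAt.norm.eventually_lt_const (by linarith)
  obtain ⟨δ, hδ, hδt⟩ := nhds_basis_ball.mem_iff.1 h1
  have hM1 : 0 < |M| + 1 := by positivity
  filter_upwards [ball_mem_nhds (0 : ℝ) (show 0 < δ / (|M| + 1) by positivity)] with ε hε
  refine Integrable.bdd_mul (c := ‖A 0‖ + 1) hw ?_ (Eventually.of_forall fun x => ?_)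
  · exact (hA.comp_aemeasurable (hd.aemeasurable.const_smul ε)).aestronglyMeasurable
  · refine (hδt ?_ : ‖A (ε • d x)‖ < ‖A 0‖ + 1).le
    rw [mem_ball_zero_iff] at hε ⊢
    rw [norm_smul]
    calc ‖ε‖ * ‖d x‖ ≤ ‖ε‖ * (|M| + 1) := by
          gcongr; linarith [hdM x, le_abs_self M]
      _ < δ := (lt_div_iff₀ hM1).1 hε

variable {n : ℕ}

/-- This is the energy density of `u ∘ Ψ⁻¹` pulled back to `X`. Since `DΨ` is symmetric, the
transformed gradient `q` solves `DΨ q = p`, and the norm formula for rank-one perturbations applies.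
-/
lemma abs_det_mul_norm_sq_adjoint {ζ : ℝ → ℝ} (hζ : ContDiff ℝ 1 ζ) {ε : ℝ} {Ψ : Space n ≃ₜ Space n}
    (hΨ : IsC1Diffeo Ψ) (hΨe : ∀ X, Ψ X = radialMap (fun y => ε * ζ y) X) {X : Space n}
    (h1 : 0 < 1 + ε * ζ (‖X‖ ^ 2))
    (h2 : 0 < 1 + ε * ζ (‖X‖ ^ 2) + 2 * (ε * deriv ζ (‖X‖ ^ 2)) * ‖X‖ ^ 2) (p : Space n) :
    |(fderiv ℝ Ψ X).det| * ‖ContinuousLinearMap.adjoint (fderiv ℝ Ψ.symm (Ψ X)) p‖ ^ 2 =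
      radialCoeff (n + 1) (ε • radialData ζ X) * ‖p‖ ^ 2 -
        radialCoeffInner (n + 1) (ε • radialData ζ X) * inner ℝ X p ^ 2 := by
  have hfun : (Ψ : Space n → Space n) = radialMap fun y => ε * ζ y := funext hΨe
  have hd : fderiv ℝ Ψ X =
      rankOnePerturbation (1 + ε * ζ (‖X‖ ^ 2)) (2 * (ε * deriv ζ (‖X‖ ^ 2))) X := by
    rw [hfun]
    exact (hasFDerivAt_radialMap ((hζ.differentiable (by simp) _).hasDerivAt.const_mul ε)).fderiv
  have hdet : (fderiv ℝ Ψ X).det = radialJacobian (n + 1) (ε • radialData ζ X) := by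
    rw [hfun, det_fderiv_radialMap hζ h1, finrank_euclideanSpace_fin]
  have hJ : 0 < radialJacobian (n + 1) (ε • radialData ζ X) := by
    rw [radialJacobian]
    simp only [radialData, Prod.smul_fst, Prod.smul_snd, smul_eq_mul]
    refine mul_pos (pow_pos h1 _) ?_
    rw [one_add_div h1.ne']
    exact div_pos (by linarith) h1
  have hcomp : (fderiv ℝ Ψ.symm (Ψ X)).comp (fderiv ℝ Ψ X) = ContinuousLinearMap.id ℝ _ := by
    rw [← fderiv_comp X (hΨ.symm.differentiable _) (hΨ.differentiable X)]
    have : Ψ.symm ∘ Ψ = id := by ext1 Y; simp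
    rw [this, fderiv_id]
  have hq : rankOnePerturbation (1 + ε * ζ (‖X‖ ^ 2)) (2 * (ε * deriv ζ (‖X‖ ^ 2))) X
      (ContinuousLinearMap.adjoint (fderiv ℝ Ψ.symm (Ψ X)) p) = p := by
    rw [← rankOnePerturbation_adjoint, ← hd, ← ContinuousLinearMap.comp_apply,
      ← ContinuousLinearMap.adjoint_comp, hcomp]
    refine ext_inner_right ℝ fun v => ?_
    rw [ContinuousLinearMap.adjoint_inner_left, ContinuousLinearMap.id_apply]
  rw [norm_sq_of_rankOnePerturbation_apply_eq h1.ne' h2.ne' hq, hdet, abs_of_pos hJ,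
    radialCoeffInner, radialCoeff]
  simp only [radialData, Prod.smul_fst, Prod.smul_snd, smul_eq_mul]
  ring

lemma dirichletEnergy_comp_radialMap {u : Space n → ℝ} {G : Space n → Space n} {R r b : ℝ}
    (h : HasWeakGradientOn u G (ball 0 R)) (hbr : b ≤ r) (hrR : r ≤ R)
    {ζ : ℝ → ℝ} (hζ : ContDiff ℝ 1 ζ) (hb : 0 ≤ b) (hζb : ∀ y, b ^ 2 ≤ y → ζ y = 0)
    {ε : ℝ} {Ψ : Space n ≃ₜ Space n} (hΨ : IsC1Diffeo Ψ)
    (hΨe : ∀ X, Ψ X = radialMap (fun y => ε * ζ y) X)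
    (hpos : ∀ X : Space n, 0 < 1 + ε * ζ (‖X‖ ^ 2) ∧
      0 < 1 + ε * ζ (‖X‖ ^ 2) + 2 * (ε * deriv ζ (‖X‖ ^ 2)) * ‖X‖ ^ 2)
    (hi1 : IntegrableOn (fun X => radialCoeff (n + 1) (ε • radialData ζ X) * ‖G X‖ ^ 2) (ball 0 r))
    (hi2 : IntegrableOn (fun X => radialCoeffInner (n + 1) (ε • radialData ζ X) *
      inner ℝ X (G X) ^ 2) (ball 0 r)) :
    dirichletEnergy (fun X => u (Ψ.symm X)) (ball 0 r) = ENNReal.ofReal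
      ((∫ X in ball 0 r, radialCoeff (n + 1) (ε • radialData ζ X) * ‖G X‖ ^ 2) -
        ∫ X in ball 0 r, radialCoeffInner (n + 1) (ε • radialData ζ X) * inner ℝ X (G X) ^ 2) ∧
    0 ≤ (∫ X in ball 0 r, radialCoeff (n + 1) (ε • radialData ζ X) * ‖G X‖ ^ 2) -
        ∫ X in ball 0 r, radialCoeffInner (n + 1) (ε • radialData ζ X) * inner ℝ X (G X) ^ 2 := by
  have hfix : ∀ X, b ≤ ‖X‖ → Ψ X = X := fun X hX => by
    rw [hΨe, radialMap_eq_self hb (fun y hy => by rw [hζb y hy, mul_zero]) hX]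
  have hmaps : ∀ X ∈ ball (0 : Space n) R, Ψ.symm X ∈ ball (0 : Space n) R := by
    intro X hX
    rw [← image_ball_of_eq_self hfix (hbr.trans hrR)] at hX
    obtain ⟨Y, hY, rfl⟩ := hX
    rwa [Ψ.symm_apply_apply]
  have hv := h.pullback isOpen_ball (b := fun _ => 1) contDiff_const hΨ.symm hmaps
  simp only [one_mul] at hv
  rw [dirichletEnergy_eq (hv.mono isOpen_ball (ball_subset_ball hrR)) isOpen_ball]
  rw [← image_ball_of_eq_self hfix hbr, hΨ.setLIntegral_image measurableSet_ball,
    image_ball_of_eq_self hfix hbr]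
  have hpt : ∀ X, ENNReal.ofReal |(fderiv ℝ Ψ X).det| *
      ‖pullbackGradient (fun _ => 1) Ψ.symm u G (Ψ X)‖ₑ ^ 2 =
      ENNReal.ofReal (radialCoeff (n + 1) (ε • radialData ζ X) * ‖G X‖ ^ 2 -
        radialCoeffInner (n + 1) (ε • radialData ζ X) * inner ℝ X (G X) ^ 2) := by
    intro X
    rw [← abs_det_mul_norm_sq_adjoint hζ hΨ hΨe (hpos X).1 (hpos X).2,
      ENNReal.ofReal_mul (abs_nonneg _), ENNReal.ofReal_pow (norm_nonneg _), ofReal_norm]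
    simp [pullbackGradient, gradient]
  have hnn : ∀ X, 0 ≤ radialCoeff (n + 1) (ε • radialData ζ X) * ‖G X‖ ^ 2 -
        radialCoeffInner (n + 1) (ε • radialData ζ X) * inner ℝ X (G X) ^ 2 := fun X => by
    rw [← abs_det_mul_norm_sq_adjoint hζ hΨ hΨe (hpos X).1 (hpos X).2]; positivity
  rw [← integral_sub hi1 hi2]
  refine ⟨?_, integral_nonneg hnn⟩
  exact (lintegral_congr hpt).trans
    (ofReal_integral_eq_lintegral_ofReal (hi1.sub hi2) (Eventually.of_forall hnn)).symm

/-- On the hyperplane `Ψ` acts as the lower-dimensional radial map `ψ` with the same profile. At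
almost every point the trace of `u ∘ Ψ⁻¹` is the transported trace, because Lebesgue points are
preserved. Up to a null set the new positivity set is thus the image under `ψ`, measured by its
`n`-dimensional Jacobian. -/
lemma measure_traceSet_comp_radialMap {u : Space n → ℝ} {G : Space n → Space n} {R r b : ℝ}
    (h : HasWeakGradientOn u G (ball 0 R))
    (hG : ∀ r < R, ∫⁻ X in closedBall (0 : Space n) r, ‖G X‖ₑ ^ 2 ≠ ⊤) (hbr : b ≤ r) (hrR : r < R)
    {ζ : ℝ → ℝ} (hζ : ContDiff ℝ 1 ζ) (hb : 0 ≤ b) (hζb : ∀ y, b ^ 2 ≤ y → ζ y = 0)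
    {ε : ℝ} {Ψ : Space n ≃ₜ Space n} (hΨ : IsC1Diffeo Ψ)
    (hΨe : ∀ X, Ψ X = radialMap (fun y => ε * ζ y) X)
    {ψ : EuclideanSpace ℝ (Fin n) ≃ₜ EuclideanSpace ℝ (Fin n)} (hψ : IsC1Diffeo ψ)
    (hψe : ∀ x, ψ x = radialMap (fun y => ε * ζ y) x)
    (hpos : ∀ x : EuclideanSpace ℝ (Fin n), 0 < 1 + ε * ζ (‖x‖ ^ 2) ∧
      0 < 1 + ε * ζ (‖x‖ ^ 2) + 2 * (ε * deriv ζ (‖x‖ ^ 2)) * ‖x‖ ^ 2)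
    (hi : IntegrableOn (fun x => radialJacobian n (ε • radialData ζ x)) (traceSet u r)) :
    volume (traceSet (fun X => u (Ψ.symm X)) r) =
      ENNReal.ofReal (∫ x in traceSet u r, radialJacobian n (ε • radialData ζ x)) ∧
    0 ≤ ∫ x in traceSet u r, radialJacobian n (ε • radialData ζ x) := by
  have hfix : ∀ x, b ≤ ‖x‖ → ψ x = x := fun X hX => by
    rw [hψe, radialMap_eq_self hb (fun y hy => by rw [hζb y hy, mul_zero]) hX]
  have hmaps : ∀ s, b ≤ s → ∀ x, ‖ψ.symm x‖ < s ↔ ‖x‖ < s := by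
    intro s hs x
    rw [← mem_ball_zero_iff, ← mem_ball_zero_iff, ← image_ball_of_eq_self hfix hs,
      ← ψ.injective.mem_set_image (s := ψ '' ball 0 s), ψ.apply_symm_apply,
      image_ball_of_eq_self hfix hs, image_ball_of_eq_self hfix hs]
  have hemb : ∀ x, Ψ.symm (hyperplaneEmb n x) = hyperplaneEmb n (ψ.symm x) := by
    intro x
    rw [Homeomorph.symm_apply_eq, hΨe, radialMap, norm_hyperplaneEmb, ← hyperplaneEmb_smul]
    have := hψe (ψ.symm x)
    rw [ψ.apply_symm_apply, radialMap] at this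
    rw [← this]
  have hset : traceSet (fun X => u (Ψ.symm X)) r =ᵐ[volume] ψ '' traceSet u r := by
    have h1 := hψ.symm.quasiMeasurePreserving.ae (h.ae_isLebesguePoint_hyperplane hG)
    filter_upwards [h1] with x hx
    refine propext ?_
    rw [ψ.image_eq_preimage_symm]
    change (‖x‖ < r ∧ 0 < _) ↔ (‖ψ.symm x‖ < r ∧ 0 < _)
    rw [hmaps r hbr]
    refine and_congr_right fun hxr => ?_
    have hxR : ‖ψ.symm x‖ < R := (hmaps R (hbr.trans hrR.le) x).2 (hxr.trans hrR)
    have hL := hx hxR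
    rw [← hemb] at hL
    have hmem : Ψ.symm (hyperplaneEmb n x) ∈ ball (0 : Space n) R := by
      rwa [hemb, mem_ball_zero_iff, norm_hyperplaneEmb]
    obtain ⟨ρ, hρ, hsub⟩ := nhds_basis_closedBall.mem_iff.1 (isOpen_ball.mem_nhds hmem)
    have hu := (h.locInt.integrableOn_compact_subset hsub (isCompact_closedBall _ _)).mono_set
      ball_subset_closedBall
    have hLv := IsLebesguePoint.comp hΨ.symm hL hρ hu
    have hmem' : hyperplaneEmb n x ∈ Ψ.symm ⁻¹' ball (0 : Space n) R := hmem
    obtain ⟨ε', hε', hsub'⟩ := nhds_basis_closedBall.mem_iff.1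
      ((isOpen_ball.preimage Ψ.symm.continuous).mem_nhds hmem')
    have hv : IntegrableOn (fun X => u (Ψ.symm X)) (ball (hyperplaneEmb n x) ε') := by
      refine (hΨ.symm.integrableOn_comp (isCompact_closedBall _ _) ?_).mono_set ball_subset_closedBall
      exact h.locInt.integrableOn_compact_subset (Set.image_subset_iff.2 hsub')
        ((isCompact_closedBall _ _).image Ψ.symm.continuous)
    rw [hLv.preciseRep_eq hε' hv, hemb]
  have hT := h.nullMeasurableSet_traceSet hG hrR
  -- The change of variables requires a measurable set, while the trace set is only null-measurable.
  obtain ⟨t, -, ht, hTt⟩ := hT.exists_measurable_superset_ae_eq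
  have himg : ψ '' traceSet u r =ᵐ[volume] ψ '' t := by
    rw [ψ.image_eq_preimage_symm, ψ.image_eq_preimage_symm]
    exact hψ.symm.quasiMeasurePreserving.preimage_ae_eq hTt.symm
  have hfun : (ψ : EuclideanSpace ℝ (Fin n) → EuclideanSpace ℝ (Fin n)) =
      radialMap fun y => ε * ζ y := funext hψe
  have hJ : ∀ x : EuclideanSpace ℝ (Fin n), 0 ≤ radialJacobian n (ε • radialData ζ x) := by
    intro x
    obtain ⟨h1, h2⟩ := hpos x
    rw [radialJacobian]
    simp only [radialData, Prod.smul_fst, Prod.smul_snd, smul_eq_mul]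
    refine mul_nonneg (pow_nonneg h1.le _) ?_
    rw [one_add_div h1.ne']
    exact div_nonneg (by linarith) h1.le
  refine ⟨?_, integral_nonneg hJ⟩
  rw [measure_congr hset, measure_congr himg, ← setLIntegral_one, hψ.setLIntegral_image ht,
    ofReal_integral_eq_lintegral_ofReal hi (Eventually.of_forall hJ),
    Measure.restrict_congr_set hTt]
  refine lintegral_congr fun x => ?_
  rw [mul_one, hfun, det_fderiv_radialMap hζ (hpos x).1, finrank_euclideanSpace_fin,
    abs_of_nonneg (hJ x)]

end InnerVariation

/-! ### Stationarity under inner and outer radial variations. -/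

section FirstVariation

variable {n : ℕ}

lemma IsMinimizer.energy_le_of_eq_outside {u v : Space n → ℝ} {R r b : ℝ}
    (hmin : IsMinimizer u (ball 0 R)) (hr : 0 < r) (hrR : r < R) (hbr : b < r)
    (hv : MemH1loc v (ball 0 R)) (heq : ∀ X, b < ‖X‖ → v X = u X) :
    energy u (ball 0 r) ≤ energy v (ball 0 r) := by
  refine hmin.2 (ball 0 r) isOpen_ball ((convex_ball _ _).isConnected ⟨0, mem_ball_self hr⟩)
    ?_ ?_ v hv ⟨{X | b < ‖X‖}, isOpen_lt continuous_const continuous_norm, ?_, ?_⟩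
  · rw [closure_ball _ hr.ne']; exact isCompact_closedBall _ _
  · rw [closure_ball _ hr.ne']; exact closedBall_subset_ball hrR
  · rintro X ⟨-, hX⟩
    rw [mem_ball_zero_iff, not_lt] at hX
    exact hbr.trans_le hX
  · have hm : MeasurableSet ({X : Space n | b < ‖X‖} ∩ ball 0 R) :=
      ((isOpen_lt continuous_const continuous_norm).inter isOpen_ball).measurableSet
    exact (ae_restrict_iff' hm).2 (Eventually.of_forall fun X hX => heq X hX.1)

lemma lintegral_ne_top_of_memLp {G : Space n → Space n} {R : ℝ}
    (hL2 : ∀ K ⊆ ball (0 : Space n) R, IsCompact K → MemLp G 2 (volume.restrict K)) :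
    ∀ r < R, ∫⁻ X in closedBall (0 : Space n) r, ‖G X‖ₑ ^ 2 ≠ ⊤ := fun _ hr =>
  (IsC1Diffeo.memLp_two_iff.1 (hL2 _ (closedBall_subset_ball hr) (isCompact_closedBall _ _))).2.ne

lemma integrableOn_inner_sq {G : Space n → Space n} {r : ℝ}
    (hG : MemLp G 2 (volume.restrict (ball 0 r))) :
    IntegrableOn (fun X => inner ℝ X (G X) ^ 2) (ball 0 r) := by
  have h1 : IntegrableOn (fun X => ‖G X‖ ^ 2) (ball 0 r) := hG.integrable_norm_pow (by simp)
  refine (h1.const_mul (r ^ 2)).mono'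
    ((continuous_id.aestronglyMeasurable.inner hG.1).pow 2) ?_
  refine (ae_restrict_iff' measurableSet_ball).2 (Eventually.of_forall fun X hX => ?_)
  rw [Real.norm_of_nonneg (sq_nonneg _), ← mul_pow, ← sq_abs]
  gcongr
  refine (abs_real_inner_le_norm _ _).trans ?_
  gcongr
  exact (mem_ball_zero_iff.1 hX).le

lemma integrableOn_mul_inner {u : Space n → ℝ} {G : Space n → Space n} {r : ℝ}
    (hu : MemLp u 2 (volume.restrict (ball 0 r))) (hG : MemLp G 2 (volume.restrict (ball 0 r))) :
    IntegrableOn (fun X => u X * inner ℝ X (G X)) (ball 0 r) := by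
  refine (hu.integrable_sq.add (integrableOn_inner_sq hG)).mono'
    (hu.1.mul (continuous_id.aestronglyMeasurable.inner hG.1)) (Eventually.of_forall fun X => ?_)
  simp only [Pi.add_apply]
  rw [Real.norm_eq_abs, abs_le]
  constructor <;> nlinarith [sq_nonneg (u X + inner ℝ X (G X)), sq_nonneg (u X - inner ℝ X (G X)),
    sq_nonneg (u X), sq_nonneg (inner ℝ X (G X))]

lemma measure_traceSet_lt_top (u : Space n → ℝ) (r : ℝ) : volume (traceSet u r) < ⊤ := by
  refine (measure_mono (t := ball 0 r) fun x hx => ?_).trans_lt measure_ball_lt_top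
  exact mem_ball_zero_iff.2 hx.1

/-- The first variation of the energy under radial deformations of the domain. -/
theorem IsMinimizer.integral_radialData_inner {u : Space n → ℝ} {G : Space n → Space n} {R r b : ℝ}
    (hmin : IsMinimizer u (ball 0 R)) (h : HasWeakGradientOn u G (ball 0 R))
    (hL2 : ∀ K ⊆ ball (0 : Space n) R, IsCompact K → MemLp G 2 (volume.restrict K))
    (hb : 0 ≤ b) (hbr : b < r) (hrR : r < R) {ζ : ℝ → ℝ} (hζ : ContDiff ℝ 1 ζ)
    (hζb : ∀ y, b ^ 2 ≤ y → ζ y = 0) :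
    (∫ X in ball (0 : Space n) r,
        ((n - 1) * (radialData ζ X).1 + (radialData ζ X).2.1) * ‖G X‖ ^ 2) -
      (∫ X in ball (0 : Space n) r, 2 * (radialData ζ X).2.2 * inner ℝ X (G X) ^ 2) +
      ∫ x in traceSet u r, (n * (radialData ζ x).1 + (radialData ζ x).2.1) = 0 := by
  have hG := lintegral_ne_top_of_memLp hL2
  have hr : 0 < r := hb.trans_lt hbr
  have hGr : MemLp G 2 (volume.restrict (ball 0 r)) :=
    (hL2 _ (closedBall_subset_ball hrR) (isCompact_closedBall _ _)).mono_measure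
      (Measure.restrict_mono ball_subset_closedBall le_rfl)
  have hw1 : IntegrableOn (fun X => ‖G X‖ ^ 2) (ball 0 r) := hGr.integrable_norm_pow (by simp)
  have hw2 := integrableOn_inner_sq hGr
  have hw3 : IntegrableOn (fun _ : EuclideanSpace ℝ (Fin n) => (1 : ℝ)) (traceSet u r) :=
    integrableOn_const (measure_traceSet_lt_top u r).ne
  obtain ⟨M, hM⟩ := exists_norm_radialData_le (E := Space n) hζ hb hζb
  obtain ⟨M', hM'⟩ := exists_norm_radialData_le (E := EuclideanSpace ℝ (Fin n)) hζ hb hζb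
  have hd : ∀ μ : Measure (Space n), AEStronglyMeasurable (radialData ζ) μ := fun μ =>
    (continuous_radialData hζ).aestronglyMeasurable
  have hd' : ∀ μ : Measure (EuclideanSpace ℝ (Fin n)), AEStronglyMeasurable (radialData ζ) μ :=
    fun μ => (continuous_radialData hζ).aestronglyMeasurable
  set f1 : ℝ → ℝ := fun ε => ∫ X in ball (0 : Space n) r,
    radialCoeff (n + 1) (ε • radialData ζ X) * ‖G X‖ ^ 2 with hf1
  set f2 : ℝ → ℝ := fun ε => ∫ X in ball (0 : Space n) r,
    radialCoeffInner (n + 1) (ε • radialData ζ X) * inner ℝ X (G X) ^ 2 with hf2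
  set f3 : ℝ → ℝ := fun ε => ∫ x in traceSet u r, radialJacobian n (ε • radialData ζ x) * 1 with hf3
  have d1 := hasDerivAt_integral_smul (measurable_radialCoeff (n + 1))
    (contDiffAt_radialCoeff (n + 1)) (hd _) hM hw1
  have d2 := hasDerivAt_integral_smul (measurable_radialCoeffInner (n + 1))
    (contDiffAt_radialCoeffInner (n + 1)) (hd _) hM hw2
  have d3 := hasDerivAt_integral_smul (measurable_radialJacobian n)
    (contDiffAt_radialJacobian n) (hd' _) hM' hw3
  have hF := (d1.sub d2).add d3
  have hdata : ∀ᶠ ε : ℝ in 𝓝 0, ∃ Ψ : Space n ≃ₜ Space n, IsC1Diffeo Ψ ∧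
      (∀ X, Ψ X = radialMap (fun y => ε * ζ y) X) ∧
      energy (fun X => u (Ψ.symm X)) (ball 0 r) = ENNReal.ofReal (f1 ε - f2 ε + f3 ε) ∧
      0 ≤ f1 ε - f2 ε + f3 ε := by
    filter_upwards [exists_homeomorph_radialMap (E := Space n) hζ hb hζb,
      exists_homeomorph_radialMap (E := EuclideanSpace ℝ (Fin n)) hζ hb hζb,
      eventually_integrable_smul (measurable_radialCoeff (n + 1))
        (contDiffAt_radialCoeff (n + 1)) (hd _) hM hw1,
      eventually_integrable_smul (measurable_radialCoeffInner (n + 1))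
        (contDiffAt_radialCoeffInner (n + 1)) (hd _) hM hw2,
      eventually_integrable_smul (measurable_radialJacobian n)
        (contDiffAt_radialJacobian n) (hd' _) hM' hw3]
      with ε ⟨Ψ, hΨ, hΨe, hpos⟩ ⟨ψ, hψ, hψe, hpos'⟩ i1 i2 i3
    simp only [mul_one] at i3
    obtain ⟨e1, e2⟩ := dirichletEnergy_comp_radialMap h hbr.le hrR.le hζ hb hζb hΨ hΨe hpos i1 i2
    obtain ⟨e3, e4⟩ := measure_traceSet_comp_radialMap h hG hbr.le hrR hζ hb hζb hΨ hΨe hψ hψe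
      hpos' i3
    simp only [hf1, hf2, hf3, mul_one]
    refine ⟨Ψ, hΨ, hΨe, ?_, add_nonneg e2 e4⟩
    rw [energy, measure_thinPositivitySet, e1, e3, ENNReal.ofReal_add e2 e4]
  have hmin' : IsLocalMin (fun ε => f1 ε - f2 ε + f3 ε) 0 := by
    -- At `ε = 0` the deformation is the identity, so the value of the functional there is the
    -- energy of `u` itself.
    obtain ⟨Ψ₀, -, hΨ₀, e0, -⟩ := hdata.self_of_nhds
    have hid : ∀ X, Ψ₀.symm X = X := fun X => by
      rw [Homeomorph.symm_apply_eq, hΨ₀, radialMap]; simp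
    simp only [hid] at e0
    filter_upwards [hdata] with ε ⟨Ψ, hΨ, hΨe, e1, e2⟩
    refine (ENNReal.ofReal_le_ofReal_iff e2).1 ?_
    rw [← e0, ← e1]
    have hfix : ∀ X, b ≤ ‖X‖ → Ψ X = X := fun X hX => by
      rw [hΨe, radialMap_eq_self hb (fun y hy => by rw [hζb y hy, mul_zero]) hX]
    refine hmin.energy_le_of_eq_outside hr hrR hbr ?_ ?_
    · have hmaps : ∀ X ∈ ball (0 : Space n) R, Ψ.symm X ∈ ball (0 : Space n) R := by
        intro X hX
        rw [← image_ball_of_eq_self hfix (hbr.trans hrR).le] at hX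
        obtain ⟨Y, hY, rfl⟩ := hX
        rwa [Ψ.symm_apply_apply]
      have := memH1loc_pullback hmin.1 isOpen_ball (b := fun _ => 1) contDiff_const hΨ.symm hmaps
      simpa only [one_mul] using this
    · intro X hX
      congr 1
      rw [Homeomorph.symm_apply_eq, hfix X hX.le]
  have key := hmin'.hasDerivAt_eq_zero hF
  simp only [fderiv_radialCoeff, fderiv_radialCoeffInner, fderiv_radialJacobian, mul_one] at key
  rw [← key]
  push_cast
  congr 4
  ext X
  ring

/-- The first variation of the energy under multiplication by a radial function. -/
theorem IsMinimizer.integral_radialData_outer {u : Space n → ℝ} {G : Space n → Space n} {R r b : ℝ}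
    (hmin : IsMinimizer u (ball 0 R)) (h : HasWeakGradientOn u G (ball 0 R))
    (hu2 : ∀ K ⊆ ball (0 : Space n) R, IsCompact K → MemLp u 2 (volume.restrict K))
    (hL2 : ∀ K ⊆ ball (0 : Space n) R, IsCompact K → MemLp G 2 (volume.restrict K))
    (hb : 0 ≤ b) (hbr : b < r) (hrR : r < R) {ζ : ℝ → ℝ} (hζ : ContDiff ℝ 1 ζ)
    (hζb : ∀ y, b ^ 2 ≤ y → ζ y = 0) :
    ∫ X in ball (0 : Space n) r,
      ((radialData ζ X).1 * ‖G X‖ ^ 2 + (radialData ζ X).2.2 * (u X * inner ℝ X (G X))) = 0 := by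
  have hG := lintegral_ne_top_of_memLp hL2
  have hr : 0 < r := hb.trans_lt hbr
  have hmono : volume.restrict (ball (0 : Space n) r) ≤ volume.restrict (closedBall 0 r) :=
    Measure.restrict_mono ball_subset_closedBall le_rfl
  have hGr : MemLp G 2 (volume.restrict (ball 0 r)) :=
    (hL2 _ (closedBall_subset_ball hrR) (isCompact_closedBall _ _)).mono_measure hmono
  have hur : MemLp u 2 (volume.restrict (ball 0 r)) :=
    (hu2 _ (closedBall_subset_ball hrR) (isCompact_closedBall _ _)).mono_measure hmono
  have hw1 : IntegrableOn (fun X => ‖G X‖ ^ 2) (ball 0 r) := hGr.integrable_norm_pow (by simp)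
  have hw3 : IntegrableOn (fun X => u X ^ 2) (ball 0 r) := hur.integrable_sq
  have hw2 := integrableOn_mul_inner hur hGr
  obtain ⟨M, hM⟩ := exists_norm_radialData_le (E := Space n) hζ hb hζb
  have hcd : Continuous (radialData ζ : Space n → _) := continuous_radialData hζ
  have hbd : ∀ {w : Space n → ℝ}, IntegrableOn w (ball 0 r) → ∀ g : Space n → ℝ, Continuous g →
      IntegrableOn (fun X => g X * w X) (ball 0 r) := by
    intro w hw g hg
    obtain ⟨C, hC⟩ := (isCompact_closedBall (0 : Space n) r).exists_bound_of_continuousOn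
      hg.continuousOn
    refine Integrable.bdd_mul (c := C) hw hg.aestronglyMeasurable ?_
    exact (ae_restrict_iff' measurableSet_ball).2
      (Eventually.of_forall fun X hX => hC X (ball_subset_closedBall hX))
  set e0 := ∫ X in ball (0 : Space n) r, ‖G X‖ ^ 2 with he0
  set e1 := ∫ X in ball (0 : Space n) r,
      ((radialData ζ X).1 * ‖G X‖ ^ 2 + (radialData ζ X).2.2 * (u X * inner ℝ X (G X))) with he1
  have i1 : IntegrableOn (fun X : Space n =>
      (radialData ζ X).1 * ‖G X‖ ^ 2 + (radialData ζ X).2.2 * (u X * inner ℝ X (G X))) (ball 0 r) :=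
    (hbd hw1 _ (by fun_prop)).add (hbd hw2 _ (by fun_prop))
  have i2 : IntegrableOn (fun X : Space n => (radialData ζ X).1 ^ 2 * ‖G X‖ ^ 2 +
      2 * (radialData ζ X).1 * (radialData ζ X).2.2 * (u X * inner ℝ X (G X)) +
      (radialData ζ X).2.2 ^ 2 * ‖X‖ ^ 2 * u X ^ 2) (ball 0 r) :=
    ((hbd hw1 _ (by fun_prop)).add (hbd hw2 _ (by fun_prop))).add (hbd hw3 _ (by fun_prop))
  set e2 := ∫ X in ball (0 : Space n) r, ((radialData ζ X).1 ^ 2 * ‖G X‖ ^ 2 +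
      2 * (radialData ζ X).1 * (radialData ζ X).2.2 * (u X * inner ℝ X (G X)) +
      (radialData ζ X).2.2 ^ 2 * ‖X‖ ^ 2 * u X ^ 2) with he2
  -- The Dirichlet integral of `(1 + εζ)u` is exactly this quadratic polynomial, so differentiation
  -- under the integral is not needed.
  have hmin' : IsLocalMin (fun ε : ℝ => e0 + ε * (2 * e1) + ε ^ 2 * e2) 0 := by
    have hsmall : ∀ᶠ ε : ℝ in 𝓝 0, |ε| * M < 1 := by
      have : Tendsto (fun ε : ℝ => |ε| * M) (𝓝 0) (𝓝 (|0| * M)) :=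
        (continuous_abs.mul continuous_const).tendsto 0
      rw [abs_zero, zero_mul] at this
      exact this.eventually_lt_const (by norm_num)
    filter_upwards [hsmall] with ε hε
    set β : Space n → ℝ := fun X => 1 + ε * ζ (‖X‖ ^ 2) with hβ
    have hβ1 : ContDiff ℝ 1 β :=
      contDiff_const.add (contDiff_const.mul (hζ.comp (contDiff_norm_sq ℝ)))
    have hβpos : ∀ X, 0 < β X := by
      intro X
      have e1 : |ε * ζ (‖X‖ ^ 2)| < 1 := by
        rw [abs_mul]
        refine (mul_le_mul_of_nonneg_left ?_ (abs_nonneg _)).trans_lt hε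
        exact (norm_fst_le (radialData ζ X)).trans (hM X)
      rw [abs_lt] at e1
      simp only [hβ]
      linarith
    have hgrad : ∀ X, gradient β X = (ε * (radialData ζ X).2.2) • X := by
      intro X
      have h1 : HasFDerivAt β (ε • (deriv ζ (‖X‖ ^ 2) • (2 • innerSL ℝ X))) X :=
        ((((hζ.differentiable (by simp) _).hasDerivAt.comp_hasFDerivAt X
          (hasStrictFDerivAt_norm_sq X).hasFDerivAt)).const_mul ε).const_add 1
      refine ext_inner_right ℝ fun v => ?_
      rw [gradient, InnerProductSpace.toDual_symm_apply, h1.fderiv, inner_smul_left]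
      simp [radialData]
      ring
    have hmaps : ∀ X ∈ ball (0 : Space n) R, Homeomorph.refl (Space n) X ∈ ball (0 : Space n) R :=
      fun X hX => hX
    have hv : HasWeakGradientOn (fun X => β X * u X) (pullbackGradient β id u G) (ball 0 R) :=
      h.pullback isOpen_ball hβ1 IsC1Diffeo.refl hmaps
    have hvH : MemH1loc (fun X => β X * u X) (ball 0 R) :=
      memH1loc_pullback hmin.1 isOpen_ball hβ1 IsC1Diffeo.refl hmaps
    have hle := hmin.energy_le_of_eq_outside hr hrR hbr hvH fun X hX => by
      simp only [hβ]
      rw [hζb _ (by gcongr), mul_zero, add_zero, one_mul]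
    -- Multiplication by a positive continuous factor preserves the sign of the trace at Lebesgue
    -- points. The thin terms are equal and finite, so they cancel.
    have hthin : volume (traceSet (fun X => β X * u X) r) = volume (traceSet u r) := by
      refine measure_congr ?_
      filter_upwards [h.ae_isLebesguePoint_hyperplane hG] with x hx
      refine propext (and_congr_right fun hxr => ?_)
      have hmem : hyperplaneEmb n x ∈ ball (0 : Space n) R := by
        rw [mem_ball_zero_iff, norm_hyperplaneEmb]; exact hxr.trans hrR
      obtain ⟨ρ, hρ, hsub⟩ := nhds_basis_closedBall.mem_iff.1 (isOpen_ball.mem_nhds hmem)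
      have hu := h.locInt.integrableOn_compact_subset hsub (isCompact_closedBall _ _)
      have hvi : IntegrableOn (fun X => β X * u X) (ball (hyperplaneEmb n x) ρ) :=
        (hu.continuousOn_mul hβ1.continuous.continuousOn (isCompact_closedBall _ _)).mono_set
          ball_subset_closedBall
      rw [((hx (hxr.trans hrR)).continuous_mul hβ1.continuous hρ
        (hu.mono_set ball_subset_closedBall)).preciseRep_eq hρ hvi]
      exact mul_pos_iff_of_pos_left (hβpos _)
    rw [energy, energy, measure_thinPositivitySet, measure_thinPositivitySet, hthin,
      ENNReal.add_le_add_iff_right (measure_traceSet_lt_top u r).ne,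
      dirichletEnergy_eq (h.mono isOpen_ball (ball_subset_ball hrR.le)) isOpen_ball,
      dirichletEnergy_eq (hv.mono isOpen_ball (ball_subset_ball hrR.le)) isOpen_ball] at hle
    have hpt : ∀ X, ‖pullbackGradient β id u G X‖ ^ 2 = ‖G X‖ ^ 2 +
        ε * (2 * ((radialData ζ X).1 * ‖G X‖ ^ 2 +
          (radialData ζ X).2.2 * (u X * inner ℝ X (G X)))) +
        ε ^ 2 * ((radialData ζ X).1 ^ 2 * ‖G X‖ ^ 2 +
          2 * (radialData ζ X).1 * (radialData ζ X).2.2 * (u X * inner ℝ X (G X)) +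
          (radialData ζ X).2.2 ^ 2 * ‖X‖ ^ 2 * u X ^ 2) := by
      intro X
      have e : pullbackGradient β id u G X =
          (1 + ε * (radialData ζ X).1) • G X + (u X * (ε * (radialData ζ X).2.2)) • X := by
        rw [pullbackGradient, hgrad, smul_smul]
        rw [fderiv_id, ContinuousLinearMap.adjoint_id]
        rfl
      rw [e, ← real_inner_self_eq_norm_sq]
      simp only [inner_add_left, inner_add_right, inner_smul_left, inner_smul_right,
        RCLike.conj_to_real, real_inner_self_eq_norm_sq, real_inner_comm X (G X)]
      ring
    have hoR : ∀ (H : Space n → Space n), IntegrableOn (fun X => ‖H X‖ ^ 2) (ball 0 r) →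
        ∫⁻ X in ball (0 : Space n) r, ‖H X‖ₑ ^ 2 =
          ENNReal.ofReal (∫ X in ball (0 : Space n) r, ‖H X‖ ^ 2) := by
      intro H hH
      rw [ofReal_integral_eq_lintegral_ofReal hH (Eventually.of_forall fun X => sq_nonneg _)]
      refine lintegral_congr fun X => ?_
      rw [ENNReal.ofReal_pow (norm_nonneg _), ofReal_norm]
    have hi := (hw1.add ((i1.const_mul 2).const_mul ε)).add (i2.const_mul (ε ^ 2))
    rw [hoR G hw1, hoR _ (hi.congr (Eventually.of_forall fun X => (hpt X).symm)),
      ENNReal.ofReal_le_ofReal_iff (integral_nonneg fun _ => sq_nonneg _)] at hle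
    simp only [hpt] at hle
    have i11 : IntegrableOn (fun X : Space n => ε * (2 * ((radialData ζ X).1 * ‖G X‖ ^ 2 +
          (radialData ζ X).2.2 * (u X * inner ℝ X (G X))))) (ball 0 r) :=
      (i1.const_mul 2).const_mul ε
    have i12 : IntegrableOn (fun X : Space n => ‖G X‖ ^ 2 + ε * (2 * ((radialData ζ X).1 *
        ‖G X‖ ^ 2 + (radialData ζ X).2.2 * (u X * inner ℝ X (G X))))) (ball 0 r) := hw1.add i11
    rw [integral_add i12 (i2.const_mul (ε ^ 2)), integral_add hw1 i11,
      integral_const_mul, integral_const_mul, integral_const_mul] at hle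
    simpa using hle
  have hd : HasDerivAt (fun ε : ℝ => e0 + ε * (2 * e1) + ε ^ 2 * e2) (2 * e1) 0 := by
    have h1 := (((hasDerivAt_id (0 : ℝ)).mul_const (2 * e1)).const_add e0).add
      (((hasDerivAt_id (0 : ℝ)).pow 2).mul_const e2)
    refine HasDerivAt.congr_deriv h1 (by simp)
  have := hmin'.hasDerivAt_eq_zero hd
  linarith

end FirstVariation

/-! ### Profiles approximating the truncated power `y^{-d/2} - b^{-d}`. -/

section Cutoff

/-- Continuous functions increasing to the indicator of `(α, β)`. -/
def plateau (α β : ℝ) (k : ℕ) (y : ℝ) : ℝ := min 1 (k * max 0 (min (y - α) (β - y)))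

lemma continuous_plateau (α β : ℝ) (k : ℕ) : Continuous (plateau α β k) := by
  unfold plateau; fun_prop

lemma plateau_nonneg (α β : ℝ) (k : ℕ) (y : ℝ) : 0 ≤ plateau α β k y :=
  le_min zero_le_one (by positivity)

lemma plateau_le_one (α β : ℝ) (k : ℕ) (y : ℝ) : plateau α β k y ≤ 1 := min_le_left _ _

lemma plateau_eq_zero {α β y : ℝ} (k : ℕ) (h : y ≤ α ∨ β ≤ y) : plateau α β k y = 0 := by
  have : min (y - α) (β - y) ≤ 0 := by
    rcases h with h | h
    · exact (min_le_left _ _).trans (by linarith)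
    · exact (min_le_right _ _).trans (by linarith)
  simp [plateau, max_eq_left this]

lemma tendsto_plateau {α β y : ℝ} (h1 : α < y) (h2 : y < β) :
    Tendsto (fun k => plateau α β k y) atTop (𝓝 1) := by
  have hm : 0 < min (y - α) (β - y) := lt_min (by linarith) (by linarith)
  obtain ⟨N, hN⟩ := exists_nat_gt (1 / min (y - α) (β - y))
  refine tendsto_const_nhds.congr' ?_
  filter_upwards [eventually_ge_atTop N] with k hk
  have : 1 ≤ k * min (y - α) (β - y) := by
    rw [div_lt_iff₀ hm] at hN
    refine hN.le.trans ?_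
    gcongr
  rw [plateau, max_eq_right hm.le, min_eq_left this]

/-- The weight `(d/2) y^{-(d+2)/2}`, frozen below `y = a²`. -/
def weight (d : ℕ) (a y : ℝ) : ℝ := d / 2 * (√(max y (a ^ 2)) ^ (d + 2))⁻¹

lemma sqrt_max_pos {a : ℝ} (ha : 0 < a) (y : ℝ) : 0 < √(max y (a ^ 2)) :=
  Real.sqrt_pos.2 (lt_max_of_lt_right (by positivity))

lemma continuous_weight (d : ℕ) {a : ℝ} (ha : 0 < a) : Continuous (weight d a) := by
  have h1 : Continuous fun y : ℝ => √(max y (a ^ 2)) ^ (d + 2) := by fun_prop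
  exact continuous_const.mul (h1.inv₀ fun y => (pow_pos (sqrt_max_pos ha y) _).ne')

lemma weight_nonneg (d : ℕ) (a y : ℝ) : 0 ≤ weight d a y := by unfold weight; positivity

lemma weight_le (d : ℕ) {a : ℝ} (ha : 0 < a) (y : ℝ) : weight d a y ≤ d / 2 * (a ^ (d + 2))⁻¹ := by
  unfold weight
  gcongr
  exact Real.le_sqrt_of_sq_le (le_max_right _ _)

/-- Cut-off functions of class `C¹` which approximate the truncation of `y^{-d/2} - b^{-d}`
to `a² ≤ y ≤ b²`. -/
def cutoff (d : ℕ) (a b : ℝ) (k : ℕ) (y : ℝ) : ℝ :=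
  ∫ s in y..b ^ 2, weight d a s * plateau (a ^ 2) (b ^ 2) k s

variable {d : ℕ} {a b : ℝ}

lemma continuous_weight_mul_plateau (ha : 0 < a) (k : ℕ) :
    Continuous fun s => weight d a s * plateau (a ^ 2) (b ^ 2) k s :=
  (continuous_weight d ha).mul (continuous_plateau _ _ k)

lemma hasDerivAt_cutoff (ha : 0 < a) (k : ℕ) (y : ℝ) :
    HasDerivAt (cutoff d a b k) (-(weight d a y * plateau (a ^ 2) (b ^ 2) k y)) y :=
  have hc := continuous_weight_mul_plateau (d := d) (b := b) ha k
  intervalIntegral.integral_hasDerivAt_left (hc.intervalIntegrable _ _)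
    (hc.stronglyMeasurableAtFilter _ _) hc.continuousAt

lemma deriv_cutoff (ha : 0 < a) (k : ℕ) (y : ℝ) :
    deriv (cutoff d a b k) y = -(weight d a y * plateau (a ^ 2) (b ^ 2) k y) :=
  (hasDerivAt_cutoff ha k y).deriv

lemma contDiff_cutoff (ha : 0 < a) (k : ℕ) : ContDiff ℝ 1 (cutoff d a b k) := by
  refine contDiff_one_iff_deriv.2 ⟨fun y => (hasDerivAt_cutoff ha k y).differentiableAt, ?_⟩
  simp only [funext (deriv_cutoff (d := d) (b := b) ha k)]
  exact (continuous_weight_mul_plateau ha k).neg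

lemma cutoff_eq_zero (k : ℕ) {y : ℝ} (hy : b ^ 2 ≤ y) : cutoff d a b k y = 0 := by
  rw [cutoff, intervalIntegral.integral_symm, neg_eq_zero]
  refine intervalIntegral.integral_zero_ae (Eventually.of_forall fun s hs => ?_)
  rw [Set.uIoc_of_le hy] at hs
  rw [plateau_eq_zero k (Or.inr hs.1.le), mul_zero]

/-- The plateau vanishes below `a²`, so the cutoff is constant there, down to negative arguments. -/
lemma cutoff_max (ha : 0 < a) (k : ℕ) (y : ℝ) :
    cutoff d a b k (max y (a ^ 2)) = cutoff d a b k y := by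
  rcases le_total (a ^ 2) y with h | h
  · rw [max_eq_left h]
  rw [max_eq_right h, cutoff, cutoff, eq_comm]
  have hc := continuous_weight_mul_plateau (d := d) (b := b) ha k
  rw [← intervalIntegral.integral_add_adjacent_intervals (hc.intervalIntegrable y (a ^ 2))
    (hc.intervalIntegrable _ _), add_eq_right]
  refine intervalIntegral.integral_zero_ae (Eventually.of_forall fun s hs => ?_)
  rw [Set.uIoc_of_le h] at hs
  rw [plateau_eq_zero k (Or.inl hs.2), mul_zero]

lemma abs_weight_mul_plateau_le (ha : 0 < a) (k : ℕ) (y : ℝ) :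
    |weight d a y * plateau (a ^ 2) (b ^ 2) k y| ≤ d / 2 * (a ^ (d + 2))⁻¹ := by
  rw [abs_of_nonneg (mul_nonneg (weight_nonneg _ _ _) (plateau_nonneg _ _ _ _))]
  calc _ ≤ weight d a y * 1 := by
        gcongr
        · exact weight_nonneg _ _ _
        · exact plateau_le_one _ _ _ _
    _ ≤ _ := by rw [mul_one]; exact weight_le d ha y

lemma abs_cutoff_le (ha : 0 < a) (k : ℕ) {y : ℝ} (hy : 0 ≤ y) :
    |cutoff d a b k y| ≤ d / 2 * (a ^ (d + 2))⁻¹ * b ^ 2 := by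
  rcases le_total (b ^ 2) y with h | h
  · rw [cutoff_eq_zero k h, abs_zero]; positivity
  · refine (intervalIntegral.norm_integral_le_of_norm_le_const
      (f := fun s => weight d a s * plateau (a ^ 2) (b ^ 2) k s) fun s _ =>
      abs_weight_mul_plateau_le ha k s).trans ?_
    gcongr
    rw [abs_of_nonneg (by linarith)]
    linarith

lemma integral_weight (ha : 0 < a) {m : ℝ} (ham : a ^ 2 ≤ m) (hmb : m ≤ b ^ 2) (hb : 0 ≤ b) :
    ∫ s in m..b ^ 2, weight d a s = (√m ^ d)⁻¹ - (b ^ d)⁻¹ := by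
  have hder : ∀ s ∈ Set.uIcc m (b ^ 2), HasDerivAt (fun s => -(√s ^ d)⁻¹) (weight d a s) s := by
    intro s hs
    rw [Set.uIcc_of_le hmb] at hs
    have hs2 : a ^ 2 ≤ s := ham.trans hs.1
    have hs0 : 0 < s := lt_of_lt_of_le (by positivity) hs2
    have hq : 0 < √s := Real.sqrt_pos.2 hs0
    have h1 := (((Real.hasDerivAt_sqrt hs0.ne').pow d).inv (pow_pos hq d).ne').neg
    refine HasDerivAt.congr_deriv h1 ?_
    rw [weight, max_eq_left hs2]
    rcases d with _ | d
    · simp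
    · simp only [Nat.add_sub_cancel, Pi.pow_apply]
      field_simp
      ring
  rw [intervalIntegral.integral_eq_sub_of_hasDerivAt hder
    ((continuous_weight d ha).intervalIntegrable _ _), Real.sqrt_sq hb]
  ring

lemma tendsto_cutoff (ha : 0 < a) (hab : a < b) {y : ℝ} (hy : y < b ^ 2) :
    Tendsto (fun k => cutoff d a b k y) atTop
      (𝓝 ((√(max y (a ^ 2)) ^ d)⁻¹ - (b ^ d)⁻¹)) := by
  simp only [← cutoff_max (d := d) (b := b) ha _ y]
  have hm : max y (a ^ 2) ≤ b ^ 2 := max_le hy.le (by gcongr)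
  rw [← integral_weight ha (le_max_right _ _) hm (ha.trans hab).le]
  refine intervalIntegral.tendsto_integral_filter_of_dominated_convergence
    (fun _ => d / 2 * (a ^ (d + 2))⁻¹) ?_ ?_ ?_ ?_
  · exact Eventually.of_forall fun k => (continuous_weight_mul_plateau ha k).aestronglyMeasurable
  · exact Eventually.of_forall fun k => Eventually.of_forall fun s _ =>
      abs_weight_mul_plateau_le ha k s
  · exact intervalIntegrable_const
  · have hne : ∀ᵐ s : ℝ, s ≠ b ^ 2 := by simp [ae_iff]
    filter_upwards [hne] with s hs hsI
    rw [Set.uIoc_of_le hm] at hsI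
    simpa using (tendsto_plateau ((le_max_right _ _).trans_lt hsI.1)
      (lt_of_le_of_ne hsI.2 hs)).const_mul (weight d a s)

variable {E : Type*} [NormedAddCommGroup E]

/-- The open annulus `{a < |X| < b}`. -/
def annulus (E : Type*) [NormedAddCommGroup E] (a b : ℝ) : Set E := ball 0 b \ closedBall 0 a

lemma mem_annulus {X : E} : X ∈ annulus E a b ↔ a < ‖X‖ ∧ ‖X‖ < b := by
  simp [annulus, and_comm]

lemma measurableSet_annulus [MeasurableSpace E] [BorelSpace E] : MeasurableSet (annulus E a b) :=
  measurableSet_ball.diff measurableSet_closedBall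

/-- The operator `dζ + 2yζ'` annihilates `y^{-d/2}` and multiplies constants by `d`. In the annulus
only `-b^{-d}` survives, while inside radius `a` the profile is the constant `a^{-d} - b^{-d}`. -/
lemma tendsto_radialData_cutoff_dilation (ha : 0 < a) (hab : a < b) (X : E) :
    Tendsto (fun k => d * (radialData (cutoff d a b k) X).1 + (radialData (cutoff d a b k) X).2.1)
      atTop (𝓝 ((closedBall (0 : E) a).indicator (fun _ => d * (a ^ d)⁻¹) X -
        (ball (0 : E) b).indicator (fun _ => d * (b ^ d)⁻¹) X)) := by
  simp only [radialData, deriv_cutoff ha]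
  have hb : 0 < b := ha.trans hab
  have hX0 := norm_nonneg X
  rcases lt_or_ge ‖X‖ b with h2 | h2
  · have h2' : ‖X‖ ^ 2 < b ^ 2 := by gcongr
    have hlim := (tendsto_cutoff (d := d) ha hab h2').const_mul (d : ℝ)
    rw [Set.indicator_of_mem (s := ball (0 : E) b) (by simpa using h2)]
    rcases le_or_gt ‖X‖ a with h1 | h1
    · have h1' : ‖X‖ ^ 2 ≤ a ^ 2 := by gcongr
      rw [Set.indicator_of_mem (s := closedBall (0 : E) a) (by simpa using h1)]
      rw [max_eq_right h1', Real.sqrt_sq ha.le] at hlim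
      simpa [plateau_eq_zero _ (Or.inl h1'), mul_sub] using hlim
    · have h1' : a ^ 2 < ‖X‖ ^ 2 := by gcongr
      have hX : 0 < ‖X‖ := ha.trans h1
      rw [Set.indicator_of_notMem (s := closedBall (0 : E) a) (by simpa using h1)]
      have hp := ((((tendsto_plateau h1' h2').const_mul (weight d a (‖X‖ ^ 2))).neg.const_mul
        2).mul_const (‖X‖ ^ 2))
      have h3 := hlim.add hp
      refine h3.trans_eq ?_
      congr 1
      rw [weight, max_eq_left h1'.le, Real.sqrt_sq hX.le]
      field_simp
      ring
  · have h2' : b ^ 2 ≤ ‖X‖ ^ 2 := by gcongr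
    rw [Set.indicator_of_notMem (s := closedBall (0 : E) a) (by simpa using hab.trans_le h2),
      Set.indicator_of_notMem (s := ball (0 : E) b) (by simpa using h2)]
    simp [cutoff_eq_zero _ h2', plateau_eq_zero _ (Or.inr h2')]

lemma tendsto_radialData_cutoff_deriv (ha : 0 < a) (hab : a < b) (X : E) :
    Tendsto (fun k => (radialData (cutoff d a b k) X).2.2) atTop
      (𝓝 ((annulus E a b).indicator (fun X => -(d * (‖X‖ ^ (d + 2))⁻¹)) X)) := by
  simp only [radialData, deriv_cutoff ha]
  have hX0 := norm_nonneg X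
  rcases lt_or_ge ‖X‖ b with h2 | h2
  · rcases le_or_gt ‖X‖ a with h1 | h1
    · have h1' : ‖X‖ ^ 2 ≤ a ^ 2 := by gcongr
      rw [Set.indicator_of_notMem fun h => (mem_annulus.1 h).1.not_ge h1]
      simp [plateau_eq_zero _ (Or.inl h1')]
    · have h1' : a ^ 2 < ‖X‖ ^ 2 := by gcongr
      have h2' : ‖X‖ ^ 2 < b ^ 2 := by gcongr
      rw [Set.indicator_of_mem (mem_annulus.2 ⟨h1, h2⟩)]
      refine (((tendsto_plateau h1' h2').const_mul (weight d a (‖X‖ ^ 2))).neg.const_mul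
        2).trans_eq ?_
      congr 1
      rw [weight, max_eq_left h1'.le, Real.sqrt_sq hX0]
      ring
  · have hb : 0 < b := ha.trans hab
    have h2' : b ^ 2 ≤ ‖X‖ ^ 2 := by gcongr
    rw [Set.indicator_of_notMem fun h => (mem_annulus.1 h).2.not_ge h2]
    simp [plateau_eq_zero _ (Or.inr h2')]

end Cutoff

/-! ### Exact growth of the scaled energy. -/

section EnergyGrowth

lemma tendsto_integral_mul_of_bounded {α : Type*} [MeasurableSpace α] {μ : Measure α}
    {p : ℕ → α → ℝ} {P w : α → ℝ} {C : ℝ} (hp : ∀ k, AEStronglyMeasurable (p k) μ)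
    (hC : ∀ k x, |p k x| ≤ C) (hlim : ∀ x, Tendsto (fun k => p k x) atTop (𝓝 (P x)))
    (hw : Integrable w μ) :
    Tendsto (fun k => ∫ x, p k x * w x ∂μ) atTop (𝓝 (∫ x, P x * w x ∂μ)) := by
  refine tendsto_integral_of_dominated_convergence (fun x => C * |w x|)
    (fun k => (hp k).mul hw.1) (hw.abs.const_mul C) (fun k => Eventually.of_forall fun x => ?_)
    (Eventually.of_forall fun x => (hlim x).mul_const _)
  rw [norm_mul, Real.norm_eq_abs, Real.norm_eq_abs]
  gcongr
  exact hC k x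

variable {d : ℕ} {a b : ℝ} {E : Type*} [NormedAddCommGroup E]

lemma abs_radialData_cutoff_deriv_le (ha : 0 < a) (k : ℕ) (X : E) :
    |(radialData (cutoff d a b k) X).2.2| ≤ 2 * (d / 2 * (a ^ (d + 2))⁻¹) := by
  simp only [radialData, deriv_cutoff ha]
  rw [abs_mul, abs_neg, abs_two]
  gcongr
  exact abs_weight_mul_plateau_le ha k _

lemma abs_radialData_cutoff_dilation_le (ha : 0 < a) (k : ℕ) (X : E) :
    |d * (radialData (cutoff d a b k) X).1 + (radialData (cutoff d a b k) X).2.1| ≤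
      d * (d / 2 * (a ^ (d + 2))⁻¹ * b ^ 2) + 2 * (d / 2 * (a ^ (d + 2))⁻¹) * b ^ 2 := by
  refine (abs_add_le _ _).trans (add_le_add ?_ ?_)
  · rw [abs_mul, Nat.abs_cast]
    gcongr
    exact abs_cutoff_le ha k (sq_nonneg _)
  · rcases le_total (‖X‖ ^ 2) (b ^ 2) with h | h
    · change |2 * deriv _ _ * ‖X‖ ^ 2| ≤ _
      rw [abs_mul, abs_of_nonneg (sq_nonneg ‖X‖)]
      gcongr
      exact abs_radialData_cutoff_deriv_le ha k X
    · rw [radialData_eq_zero (contDiff_cutoff ha k) (fun y hy => cutoff_eq_zero k hy) h]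
      simp only [Prod.snd_zero, Prod.fst_zero, abs_zero]
      positivity

variable {n : ℕ}

lemma toReal_energy {u : Space n → ℝ} {G : Space n → Space n} {r : ℝ}
    (h : HasWeakGradientOn u G (ball 0 r))
    (hG : MemLp G 2 (volume.restrict (ball 0 r))) :
    (energy u (ball 0 r)).toReal =
      (∫ X in ball (0 : Space n) r, ‖G X‖ ^ 2) + volume.real (traceSet u r) := by
  have h1 : IntegrableOn (fun X => ‖G X‖ ^ 2) (ball 0 r) := hG.integrable_norm_pow (by simp)
  have h2 : ∫⁻ X in ball (0 : Space n) r, ‖G X‖ₑ ^ 2 =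
      ENNReal.ofReal (∫ X in ball (0 : Space n) r, ‖G X‖ ^ 2) := by
    rw [ofReal_integral_eq_lintegral_ofReal h1 (Eventually.of_forall fun X => sq_nonneg _)]
    refine lintegral_congr fun X => ?_
    rw [ENNReal.ofReal_pow (norm_nonneg _), ofReal_norm]
  rw [energy, measure_thinPositivitySet, dirichletEnergy_eq h isOpen_ball, h2,
    ENNReal.toReal_add ENNReal.ofReal_ne_top (measure_traceSet_lt_top u r).ne,
    ENNReal.toReal_ofReal (integral_nonneg fun _ => sq_nonneg _), measureReal_def]

/-- The growth of the energy of a minimizer on balls. -/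
theorem IsMinimizer.energy_sub_energy {u : Space n → ℝ} {G : Space n → Space n} {R : ℝ}
    (hn : 1 ≤ n) (hmin : IsMinimizer u (ball 0 R)) (h : HasWeakGradientOn u G (ball 0 R))
    (hu2 : ∀ K ⊆ ball (0 : Space n) R, IsCompact K → MemLp u 2 (volume.restrict K))
    (hL2 : ∀ K ⊆ ball (0 : Space n) R, IsCompact K → MemLp G 2 (volume.restrict K))
    (ha : 0 < a) (hab : a < b) (hbR : b < R) :
    (b ^ n)⁻¹ * (energy u (ball 0 b)).toReal - (a ^ n)⁻¹ * (energy u (ball 0 a)).toReal =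
      ∫ X in annulus (Space n) a b,
        (‖X‖ ^ (n + 2))⁻¹ * (2 * inner ℝ X (G X) ^ 2 - u X * inner ℝ X (G X)) := by
  obtain ⟨r, hbr, hrR⟩ := exists_between hbR
  have hb : 0 < b := ha.trans hab
  have hsub : ∀ s < R, volume.restrict (ball (0 : Space n) s) ≤ volume.restrict (closedBall 0 s) :=
    fun s _ => Measure.restrict_mono ball_subset_closedBall le_rfl
  have hGs : ∀ s < R, MemLp G 2 (volume.restrict (ball 0 s)) := fun s hs =>
    (hL2 _ (closedBall_subset_ball hs) (isCompact_closedBall _ _)).mono_measure (hsub s hs)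
  have hur : MemLp u 2 (volume.restrict (ball 0 r)) :=
    (hu2 _ (closedBall_subset_ball hrR) (isCompact_closedBall _ _)).mono_measure (hsub r hrR)
  have hw1 : IntegrableOn (fun X => ‖G X‖ ^ 2) (ball 0 r) :=
    (hGs r hrR).integrable_norm_pow (by simp)
  have hw2 := integrableOn_inner_sq (hGs r hrR)
  have hw3 := integrableOn_mul_inner hur (hGs r hrR)
  have hw4 : IntegrableOn (fun X => u X * inner ℝ X (G X) - 2 * inner ℝ X (G X) ^ 2) (ball 0 r) :=
    hw3.sub (hw2.const_mul 2)
  have hwT : IntegrableOn (fun _ : EuclideanSpace ℝ (Fin n) => (1 : ℝ)) (traceSet u r) :=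
    integrableOn_const (measure_traceSet_lt_top u r).ne
  have hζ : ∀ k, ContDiff ℝ 1 (cutoff n a b k) := contDiff_cutoff ha
  have hζb : ∀ k y, b ^ 2 ≤ y → cutoff n a b k y = 0 := fun k y => cutoff_eq_zero k
  have hcd : ∀ k, Continuous (radialData (cutoff n a b k) : Space n → _) := fun k =>
    continuous_radialData (hζ k)
  have hcd' : ∀ k, Continuous (radialData (cutoff n a b k) : EuclideanSpace ℝ (Fin n) → _) :=
    fun k => continuous_radialData (hζ k)
  have hbd : ∀ {w : Space n → ℝ}, IntegrableOn w (ball 0 r) → ∀ g : Space n → ℝ, Continuous g →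
      IntegrableOn (fun X => g X * w X) (ball 0 r) := by
    intro w hw g hg
    obtain ⟨C, hC⟩ := (isCompact_closedBall (0 : Space n) r).exists_bound_of_continuousOn
      hg.continuousOn
    refine Integrable.bdd_mul (c := C) hw hg.aestronglyMeasurable ?_
    exact (ae_restrict_iff' measurableSet_ball).2
      (Eventually.of_forall fun X hX => hC X (ball_subset_closedBall hX))
  have hk : ∀ k, (∫ X in ball (0 : Space n) r, (n * (radialData (cutoff n a b k) X).1 +
        (radialData (cutoff n a b k) X).2.1) * ‖G X‖ ^ 2) +
      (∫ X in ball (0 : Space n) r, (radialData (cutoff n a b k) X).2.2 *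
        (u X * inner ℝ X (G X) - 2 * inner ℝ X (G X) ^ 2)) +
      (∫ x in traceSet u r, (n * (radialData (cutoff n a b k) x).1 +
        (radialData (cutoff n a b k) x).2.1) * 1) = 0 := by
    intro k
    -- The inner variation has `(n - 1)ζ` in front of `|G|²`. Adding the outer one supplies the
    -- missing `ζ|G|²`, so the bulk and thin terms acquire the same factor.
    have e1 := hmin.integral_radialData_inner h hL2 hb.le hbr hrR (hζ k) (hζb k)
    have e2 := hmin.integral_radialData_outer h hu2 hL2 hb.le hbr hrR (hζ k) (hζb k)
    have := hcd k
    rw [integral_add (hbd hw1 _ (by fun_prop)) (hbd hw3 _ (by fun_prop))] at e2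
    have e3 : ∫ X in ball (0 : Space n) r, (n * (radialData (cutoff n a b k) X).1 +
        (radialData (cutoff n a b k) X).2.1) * ‖G X‖ ^ 2 =
        (∫ X in ball (0 : Space n) r, ((n - 1) * (radialData (cutoff n a b k) X).1 +
        (radialData (cutoff n a b k) X).2.1) * ‖G X‖ ^ 2) +
        ∫ X in ball (0 : Space n) r, (radialData (cutoff n a b k) X).1 * ‖G X‖ ^ 2 := by
      rw [← integral_add (hbd hw1 _ (by fun_prop)) (hbd hw1 _ (by fun_prop))]
      congr 1 with X
      ring
    have e4 : ∫ X in ball (0 : Space n) r, (radialData (cutoff n a b k) X).2.2 *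
        (u X * inner ℝ X (G X) - 2 * inner ℝ X (G X) ^ 2) =
        (∫ X in ball (0 : Space n) r, (radialData (cutoff n a b k) X).2.2 *
          (u X * inner ℝ X (G X))) -
        ∫ X in ball (0 : Space n) r, 2 * (radialData (cutoff n a b k) X).2.2 *
          inner ℝ X (G X) ^ 2 := by
      rw [← integral_sub (hbd hw3 _ (by fun_prop)) (hbd hw2 _ (by fun_prop))]
      congr 1 with X
      ring
    simp only [mul_one]
    rw [e3, e4]
    linarith
  have l1 := tendsto_integral_mul_of_bounded (μ := volume.restrict (ball (0 : Space n) r))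
    (fun k => by have := hcd k; exact (show Continuous fun X : Space n =>
      n * (radialData (cutoff n a b k) X).1 + (radialData (cutoff n a b k) X).2.1 by
        fun_prop).aestronglyMeasurable)
    (abs_radialData_cutoff_dilation_le ha) (tendsto_radialData_cutoff_dilation ha hab) hw1
  have l2 := tendsto_integral_mul_of_bounded (μ := volume.restrict (ball (0 : Space n) r))
    (fun k => by have := hcd k; exact (show Continuous fun X : Space n =>
      (radialData (cutoff n a b k) X).2.2 by fun_prop).aestronglyMeasurable)
    (abs_radialData_cutoff_deriv_le ha) (tendsto_radialData_cutoff_deriv ha hab) hw4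
  have l3 := tendsto_integral_mul_of_bounded (μ := volume.restrict (traceSet u r))
    (fun k => by have := hcd' k; exact (show Continuous fun X : EuclideanSpace ℝ (Fin n) =>
      n * (radialData (cutoff n a b k) X).1 + (radialData (cutoff n a b k) X).2.1 by
        fun_prop).aestronglyMeasurable)
    (abs_radialData_cutoff_dilation_le ha) (tendsto_radialData_cutoff_dilation ha hab) hwT
  have l := (l1.add l2).add l3
  simp only [hk] at l
  have key := tendsto_nhds_unique tendsto_const_nhds l
  have split : ∀ {F : Type} [NormedAddCommGroup F] [MeasurableSpace F] [BorelSpace F]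
      {μ : Measure F} {w : F → ℝ}, Integrable w μ →
      ∫ X, ((closedBall (0 : F) a).indicator (fun _ => n * (a ^ n)⁻¹) X -
        (ball (0 : F) b).indicator (fun _ => n * (b ^ n)⁻¹) X) * w X ∂μ =
      n * ((a ^ n)⁻¹ * ∫ X in closedBall 0 a, w X ∂μ) - n * ((b ^ n)⁻¹ * ∫ X in ball 0 b, w X ∂μ) := by
    intro F _ _ _ μ w hw
    have e : ∀ X, ((closedBall (0 : F) a).indicator (fun _ => n * (a ^ n)⁻¹) X -
        (ball (0 : F) b).indicator (fun _ => n * (b ^ n)⁻¹) X) * w X =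
        (closedBall (0 : F) a).indicator (fun X => n * (a ^ n)⁻¹ * w X) X -
        (ball (0 : F) b).indicator (fun X => n * (b ^ n)⁻¹ * w X) X := by
      intro X
      classical
      simp only [Set.indicator_apply]
      split_ifs <;> ring
    simp only [e]
    rw [integral_sub ((hw.const_mul _).indicator measurableSet_closedBall)
      ((hw.const_mul _).indicator measurableSet_ball), integral_indicator measurableSet_closedBall,
      integral_indicator measurableSet_ball, integral_const_mul, integral_const_mul]
    ring
  have hball : ∀ (s : ℝ), s ≤ r → (volume.restrict (ball (0 : Space n) r)).restrict (ball 0 s) =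
      volume.restrict (ball 0 s) := fun s hs => by
    rw [Measure.restrict_restrict measurableSet_ball, Set.inter_eq_left.2 (ball_subset_ball hs)]
  have hT : ∀ (s : ℝ), s ≤ r → (volume.restrict (traceSet u r)).restrict (ball 0 s) =
      volume.restrict (traceSet u s) := fun s hs => by
    rw [Measure.restrict_restrict measurableSet_ball]
    congr 1
    ext x
    simp only [traceSet, Set.mem_inter_iff, mem_ball_zero_iff, Set.mem_ofPred_eq]
    constructor
    · rintro ⟨h1, -, h2⟩; exact ⟨h1, h2⟩
    · rintro ⟨h1, h2⟩; exact ⟨h1, h1.trans_le hs, h2⟩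
  have hcl : (closedBall (0 : Space n) a : Set (Space n)) =ᵐ[volume.restrict (ball 0 r)] ball 0 a :=
    ae_restrict_of_ae (ball_ae_eq_closedBall 0 ha.ne')
  have hcl' : (closedBall (0 : EuclideanSpace ℝ (Fin n)) a : Set _)
      =ᵐ[volume.restrict (traceSet u r)] ball 0 a := by
    refine ae_restrict_of_ae ?_
    rw [← ball_union_sphere]
    exact union_ae_eq_left_of_ae_eq_empty
      (ae_eq_empty.2 (Measure.addHaar_sphere_of_ne_zero _ _ ha.ne'))
  rw [split hw1, split hwT, Measure.restrict_congr_set hcl, Measure.restrict_congr_set hcl',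
    hball a (hab.trans hbr).le, hball b hbr.le, hT a (hab.trans hbr).le, hT b hbr.le] at key
  have hann : ∫ X in ball (0 : Space n) r, (annulus (Space n) a b).indicator
      (fun X => -(n * (‖X‖ ^ (n + 2))⁻¹)) X * (u X * inner ℝ X (G X) - 2 * inner ℝ X (G X) ^ 2) =
      (n : ℝ) * ∫ X in annulus (Space n) a b,
        (‖X‖ ^ (n + 2))⁻¹ * (2 * inner ℝ X (G X) ^ 2 - u X * inner ℝ X (G X)) := by
    have e : ∀ X, (annulus (Space n) a b).indicator (fun X => -(n * (‖X‖ ^ (n + 2))⁻¹)) X *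
        (u X * inner ℝ X (G X) - 2 * inner ℝ X (G X) ^ 2) =
        (annulus (Space n) a b).indicator (fun X => (n : ℝ) * ((‖X‖ ^ (n + 2))⁻¹ *
          (2 * inner ℝ X (G X) ^ 2 - u X * inner ℝ X (G X)))) X := by
      intro X
      classical
      simp only [Set.indicator_apply]
      split_ifs <;> ring
    simp only [e]
    rw [integral_indicator measurableSet_annulus, Measure.restrict_restrict measurableSet_annulus,
      Set.inter_eq_left.2 (fun X hX => mem_ball_zero_iff.2 ((mem_annulus.1 hX).2.trans hbr)),
      integral_const_mul]
  rw [hann] at key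
  have hmonoB : ∀ s < R, HasWeakGradientOn u G (ball 0 s) := fun s hs =>
    h.mono isOpen_ball (ball_subset_ball hs.le)
  rw [toReal_energy (hmonoB b hbR) (hGs b hbR),
    toReal_energy (hmonoB a (hab.trans hbR)) (hGs a (hab.trans hbR))]
  simp only [setIntegral_const, smul_eq_mul, mul_one] at key
  -- Every term of the limiting identity carries the factor `n`; it can be divided out because `n ≥
  -- 1`.
  have hn0 : (n : ℝ) ≠ 0 := by positivity
  refine mul_left_cancel₀ hn0 ?_
  linarith

end EnergyGrowth

/-! ### One-dimensional identities for absolutely continuous functions. -/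

section Primitives

variable {g : ℝ → ℝ} {a b : ℝ}

lemma absolutelyContinuousOnInterval_primitive (hg : IntervalIntegrable g volume a b) (c : ℝ) :
    AbsolutelyContinuousOnInterval (fun s => c + ∫ t in a..s, g t) a b := by
  have h1 : AbsolutelyContinuousOnInterval (fun _ : ℝ => c) a b :=
    ((LipschitzWith.const c).lipschitzOnWith (s := Set.uIcc a b)).absolutelyContinuousOnInterval
  exact h1.add (hg.absolutelyContinuousOnInterval_intervalIntegral Set.left_mem_uIcc)

lemma ae_hasDerivAt_primitive (hg : IntervalIntegrable g volume a b) (c : ℝ) :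
    ∀ᵐ s, s ∈ Set.uIcc a b → HasDerivAt (fun s => c + ∫ t in a..s, g t) (g s) s := by
  filter_upwards [hg.ae_hasDerivAt_integral] with s hs hsI
  exact (hs hsI a Set.left_mem_uIcc).const_add c

/-- The integrand is the a.e. derivative of `F²/s`, which is absolutely continuous away from zero.
`F` is replaced by its primitive `P` because the hypotheses describe it on `[a, b]` only. -/
lemma integral_deriv_sq_div (ha : 0 < a) (hab : a ≤ b) (hg : IntervalIntegrable g volume a b)
    {F : ℝ → ℝ} (hF : ∀ s ∈ Set.Icc a b, F s = F a + ∫ t in a..s, g t) :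
    ∫ s in a..b, (2 * F s * g s / s - F s ^ 2 / s ^ 2) = F b ^ 2 / b - F a ^ 2 / a := by
  set P : ℝ → ℝ := fun s => F a + ∫ t in a..s, g t with hP
  have hPac : AbsolutelyContinuousOnInterval P a b :=
    absolutelyContinuousOnInterval_primitive hg (F a)
  have hinv : AbsolutelyContinuousOnInterval (fun s : ℝ => s⁻¹) a b := by
    refine ContDiffOn.absolutelyContinuousOnInterval fun s hs => ?_
    rw [Set.uIcc_of_le hab] at hs
    exact (contDiffAt_inv ℝ (ha.trans_le hs.1).ne').contDiffWithinAt
  have key := ((hPac.mul hPac).mul hinv).integral_deriv_eq_sub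
  have hFP : ∀ s ∈ Set.Icc a b, F s = P s := hF
  rw [hFP a ⟨le_rfl, hab⟩, hFP b ⟨hab, le_rfl⟩]
  simp only [Pi.mul_apply] at key
  rw [div_eq_mul_inv, div_eq_mul_inv, sq, sq, ← key]
  refine intervalIntegral.integral_congr_ae ?_
  filter_upwards [ae_hasDerivAt_primitive hg (F a)] with s hs hsI
  have hsI' : s ∈ Set.uIcc a b := Set.uIoc_subset_uIcc hsI
  have hs1 : HasDerivAt P (g s) s := hs hsI'
  rw [Set.uIcc_of_le hab] at hsI'
  have hs0 : s ≠ 0 := (ha.trans_le hsI'.1).ne'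
  rw [hFP s hsI', ((hs1.mul hs1).mul (hasDerivAt_inv hs0)).deriv]
  simp only [Pi.mul_apply]
  field_simp
  ring

/-- The relation `2sF' = F` says that `F/√s` has zero derivative a.e.; absolute continuity makes it
constant. -/
lemma div_sqrt_eq_of_ae (ha : 0 < a) (hab : a ≤ b) (hg : IntervalIntegrable g volume a b)
    {F : ℝ → ℝ} (hF : ∀ s ∈ Set.Icc a b, F s = F a + ∫ t in a..s, g t)
    (hode : ∀ᵐ s, s ∈ Set.Ioc a b → 2 * s * g s = F s) : F b / √b = F a / √a := by
  set P : ℝ → ℝ := fun s => F a + ∫ t in a..s, g t with hP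
  have hPac : AbsolutelyContinuousOnInterval P a b :=
    absolutelyContinuousOnInterval_primitive hg (F a)
  have hinv : AbsolutelyContinuousOnInterval (fun s : ℝ => (√s)⁻¹) a b := by
    refine ContDiffOn.absolutelyContinuousOnInterval fun s hs => ?_
    rw [Set.uIcc_of_le hab] at hs
    have hs0 := ha.trans_le hs.1
    exact ((Real.contDiffAt_sqrt hs0.ne').inv (Real.sqrt_pos.2 hs0).ne').contDiffWithinAt
  have key := (hPac.mul hinv).integral_deriv_eq_sub
  have hFP : ∀ s ∈ Set.Icc a b, F s = P s := hF
  simp only [Pi.mul_apply] at key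
  rw [hFP a ⟨le_rfl, hab⟩, hFP b ⟨hab, le_rfl⟩, ← sub_eq_zero, div_eq_mul_inv, div_eq_mul_inv, ← key]
  refine intervalIntegral.integral_zero_ae ?_
  filter_upwards [ae_hasDerivAt_primitive hg (F a), hode] with s hs hs2 hsI
  have hsI' : s ∈ Set.uIcc a b := Set.uIoc_subset_uIcc hsI
  have hs1 : HasDerivAt P (g s) s := hs hsI'
  rw [Set.uIcc_of_le hab] at hsI'
  rw [Set.uIoc_of_le hab] at hsI
  have hs0 : 0 < s := ha.trans_le hsI'.1
  have hq : 0 < √s := Real.sqrt_pos.2 hs0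
  have hq2 : √s ^ 2 = s := Real.sq_sqrt hs0.le
  have hd : deriv (P * fun s => (√s)⁻¹) s = _ :=
    (hs1.mul ((Real.hasDerivAt_sqrt hs0.ne').inv hq.ne')).deriv
  rw [hd, ← hFP s hsI', ← hs2 hsI, hq2]
  simp only [Pi.inv_apply]
  field_simp
  ring

lemma ae_two_mul_eq_of_sqrt (ha : 0 < a) (hab : a ≤ b) (hg : IntervalIntegrable g volume a b)
    {F : ℝ → ℝ} (hF : ∀ s ∈ Set.Icc a b, F s = F a + ∫ t in a..s, g t) {c : ℝ}
    (hc : ∀ s ∈ Set.Icc a b, F s = √s * c) : ∀ᵐ s, s ∈ Set.Ioo a b → 2 * s * g s = F s := by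
  filter_upwards [ae_hasDerivAt_primitive hg (F a)] with s hs hsI
  have hs0 : 0 < s := ha.trans hsI.1
  have h1 := hs (by rw [Set.uIcc_of_le hab]; exact Set.Ioo_subset_Icc_self hsI)
  have h2 : HasDerivAt (fun s => F a + ∫ t in a..s, g t) (1 / (2 * √s) * c) s := by
    refine ((Real.hasDerivAt_sqrt hs0.ne').mul_const c).congr_of_eventuallyEq ?_
    filter_upwards [Icc_mem_nhds hsI.1 hsI.2] with t ht
    rw [← hF t ht, hc t ht]
  rw [h1.unique h2, hc s (Set.Ioo_subset_Icc_self hsI)]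
  have hq : 0 < √s := Real.sqrt_pos.2 hs0
  have hq2 : √s * √s = s := Real.mul_self_sqrt hs0.le
  field_simp
  rw [sq, hq2]

end Primitives

/-! ### Polar integration in annuli. -/

section PolarIntegral

variable {n : ℕ}

lemma integrable_radialMeasure_iff {f : ℝ → ℝ} :
    Integrable f (radialMeasure n) ↔ IntegrableOn (fun s => s ^ n * f s) (Set.Ioi 0) := by
  rw [radialMeasure, integrable_withDensity_iff_integrable_smul₀' (by fun_prop)
    (Eventually.of_forall fun _ => ENNReal.ofReal_lt_top)]
  refine integrable_congr ?_
  filter_upwards [self_mem_ae_restrict measurableSet_Ioi] with s hs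
  have : (0 : ℝ) ≤ s := (Set.mem_Ioi.1 hs).le
  rw [ENNReal.toReal_ofReal (by positivity), smul_eq_mul]

lemma integral_radialMeasure (f : ℝ → ℝ) :
    ∫ s, f s ∂radialMeasure n = ∫ s in Set.Ioi 0, s ^ n * f s := by
  rw [radialMeasure, integral_withDensity_eq_integral_toReal_smul₀ (by fun_prop)
    (Eventually.of_forall fun _ => ENNReal.ofReal_lt_top)]
  refine integral_congr_ae ?_
  filter_upwards [self_mem_ae_restrict measurableSet_Ioi] with s hs
  have : (0 : ℝ) ≤ s := (Set.mem_Ioi.1 hs).le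
  rw [ENNReal.toReal_ofReal (by positivity), smul_eq_mul]

lemma integrable_polar {f : Space n → ℝ} (hf : Integrable f) :
    Integrable (fun p : sphere (0 : Space n) 1 × ℝ => f (p.2 • (p.1 : Space n)))
      ((sphereMeasure n).prod (radialMeasure n)) :=
  measurePreserving_polar.integrable_comp_of_integrable hf

lemma integral_polar {f : Space n → ℝ} (hf : Integrable f) :
    ∫ X, f X = ∫ θ : sphere (0 : Space n) 1, (∫ s in Set.Ioi (0 : ℝ),
      s ^ n * f (s • (θ : Space n))) ∂sphereMeasure n := by
  rw [← measurePreserving_polar.map_eq, integral_map (by fun_prop)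
    (by rw [measurePreserving_polar.map_eq]; exact hf.1), integral_prod _ (integrable_polar hf)]
  simp only [integral_radialMeasure]

lemma integrable_integral_ray {f : Space n → ℝ} (hf : Integrable f) :
    Integrable (fun θ : sphere (0 : Space n) 1 => ∫ s in Set.Ioi (0 : ℝ),
      s ^ n * f (s • (θ : Space n))) (sphereMeasure n) := by
  have := (integrable_polar hf).integral_prod_left
  simpa only [integral_radialMeasure] using this

lemma ae_integrableOn_ray {f : Space n → ℝ} (hf : Integrable f) :
    ∀ᵐ θ : sphere (0 : Space n) 1 ∂sphereMeasure n,
      IntegrableOn (fun s : ℝ => s ^ n * f (s • (θ : Space n))) (Set.Ioi 0) := by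
  filter_upwards [(integrable_polar hf).prod_right_ae] with θ hθ
  exact integrable_radialMeasure_iff.1 hθ

variable {a b : ℝ} {f : Space n → ℝ}

lemma setIntegral_ray_indicator (ha : 0 ≤ a) (θ : sphere (0 : Space n) 1) (w : ℝ → ℝ) :
    ∫ s in Set.Ioi (0 : ℝ), w s * (annulus (Space n) a b).indicator f (s • (θ : Space n)) =
      ∫ s in Set.Ioo a b, w s * f (s • (θ : Space n)) := by
  rw [← integral_indicator measurableSet_Ioi, ← integral_indicator measurableSet_Ioo]
  congr 1 with s
  classical
  simp only [Set.indicator_apply, mem_annulus, Set.mem_Ioi, Set.mem_Ioo]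
  by_cases hs : 0 < s
  · rw [if_pos hs, norm_ray hs.le]
    split_ifs <;> simp
  · rw [if_neg hs, if_neg fun h => hs (ha.trans_lt h.1)]

/-- Polar coordinates in an annulus. -/
lemma setIntegral_annulus (ha : 0 ≤ a) (hab : a ≤ b) (hf : IntegrableOn f (annulus (Space n) a b)) :
    ∫ X in annulus (Space n) a b, f X = ∫ θ : sphere (0 : Space n) 1,
      (∫ s in a..b, s ^ n * f (s • (θ : Space n))) ∂sphereMeasure n := by
  rw [← integral_indicator measurableSet_annulus,
    integral_polar (hf.integrable_indicator measurableSet_annulus)]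
  simp only [setIntegral_ray_indicator ha, intervalIntegral.integral_of_le hab,
    integral_Ioc_eq_integral_Ioo]

lemma integrable_integral_annulus_ray (ha : 0 ≤ a) (hab : a ≤ b)
    (hf : IntegrableOn f (annulus (Space n) a b)) :
    Integrable (fun θ : sphere (0 : Space n) 1 => ∫ s in a..b, s ^ n * f (s • (θ : Space n)))
      (sphereMeasure n) := by
  have := integrable_integral_ray (hf.integrable_indicator measurableSet_annulus)
  simpa only [setIntegral_ray_indicator ha, intervalIntegral.integral_of_le hab,
    integral_Ioc_eq_integral_Ioo] using this

lemma ae_intervalIntegrable_ray (ha : 0 ≤ a) (hab : a ≤ b)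
    (hf : IntegrableOn f (annulus (Space n) a b)) :
    ∀ᵐ θ : sphere (0 : Space n) 1 ∂sphereMeasure n,
      IntervalIntegrable (fun s : ℝ => s ^ n * f (s • (θ : Space n))) volume a b := by
  filter_upwards [ae_integrableOn_ray (hf.integrable_indicator measurableSet_annulus)] with θ hθ
  rw [intervalIntegrable_iff_integrableOn_Ioo_of_le hab]
  refine (hθ.mono_set fun s hs => ha.trans_lt hs.1).congr_fun (fun s hs => ?_) measurableSet_Ioo
  have hs0 : 0 < s := ha.trans_lt hs.1
  simp only
  rw [Set.indicator_of_mem (mem_annulus.2 (by rwa [norm_ray hs0.le]))]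

end PolarIntegral

/-! ### Radial traces up to the boundary sphere. -/

section Spheres

variable {n : ℕ} {u : Space n → ℝ} {G : Space n → Space n} {R r : ℝ}

lemma closedBallRep_of_lt {X : Space n} (h : ‖X‖ < R) : closedBallRep R u X = preciseRep u X :=
  if_pos h

lemma closedBallRep_of_tendsto {X : Space n} (h : ‖X‖ = R) {l : ℝ}
    (hl : Tendsto (fun s : ℝ => preciseRep u (s • X)) (𝓝[<] 1) (𝓝 l)) :
    closedBallRep R u X = l := by
  have hex : ∃ l : ℝ, Tendsto (fun s : ℝ => preciseRep u (s • X)) (𝓝[<] 1) (𝓝 l) := ⟨l, hl⟩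
  rw [closedBallRep, if_neg (by simp [h]), dif_pos hex]
  exact tendsto_nhds_unique hex.choose_spec hl

/-- The radial derivative along a ray. -/
def rayDeriv (G : Space n → Space n) (θ : sphere (0 : Space n) 1) (s : ℝ) : ℝ :=
  inner ℝ (G (s • (θ : Space n))) (θ : Space n)

/-- The values of `u` along a ray. -/
def rayValue (R : ℝ) (u : Space n → ℝ) (θ : sphere (0 : Space n) 1) (s : ℝ) : ℝ :=
  closedBallRep R u (s • (θ : Space n))

lemma rayValue_of_lt {θ : sphere (0 : Space n) 1} {s : ℝ} (hs : 0 ≤ s) (hsR : s < R) :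
    rayValue R u θ s = preciseRep u (s • (θ : Space n)) :=
  closedBallRep_of_lt (by rwa [norm_ray hs])

lemma abs_rayDeriv_le (θ : sphere (0 : Space n) 1) (s : ℝ) :
    |rayDeriv G θ s| ≤ ‖G (s • (θ : Space n))‖ := by
  refine (abs_real_inner_le_norm _ _).trans ?_
  simp

lemma sq_rayDeriv_le (θ : sphere (0 : Space n) 1) (s : ℝ) :
    rayDeriv G θ s ^ 2 ≤ ‖G (s • (θ : Space n))‖ ^ 2 := by
  rw [← sq_abs]
  have := abs_rayDeriv_le (G := G) θ s
  gcongr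

/-- The fundamental theorem of calculus along a ray, up to the radius `r`. -/
def IsPrimitiveRay (R : ℝ) (u : Space n → ℝ) (G : Space n → Space n) (r : ℝ)
    (θ : sphere (0 : Space n) 1) : Prop :=
  ∀ a c, 0 < a → a ≤ c → c ≤ r → IntervalIntegrable (rayDeriv G θ) volume a c ∧
    rayValue R u θ c = rayValue R u θ a + ∫ s in a..c, rayDeriv G θ s

/-- Only `c = R` is new. Integrability of the radial derivative up to `R` makes the primitive
continuous there, so the radial limit defining the boundary value exists and equals the primitive.
-/
lemma IsRegularRay.isPrimitiveRay {θ : sphere (0 : Space n) 1} (h : IsRegularRay u G R θ)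
    (hr : 0 < r) (hrR : r ≤ R) (hi : IntervalIntegrable (rayDeriv G θ) volume (r / 2) r) :
    IsPrimitiveRay R u G r θ := by
  have hlt : ∀ a c, 0 < a → a ≤ c → c < R → IntervalIntegrable (rayDeriv G θ) volume a c ∧
      rayValue R u θ c = rayValue R u θ a + ∫ s in a..c, rayDeriv G θ s := by
    intro a c ha hac hc
    constructor
    · rw [intervalIntegrable_iff_integrableOn_Icc_of_le hac]
      exact (h.integrableOn a c ha hac hc).inner_const _
    · rw [rayValue_of_lt ha.le (hac.trans_lt hc), rayValue_of_lt (ha.le.trans hac) hc,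
        ← sub_eq_iff_eq_add']
      exact h.sub_eq a c ha hac hc
  intro a c ha hac hcr
  rcases lt_or_ge c R with hc | hc
  · exact hlt a c ha hac hc
  obtain rfl : c = R := le_antisymm (hcr.trans hrR) hc
  obtain rfl : c = r := le_antisymm hcr hrR
  rcases hac.eq_or_lt with rfl | hac
  · simp
  have hii : IntervalIntegrable (rayDeriv G θ) volume a c := by
    rcases le_total (c / 2) a with h2 | h2
    · exact hi.mono_set (by
        rw [Set.uIcc_of_le hac.le, Set.uIcc_of_le (by linarith)]; exact Set.Icc_subset_Icc_left h2)
    · exact (hlt a (c / 2) ha h2 (by linarith)).1.trans hi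
  refine ⟨hii, closedBallRep_of_tendsto (norm_ray hr.le) ?_⟩
  have hcont : ContinuousOn (fun x => ∫ s in a..x, rayDeriv G θ s) (Set.uIcc a c) :=
    intervalIntegral.continuousOn_primitive_interval' hii Set.left_mem_uIcc
  have h1 : Tendsto (fun x => rayValue c u θ a + ∫ s in a..x, rayDeriv G θ s) (𝓝[<] c)
      (𝓝 (rayValue c u θ a + ∫ s in a..c, rayDeriv G θ s)) := by
    refine Tendsto.const_add _ ((hcont c Set.right_mem_uIcc).mono_left ?_)
    rw [Set.uIcc_of_le hac.le, ← nhdsWithin_Ioo_eq_nhdsLT hac]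
    exact nhdsWithin_mono _ Set.Ioo_subset_Icc_self
  have h2 : Tendsto (fun s : ℝ => s * c) (𝓝[<] 1) (𝓝[<] c) := by
    refine tendsto_nhdsWithin_iff.2 ⟨?_, ?_⟩
    · have : Tendsto (fun s : ℝ => s * c) (𝓝 1) (𝓝 (1 * c)) :=
        (continuous_id.mul continuous_const).tendsto 1
      rw [one_mul] at this
      exact this.mono_left nhdsWithin_le_nhds
    · filter_upwards [self_mem_nhdsWithin] with s hs
      have : s < 1 := hs
      simp only [Set.mem_Iio]
      nlinarith
  refine (h1.comp h2).congr' ?_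
  filter_upwards [Ioo_mem_nhdsLT (show a / c < 1 from (div_lt_one hr).2 hac)] with s hs
  have e1 : a < s * c := (div_lt_iff₀ hr).1 hs.1
  have e2 : s * c < c := by nlinarith [hs.2]
  simp only [Function.comp]
  rw [smul_smul, ← (hlt a (s * c) ha e1.le e2).2, rayValue_of_lt (ha.trans e1).le e2]

lemma annulus_subset_ball {a b : ℝ} : annulus (Space n) a b ⊆ ball 0 b := Set.sdiff_subset

/-- For `s ≥ r/2` the polar weight is at least `(r/2)ⁿ`, so finite energy in `B_r` bounds the radial
derivative in `L²(r/2, r)` on almost every ray. This includes `r = R` when the energy is finite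
there. -/
lemma HasWeakGradientOn.ae_isPrimitiveRay (h : HasWeakGradientOn u G (ball 0 R))
    (hL2 : ∀ K ⊆ ball (0 : Space n) R, IsCompact K → MemLp G 2 (volume.restrict K))
    (hr : 0 < r) (hrR : r ≤ R) (hGr : MemLp G 2 (volume.restrict (ball 0 r))) :
    ∀ᵐ θ : sphere (0 : Space n) 1 ∂sphereMeasure n, IsPrimitiveRay R u G r θ ∧
      IntervalIntegrable (fun s => rayDeriv G θ s ^ 2) volume (r / 2) r ∧
      ∫ s in r / 2..r, rayDeriv G θ s ^ 2 ≤
        ((r / 2) ^ n)⁻¹ * ∫ s in r / 2..r, s ^ n * ‖G (s • (θ : Space n))‖ ^ 2 := by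
  have hi : IntegrableOn (fun X => ‖G X‖ ^ 2) (annulus (Space n) (r / 2) r) :=
    IntegrableOn.mono_set (hGr.integrable_norm_pow (by simp)) annulus_subset_ball
  have hm : AEStronglyMeasurable ((ball (0 : Space n) r).indicator G) :=
    (aestronglyMeasurable_indicator_iff measurableSet_ball).2 hGr.1
  have hr2 : r / 2 ≤ r := by linarith
  filter_upwards [h.ae_isRegularRay (lintegral_ne_top_of_memLp hL2),
    ae_intervalIntegrable_ray (by positivity) hr2 hi, ae_aestronglyMeasurable_ray hm]
    with θ h1 h2 h3
  have hm' : AEStronglyMeasurable (rayDeriv G θ) (volume.restrict (Set.Ioo (r / 2) r)) := by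
    have h4 : AEStronglyMeasurable (fun s : ℝ => G (s • (θ : Space n)))
        (volume.restrict (Set.Ioo (r / 2) r)) := by
      refine (h3.mono_measure (Measure.restrict_mono (fun s hs => ?_) le_rfl)).congr ?_
      · exact lt_trans (by positivity) hs.1
      · refine (ae_restrict_iff' measurableSet_Ioo).2 (Eventually.of_forall fun s hs => ?_)
        refine Set.indicator_of_mem ?_ _
        rw [mem_ball_zero_iff, norm_ray (le_trans (by positivity) hs.1.le)]
        exact hs.2
    exact h4.inner aestronglyMeasurable_const
  have hw : ∀ s ∈ Set.Ioo (r / 2) r, ‖G (s • (θ : Space n))‖ ^ 2 ≤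
      ((r / 2) ^ n)⁻¹ * (s ^ n * ‖G (s • (θ : Space n))‖ ^ 2) := by
    intro s hs
    have hp : 0 < (r / 2) ^ n := by positivity
    have : (r / 2) ^ n ≤ s ^ n := by gcongr; exact hs.1.le
    rw [← mul_assoc]
    refine le_mul_of_one_le_left (sq_nonneg _) ?_
    rw [inv_mul_eq_div, one_le_div hp]
    exact this
  rw [intervalIntegrable_iff_integrableOn_Ioo_of_le hr2] at h2
  have hsq : IntegrableOn (fun s => rayDeriv G θ s ^ 2) (Set.Ioo (r / 2) r) := by
    refine (h2.const_mul ((r / 2) ^ n)⁻¹).mono' (hm'.pow 2) ?_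
    refine (ae_restrict_iff' measurableSet_Ioo).2 (Eventually.of_forall fun s hs => ?_)
    rw [Real.norm_of_nonneg (sq_nonneg _)]
    exact (sq_rayDeriv_le θ s).trans (hw s hs)
  have hg : IntegrableOn (rayDeriv G θ) (Set.Ioo (r / 2) r) := by
    have h1c : IntegrableOn (fun _ : ℝ => (1 : ℝ)) (Set.Ioo (r / 2) r) :=
      integrableOn_const measure_Ioo_lt_top.ne
    refine (h1c.add hsq).mono' hm' (Eventually.of_forall fun s => ?_)
    simp only [Pi.add_apply]
    rw [Real.norm_eq_abs, abs_le]
    constructor <;> nlinarith [sq_nonneg (rayDeriv G θ s + 1), sq_nonneg (rayDeriv G θ s - 1)]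
  refine ⟨h1.isPrimitiveRay hr hrR
    ((intervalIntegrable_iff_integrableOn_Ioo_of_le hr2).2 hg),
    (intervalIntegrable_iff_integrableOn_Ioo_of_le hr2).2 hsq, ?_⟩
  rw [intervalIntegral.integral_of_le hr2, intervalIntegral.integral_of_le hr2,
    integral_Ioc_eq_integral_Ioo, integral_Ioc_eq_integral_Ioo, ← integral_const_mul]
  refine setIntegral_mono_on hsq (h2.const_mul _) measurableSet_Ioo fun s hs => ?_
  exact (sq_rayDeriv_le θ s).trans (hw s hs)

/-- Cauchy–Schwarz, obtained from nonnegativity of the integral of `(g - mean)²`. -/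
lemma sq_intervalIntegral_le {g : ℝ → ℝ} {a b : ℝ} (hab : a ≤ b)
    (hg : IntervalIntegrable g volume a b) (hg2 : IntervalIntegrable (fun s => g s ^ 2) volume a b) :
    (∫ s in a..b, g s) ^ 2 ≤ (b - a) * ∫ s in a..b, g s ^ 2 := by
  rcases hab.eq_or_lt with rfl | hab'
  · simp
  have hL : 0 < b - a := by linarith
  set J := ∫ s in a..b, g s
  have h0 : 0 ≤ ∫ s in a..b, (g s - J / (b - a)) ^ 2 :=
    intervalIntegral.integral_nonneg hab fun _ _ => sq_nonneg _
  have e : ∫ s in a..b, (g s - J / (b - a)) ^ 2 =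
      (∫ s in a..b, g s ^ 2) - 2 * (J / (b - a)) * J + (b - a) * (J / (b - a)) ^ 2 := by
    have e1 : ∀ s, (g s - J / (b - a)) ^ 2 =
        g s ^ 2 - 2 * (J / (b - a)) * g s + (J / (b - a)) ^ 2 := fun s => by ring
    simp only [e1]
    rw [intervalIntegral.integral_add (hg2.sub (hg.const_mul _)) intervalIntegrable_const,
      intervalIntegral.integral_sub hg2 (hg.const_mul _), intervalIntegral.integral_const_mul,
      intervalIntegral.integral_const, smul_eq_mul]
  rw [e] at h0
  have e2 : (∫ s in a..b, g s ^ 2) - 2 * (J / (b - a)) * J + (b - a) * (J / (b - a)) ^ 2 =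
      (∫ s in a..b, g s ^ 2) - J ^ 2 / (b - a) := by field_simp; ring
  rw [e2, sub_nonneg, div_le_iff₀ hL] at h0
  linarith

lemma IsPrimitiveRay.sq_sub_le {θ : sphere (0 : Space n) 1} (h : IsPrimitiveRay R u G r θ)
    (hr : 0 < r) (h2 : IntervalIntegrable (fun s => rayDeriv G θ s ^ 2) volume (r / 2) r) {s : ℝ}
    (hs : r / 2 ≤ s) (hsr : s ≤ r) :
    (rayValue R u θ r - rayValue R u θ s) ^ 2 ≤
      (r - s) * ∫ t in r / 2..r, rayDeriv G θ t ^ 2 := by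
  obtain ⟨h3, h4⟩ := h s r (lt_of_lt_of_le (by positivity) hs) hsr le_rfl
  have hsub : Set.uIcc s r ⊆ Set.uIcc (r / 2) r := by
    rw [Set.uIcc_of_le hsr, Set.uIcc_of_le (hs.trans hsr)]; exact Set.Icc_subset_Icc_left hs
  rw [h4, add_sub_cancel_left]
  refine (sq_intervalIntegral_le hsr h3 (h2.mono_set hsub)).trans ?_
  have := sub_nonneg.2 hsr
  gcongr
  exact intervalIntegral.integral_mono_interval hs hsr le_rfl
    (Eventually.of_forall fun t => sq_nonneg _) h2

end Spheres

/-! ### Square integrals of `u` over spheres. -/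

section SphereIntegrals

variable {n : ℕ} {u : Space n → ℝ} {G : Space n → Space n} {R r : ℝ}

/-- A sequence of radii in `[r/2, r)` increasing to `r`. -/
def innerRadius (r : ℝ) (k : ℕ) : ℝ := r - r * (1 / (k + 1 : ℝ)) / 2

lemma innerRadius_lt (hr : 0 < r) (k : ℕ) : innerRadius r k < r := by
  have : 0 < r * (1 / (k + 1 : ℝ)) / 2 := by positivity
  rw [innerRadius]; linarith

lemma half_le_innerRadius (hr : 0 < r) (k : ℕ) : r / 2 ≤ innerRadius r k := by
  have h1 : (1 / (k + 1 : ℝ)) ≤ 1 := by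
    rw [div_le_one (by positivity)]
    have : (0 : ℝ) ≤ k := by positivity
    linarith
  rw [innerRadius]
  nlinarith

lemma monotone_innerRadius (hr : 0 < r) : Monotone (innerRadius r) := by
  intro j k hjk
  rw [innerRadius, innerRadius]
  gcongr

lemma tendsto_innerRadius (r : ℝ) : Tendsto (innerRadius r) atTop (𝓝 r) := by
  have h := ((tendsto_one_div_add_atTop_nhds_zero_nat (𝕜 := ℝ)).const_mul r).div_const 2
  have h2 := h.const_sub r
  rw [mul_zero, zero_div, sub_zero] at h2
  exact h2

lemma exists_lt_innerRadius {s : ℝ} (hs : s < r) : ∃ k, s < innerRadius r k :=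
  ((tendsto_innerRadius r).eventually_const_lt hs).exists

lemma IsPrimitiveRay.tendsto_rayValue {θ : sphere (0 : Space n) 1} (h : IsPrimitiveRay R u G r θ)
    (hr : 0 < r) (h2 : IntervalIntegrable (fun s => rayDeriv G θ s ^ 2) volume (r / 2) r) :
    Tendsto (fun k => rayValue R u θ (innerRadius r k)) atTop (𝓝 (rayValue R u θ r)) := by
  rw [tendsto_iff_norm_sub_tendsto_zero]
  have hlim : Tendsto (fun k => √((r - innerRadius r k) * ∫ t in r / 2..r, rayDeriv G θ t ^ 2))
      atTop (𝓝 0) := by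
    have := (((tendsto_innerRadius r).const_sub r).mul_const
      (∫ t in r / 2..r, rayDeriv G θ t ^ 2)).sqrt
    simpa using this
  refine squeeze_zero (fun k => norm_nonneg _) (fun k => ?_) hlim
  refine Real.le_sqrt_of_sq_le ?_
  rw [Real.norm_eq_abs, sq_abs, ← neg_sub, neg_sq]
  exact h.sq_sub_le hr h2 (half_le_innerRadius hr k) (innerRadius_lt hr k).le

lemma integrable_integral_normSq_ray (hr : 0 < r) (hGr : MemLp G 2 (volume.restrict (ball 0 r))) :
    Integrable (fun θ : sphere (0 : Space n) 1 =>
      ∫ s in r / 2..r, s ^ n * ‖G (s • (θ : Space n))‖ ^ 2) (sphereMeasure n) :=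
  integrable_integral_annulus_ray (f := fun X => ‖G X‖ ^ 2) (by positivity) (by linarith)
    (IntegrableOn.mono_set (hGr.integrable_norm_pow (by simp)) annulus_subset_ball)

lemma memLp_ball_of_lt {F : Type*} [NormedAddCommGroup F] {f : Space n → F}
    (hf : ∀ K ⊆ ball (0 : Space n) R, IsCompact K → MemLp f 2 (volume.restrict K)) (hr : r < R) :
    MemLp f 2 (volume.restrict (ball 0 r)) :=
  (hf _ (closedBall_subset_ball hr) (isCompact_closedBall _ _)).mono_measure
    (Measure.restrict_mono ball_subset_closedBall le_rfl)

lemma aestronglyMeasurable_rayValue_of_lt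
    (h : HasWeakGradientOn u G (ball 0 R))
    (hL2 : ∀ K ⊆ ball (0 : Space n) R, IsCompact K → MemLp G 2 (volume.restrict K))
    (hr : 0 < r) (hrR : r < R) :
    AEStronglyMeasurable (fun θ : sphere (0 : Space n) 1 => rayValue R u θ r)
      (sphereMeasure n) := by
  obtain ⟨w, hw, -, -, hL⟩ := h.exists_smooth_approx isOpen_ball
    (isCompact_closedBall (0 : Space n) r) (closedBall_subset_ball hrR)
  refine aestronglyMeasurable_of_tendsto_ae atTop
    (f := fun k (θ : sphere (0 : Space n) 1) => w k (r • (θ : Space n))) (fun k => ?_) ?_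
  · have := (hw k).continuous
    exact (show Continuous fun θ : sphere (0 : Space n) 1 => w k (r • (θ : Space n)) by
      fun_prop).aestronglyMeasurable
  · filter_upwards [h.ae_isRegularRay (lintegral_ne_top_of_memLp hL2)] with θ hθ
    rw [rayValue_of_lt hr.le hrR]
    exact hL _ (by rw [mem_closedBall_zero_iff, norm_ray hr.le]) _ (hθ.isLebesguePoint r hr hrR)

lemma aestronglyMeasurable_rayValue
    (h : HasWeakGradientOn u G (ball 0 R))
    (hL2 : ∀ K ⊆ ball (0 : Space n) R, IsCompact K → MemLp G 2 (volume.restrict K))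
    (hr : 0 < r) (hrR : r ≤ R)
    (hGr : MemLp G 2 (volume.restrict (ball 0 r))) :
    AEStronglyMeasurable (fun θ : sphere (0 : Space n) 1 => rayValue R u θ r)
      (sphereMeasure n) := by
  refine aestronglyMeasurable_of_tendsto_ae atTop
    (f := fun k (θ : sphere (0 : Space n) 1) => rayValue R u θ (innerRadius r k)) (fun k => ?_) ?_
  · exact aestronglyMeasurable_rayValue_of_lt h hL2
      (lt_of_lt_of_le (by positivity) (half_le_innerRadius hr k))
      ((innerRadius_lt hr k).trans_le hrR)
  · filter_upwards [h.ae_isPrimitiveRay hL2 hr hrR hGr] with θ ⟨h1, h2, _⟩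
    exact h1.tendsto_rayValue hr h2

/-- The value at radius `r` is compared with values at radii in `[r/2, 3r/4]`, the difference being
controlled by the energy on the ray, and the bound is averaged over these radii. Stopping at `3r/4`
keeps the annulus compactly inside `B_R` even for `r = R`, where `u` is only locally square
integrable. -/
lemma integrable_sq_rayValue
    (h : HasWeakGradientOn u G (ball 0 R))
    (hu2 : ∀ K ⊆ ball (0 : Space n) R, IsCompact K → MemLp u 2 (volume.restrict K))
    (hL2 : ∀ K ⊆ ball (0 : Space n) R, IsCompact K → MemLp G 2 (volume.restrict K))
    (hr : 0 < r) (hrR : r ≤ R)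
    (hGr : MemLp G 2 (volume.restrict (ball 0 r))) :
    Integrable (fun θ : sphere (0 : Space n) 1 => rayValue R u θ r ^ 2) (sphereMeasure n) := by
  set B : sphere (0 : Space n) 1 → ℝ := fun θ =>
    ∫ s in r / 2..r, s ^ n * ‖G (s • (θ : Space n))‖ ^ 2 with hB
  have hBi : Integrable B (sphereMeasure n) := integrable_integral_normSq_ray hr hGr
  have hu : IntegrableOn (fun X => u X ^ 2) (annulus (Space n) (r / 2) (3 * r / 4)) := by
    have h1 : IntegrableOn (fun X => u X ^ 2) (closedBall 0 (3 * r / 4)) :=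
      (hu2 _ (closedBall_subset_ball (by linarith)) (isCompact_closedBall _ _)).integrable_sq
    exact h1.mono_set (annulus_subset_ball.trans ball_subset_closedBall)
  have h34 : r / 2 ≤ 3 * r / 4 := by linarith
  set A : sphere (0 : Space n) 1 → ℝ := fun θ =>
    ∫ s in r / 2..3 * r / 4, s ^ n * u (s • (θ : Space n)) ^ 2 with hA
  have hAi : Integrable A (sphereMeasure n) :=
    integrable_integral_annulus_ray (f := fun X => u X ^ 2) (by positivity) h34 hu
  -- The length of `[r/2, 3r/4]` times the least value of the weight `sⁿ` on it.
  set c := r / 4 * (r / 2) ^ n with hc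
  have hc0 : 0 < c := by positivity
  refine ((hAi.const_mul (2 / c)).add (hBi.const_mul
    ((r / 4) * (2 * r ^ (n + 1)) * ((r / 2) ^ n)⁻¹ / c))).mono'
    ((aestronglyMeasurable_rayValue h hL2 hr hrR hGr).pow 2) ?_
  filter_upwards [h.ae_isPrimitiveRay hL2 hr hrR hGr,
    h.ae_isRegularRay (lintegral_ne_top_of_memLp hL2),
    ae_intervalIntegrable_ray (f := fun X => u X ^ 2) (by positivity) h34 hu]
    with θ ⟨h1, h2, h3⟩ h4 h5
  set K := ∫ s in r / 2..r, rayDeriv G θ s ^ 2 with hK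
  have hK0 : 0 ≤ K := intervalIntegral.integral_nonneg (by linarith) fun _ _ => sq_nonneg _
  have hint : ∫ s in r / 2..3 * r / 4, (r / 2) ^ n * rayValue R u θ r ^ 2 ≤
      ∫ s in r / 2..3 * r / 4, (2 * (s ^ n * u (s • (θ : Space n)) ^ 2) + 2 * r ^ (n + 1) * K) := by
    refine intervalIntegral.integral_mono_ae_restrict h34 intervalIntegrable_const
      ((h5.const_mul 2).add intervalIntegrable_const) ?_
    refine (ae_restrict_iff' measurableSet_Icc).2 ?_
    filter_upwards [h4.ae_eq] with s hs hsI
    have hs0 : 0 < s := lt_of_lt_of_le (by positivity) hsI.1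
    have hsr : s < r := hsI.2.trans_lt (by linarith)
    have e1 := h1.sq_sub_le hr h2 hsI.1 hsr.le
    rw [rayValue_of_lt hs0.le (hsr.trans_le hrR), hs hs0 (hsr.trans_le hrR)] at e1
    have e2 : rayValue R u θ r ^ 2 ≤ 2 * u (s • (θ : Space n)) ^ 2 + 2 * (r * K) := by
      have e3 : (r - s) * K ≤ r * K := by gcongr; linarith
      nlinarith [sq_nonneg (rayValue R u θ r - 2 * u (s • (θ : Space n)))]
    have e4 : (r / 2) ^ n ≤ s ^ n := by gcongr; exact hsI.1
    have e5 : s ^ n ≤ r ^ n := by gcongr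
    calc (r / 2) ^ n * rayValue R u θ r ^ 2 ≤ s ^ n * rayValue R u θ r ^ 2 := by gcongr
      _ ≤ s ^ n * (2 * u (s • (θ : Space n)) ^ 2 + 2 * (r * K)) := by gcongr
      _ = 2 * (s ^ n * u (s • (θ : Space n)) ^ 2) + s ^ n * (2 * (r * K)) := by ring
      _ ≤ 2 * (s ^ n * u (s • (θ : Space n)) ^ 2) + r ^ n * (2 * (r * K)) := by gcongr
      _ = _ := by ring
  rw [intervalIntegral.integral_const, intervalIntegral.integral_add (h5.const_mul 2)
    intervalIntegrable_const, intervalIntegral.integral_const_mul, intervalIntegral.integral_const,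
    smul_eq_mul, smul_eq_mul, show 3 * r / 4 - r / 2 = r / 4 by ring] at hint
  rw [Real.norm_of_nonneg (sq_nonneg _)]
  simp only [Pi.add_apply]
  have hfin : c * rayValue R u θ r ^ 2 ≤
      2 * A θ + r / 4 * (2 * r ^ (n + 1) * (((r / 2) ^ n)⁻¹ * B θ)) := by
    calc c * rayValue R u θ r ^ 2 = r / 4 * ((r / 2) ^ n * rayValue R u θ r ^ 2) := by
          rw [hc]; ring
      _ ≤ 2 * A θ + r / 4 * (2 * r ^ (n + 1) * K) := hint
      _ ≤ _ := by gcongr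
  rw [mul_comm, ← le_div_iff₀ hc0] at hfin
  refine hfin.trans_eq ?_
  ring

/-- The boundary value and the energy on the ray dominate the squares at all inner radii, so
dominated convergence applies up to the sphere of radius `r`, including `r = R`. -/
lemma tendsto_integral_sq_rayValue
    (h : HasWeakGradientOn u G (ball 0 R))
    (hu2 : ∀ K ⊆ ball (0 : Space n) R, IsCompact K → MemLp u 2 (volume.restrict K))
    (hL2 : ∀ K ⊆ ball (0 : Space n) R, IsCompact K → MemLp G 2 (volume.restrict K))
    (hr : 0 < r) (hrR : r ≤ R)
    (hGr : MemLp G 2 (volume.restrict (ball 0 r))) :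
    Tendsto (fun k => ∫ θ : sphere (0 : Space n) 1,
      rayValue R u θ (innerRadius r k) ^ 2 ∂sphereMeasure n) atTop
      (𝓝 (∫ θ : sphere (0 : Space n) 1, rayValue R u θ r ^ 2 ∂sphereMeasure n)) := by
  set B : sphere (0 : Space n) 1 → ℝ := fun θ =>
    ∫ s in r / 2..r, s ^ n * ‖G (s • (θ : Space n))‖ ^ 2 with hB
  have hBi : Integrable B (sphereMeasure n) := integrable_integral_normSq_ray hr hGr
  refine tendsto_integral_of_dominated_convergence
    (fun θ => 2 * rayValue R u θ r ^ 2 + 2 * r * (((r / 2) ^ n)⁻¹ * B θ)) (fun k => ?_) ?_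
    (fun k => ?_) ?_
  · exact (aestronglyMeasurable_rayValue_of_lt h hL2
      (lt_of_lt_of_le (by positivity) (half_le_innerRadius hr k))
      ((innerRadius_lt hr k).trans_le hrR)).pow 2
  · exact ((integrable_sq_rayValue h hu2 hL2 hr hrR hGr).const_mul 2).add
      ((hBi.const_mul _).const_mul _)
  · filter_upwards [h.ae_isPrimitiveRay hL2 hr hrR hGr] with θ ⟨h1, h2, h3⟩
    rw [Real.norm_of_nonneg (sq_nonneg _)]
    have e1 := h1.sq_sub_le hr h2 (half_le_innerRadius hr k) (innerRadius_lt hr k).le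
    have hK0 : 0 ≤ ∫ s in r / 2..r, rayDeriv G θ s ^ 2 :=
      intervalIntegral.integral_nonneg (by linarith) fun _ _ => sq_nonneg _
    have e2 : (r - innerRadius r k) * (∫ s in r / 2..r, rayDeriv G θ s ^ 2) ≤
        r * (((r / 2) ^ n)⁻¹ * B θ) := by
      refine mul_le_mul ?_ h3 hK0 hr.le
      have := half_le_innerRadius hr k
      linarith
    nlinarith [sq_nonneg (rayValue R u θ (innerRadius r k) - 2 * rayValue R u θ r)]
  · filter_upwards [h.ae_isPrimitiveRay hL2 hr hrR hGr] with θ ⟨h1, h2, _⟩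
    exact (h1.tendsto_rayValue hr h2).pow 2

lemma integrableOn_annulus_inv_pow_mul {a b : ℝ} (ha : 0 < a) (m : ℕ) {f : Space n → ℝ}
    (hf : IntegrableOn f (annulus (Space n) a b)) :
    IntegrableOn (fun X => (‖X‖ ^ m)⁻¹ * f X) (annulus (Space n) a b) := by
  refine Integrable.bdd_mul (c := (a ^ m)⁻¹) hf
    (by fun_prop : Measurable fun X : Space n => (‖X‖ ^ m)⁻¹).aestronglyMeasurable ?_
  refine (ae_restrict_iff' measurableSet_annulus).2 (Eventually.of_forall fun X hX => ?_)
  have hX' := (mem_annulus.1 hX).1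
  rw [Real.norm_of_nonneg (by positivity)]
  gcongr

/-- The growth of the mean square of `u` on spheres. -/
theorem integral_sq_sphere_sub
    (h : HasWeakGradientOn u G (ball 0 R))
    (hu2 : ∀ K ⊆ ball (0 : Space n) R, IsCompact K → MemLp u 2 (volume.restrict K))
    (hL2 : ∀ K ⊆ ball (0 : Space n) R, IsCompact K → MemLp G 2 (volume.restrict K))
    {a b : ℝ} (ha : 0 < a) (hab : a < b) (hbR : b < R) :
    b⁻¹ * (∫ θ : sphere (0 : Space n) 1, rayValue R u θ b ^ 2 ∂sphereMeasure n) -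
      a⁻¹ * (∫ θ : sphere (0 : Space n) 1, rayValue R u θ a ^ 2 ∂sphereMeasure n) =
    ∫ X in annulus (Space n) a b,
      (‖X‖ ^ (n + 2))⁻¹ * (2 * (u X * inner ℝ X (G X)) - u X ^ 2) := by
  have hb : 0 < b := ha.trans hab
  have hub := memLp_ball_of_lt hu2 hbR
  have hGball := memLp_ball_of_lt hL2 hbR
  have hint : IntegrableOn (fun X => (‖X‖ ^ (n + 2))⁻¹ * (2 * (u X * inner ℝ X (G X)) - u X ^ 2))
      (annulus (Space n) a b) := by
    refine integrableOn_annulus_inv_pow_mul ha (n + 2) ?_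
    refine IntegrableOn.mono_set ?_ annulus_subset_ball
    exact ((integrableOn_mul_inner hub hGball).const_mul 2).sub hub.integrable_sq
  rw [setIntegral_annulus ha.le hab.le hint, ← integral_const_mul, ← integral_const_mul,
    ← integral_sub ((integrable_sq_rayValue h hu2 hL2 hb hbR.le hGball).const_mul _)
      ((integrable_sq_rayValue h hu2 hL2 ha (hab.trans hbR).le
        (memLp_ball_of_lt hL2 (hab.trans hbR))).const_mul _)]
  refine integral_congr_ae ?_
  filter_upwards [h.ae_isPrimitiveRay hL2 hb hbR.le hGball,
    h.ae_isRegularRay (lintegral_ne_top_of_memLp hL2)] with θ ⟨h1, _, _⟩ h2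
  have key := integral_deriv_sq_div ha hab.le (h1 a b ha hab.le le_rfl).1
    (F := rayValue R u θ) fun s hs => (h1 a s ha hs.1 hs.2).2
  rw [inv_mul_eq_div, inv_mul_eq_div, ← key]
  refine intervalIntegral.integral_congr_ae ?_
  filter_upwards [h2.ae_eq] with s hs hsI
  rw [Set.uIoc_of_le hab.le] at hsI
  have hs0 : 0 < s := ha.trans hsI.1
  have hsR : s < R := hsI.2.trans_lt hbR
  rw [rayValue_of_lt hs0.le hsR, hs hs0 hsR, norm_ray hs0.le, real_inner_smul_left,
    real_inner_comm, rayDeriv]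
  field_simp
  ring

end SphereIntegrals

/-! ### The increment formula and monotonicity. -/

section Weiss

variable {n : ℕ} {u : Space n → ℝ} {G : Space n → Space n} {R : ℝ}

lemma weissEnergy_eq {r : ℝ} (hr : 0 < r) :
    weissEnergy R u r = (r ^ n)⁻¹ * (energy u (ball 0 r)).toReal -
      1 / 2 * (r⁻¹ * ∫ θ : sphere (0 : Space n) 1, rayValue R u θ r ^ 2 ∂sphereMeasure n) := by
  have h : (r ^ (n + 1))⁻¹ * r ^ n = r⁻¹ := by
    rw [pow_succ, mul_inv, mul_right_comm, inv_mul_cancel₀ (by positivity), one_mul]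
  rw [weissEnergy, sphereIntegral, mul_assoc, ← mul_assoc (r ^ (n + 1))⁻¹, h]
  rfl

/-- The deviation of `u` from being homogeneous of degree `1/2`. -/
def eulerDefect (u : Space n → ℝ) (G : Space n → Space n) (X : Space n) : ℝ :=
  inner ℝ X (G X) - u X / 2

lemma integrableOn_sq_eulerDefect {a b : ℝ} (ha : 0 < a)
    (hu : MemLp u 2 (volume.restrict (ball 0 b))) (hG : MemLp G 2 (volume.restrict (ball 0 b))) :
    IntegrableOn (fun X => (‖X‖ ^ (n + 2))⁻¹ * (2 * eulerDefect u G X ^ 2))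
      (annulus (Space n) a b) := by
  refine integrableOn_annulus_inv_pow_mul ha (n + 2) (IntegrableOn.mono_set ?_ annulus_subset_ball)
  have h1 : IntegrableOn (fun X => 2 * inner ℝ X (G X) ^ 2 - 2 * (u X * inner ℝ X (G X)) +
      1 / 2 * u X ^ 2) (ball 0 b) :=
    (((integrableOn_inner_sq hG).const_mul 2).sub ((integrableOn_mul_inner hu hG).const_mul 2)).add
      (hu.integrable_sq.const_mul (1 / 2))
  refine h1.congr_fun (fun X _ => ?_) measurableSet_ball
  simp only [eulerDefect]
  ring

/-- The increment of the Weiss energy. -/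
theorem IsMinimizer.weissEnergy_sub (hn : 1 ≤ n) (hmin : IsMinimizer u (ball 0 R))
    (h : HasWeakGradientOn u G (ball 0 R))
    (hu2 : ∀ K ⊆ ball (0 : Space n) R, IsCompact K → MemLp u 2 (volume.restrict K))
    (hL2 : ∀ K ⊆ ball (0 : Space n) R, IsCompact K → MemLp G 2 (volume.restrict K))
    {a b : ℝ} (ha : 0 < a) (hab : a < b) (hbR : b < R) :
    weissEnergy R u b - weissEnergy R u a =
      ∫ X in annulus (Space n) a b, (‖X‖ ^ (n + 2))⁻¹ * (2 * eulerDefect u G X ^ 2) := by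
  have e1 := hmin.energy_sub_energy hn h hu2 hL2 ha hab hbR
  have e2 := integral_sq_sphere_sub h hu2 hL2 ha hab hbR
  have hu := memLp_ball_of_lt hu2 hbR
  have hG := memLp_ball_of_lt hL2 hbR
  have i1 : IntegrableOn (fun X => (‖X‖ ^ (n + 2))⁻¹ *
      (2 * inner ℝ X (G X) ^ 2 - u X * inner ℝ X (G X))) (annulus (Space n) a b) :=
    integrableOn_annulus_inv_pow_mul ha (n + 2) (IntegrableOn.mono_set
      (((integrableOn_inner_sq hG).const_mul 2).sub (integrableOn_mul_inner hu hG))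
      annulus_subset_ball)
  have i2 : IntegrableOn (fun X => (‖X‖ ^ (n + 2))⁻¹ *
      (2 * (u X * inner ℝ X (G X)) - u X ^ 2)) (annulus (Space n) a b) :=
    integrableOn_annulus_inv_pow_mul ha (n + 2) (IntegrableOn.mono_set
      (((integrableOn_mul_inner hu hG).const_mul 2).sub hu.integrable_sq) annulus_subset_ball)
  -- With `p = ⟨X, G⟩`, this completes the square: `(2p² - up) - ½(2up - u²) = 2(p - u/2)²`.
  have e3 : ∫ X in annulus (Space n) a b, (‖X‖ ^ (n + 2))⁻¹ * (2 * eulerDefect u G X ^ 2) =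
      (∫ X in annulus (Space n) a b,
        (‖X‖ ^ (n + 2))⁻¹ * (2 * inner ℝ X (G X) ^ 2 - u X * inner ℝ X (G X))) -
      1 / 2 * ∫ X in annulus (Space n) a b,
        (‖X‖ ^ (n + 2))⁻¹ * (2 * (u X * inner ℝ X (G X)) - u X ^ 2) := by
    rw [← integral_const_mul, ← integral_sub i1 (i2.const_mul _)]
    refine integral_congr_ae (Eventually.of_forall fun X => ?_)
    simp only [eulerDefect]
    ring
  rw [weissEnergy_eq ha, weissEnergy_eq (ha.trans hab), e3, ← e1, ← e2]
  ring

lemma iUnion_ball_innerRadius {F : Type*} [SeminormedAddCommGroup F] {r : ℝ} (hr : 0 < r) :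
    ⋃ k, ball (0 : F) (innerRadius r k) = ball 0 r := by
  ext X
  simp only [Set.mem_iUnion, mem_ball_zero_iff]
  exact ⟨fun ⟨k, hk⟩ => hk.trans (innerRadius_lt hr k), exists_lt_innerRadius⟩

lemma tendsto_measure_traceSet {r : ℝ} (hr : 0 < r) :
    Tendsto (fun k => volume.real (traceSet u (innerRadius r k))) atTop
      (𝓝 (volume.real (traceSet u r))) := by
  have hU : ⋃ k, traceSet u (innerRadius r k) = traceSet u r := by
    ext x
    simp only [Set.mem_iUnion, traceSet, Set.mem_ofPred_eq, exists_and_right]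
    exact and_congr_left fun _ =>
      ⟨fun ⟨k, hk⟩ => hk.trans (innerRadius_lt hr k), exists_lt_innerRadius⟩
  have hmono : Monotone fun k => traceSet u (innerRadius r k) := fun j k hjk x hx =>
    ⟨hx.1.trans_le (monotone_innerRadius hr hjk), hx.2⟩
  have := tendsto_measure_iUnion_atTop (μ := volume) hmono
  rw [hU] at this
  exact (ENNReal.tendsto_toReal (measure_traceSet_lt_top u r).ne).comp this

/-- Left continuity along inner radii carries monotonicity and constancy to `r = R`, where the
increment formula, valid for radii below `R`, cannot be used directly. -/
lemma tendsto_weissEnergy (h : HasWeakGradientOn u G (ball 0 R))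
    (hu2 : ∀ K ⊆ ball (0 : Space n) R, IsCompact K → MemLp u 2 (volume.restrict K))
    (hL2 : ∀ K ⊆ ball (0 : Space n) R, IsCompact K → MemLp G 2 (volume.restrict K))
    {r : ℝ} (hr : 0 < r) (hrR : r ≤ R) (hGr : MemLp G 2 (volume.restrict (ball 0 r))) :
    Tendsto (fun k => weissEnergy R u (innerRadius r k)) atTop (𝓝 (weissEnergy R u r)) := by
  have hpos : ∀ k, 0 < innerRadius r k := fun k =>
    lt_of_lt_of_le (by positivity) (half_le_innerRadius hr k)
  have hE : Tendsto (fun k => (energy u (ball (0 : Space n) (innerRadius r k))).toReal) atTop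
      (𝓝 (energy u (ball (0 : Space n) r)).toReal) := by
    rw [toReal_energy (h.mono isOpen_ball (ball_subset_ball hrR)) hGr]
    have hi : IntegrableOn (fun X => ‖G X‖ ^ 2) (ball 0 r) := hGr.integrable_norm_pow (by simp)
    have h1 := tendsto_setIntegral_of_monotone (μ := volume) (f := fun X => ‖G X‖ ^ 2)
      (s := fun k => ball (0 : Space n) (innerRadius r k)) (fun k => measurableSet_ball)
      (fun j k hjk => ball_subset_ball (monotone_innerRadius hr hjk))
      (by rwa [iUnion_ball_innerRadius hr])
    rw [iUnion_ball_innerRadius hr] at h1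
    refine (h1.add (tendsto_measure_traceSet hr)).congr fun k => ?_
    have hle := (innerRadius_lt hr k).le
    rw [toReal_energy (h.mono isOpen_ball (ball_subset_ball (hle.trans hrR)))
      (hGr.mono_measure (Measure.restrict_mono (ball_subset_ball hle) le_rfl))]
  rw [weissEnergy_eq hr]
  simp only [fun k => weissEnergy_eq (R := R) (u := u) (hpos k)]
  have hp := (((tendsto_innerRadius r).pow n).inv₀ (pow_ne_zero n hr.ne')).mul hE
  exact hp.sub ((((tendsto_innerRadius r).inv₀ hr.ne').mul
    (tendsto_integral_sq_rayValue h hu2 hL2 hr hrR hGr)).const_mul _)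

lemma energy_ne_top (h : HasWeakGradientOn u G (ball 0 R))
    (hL2 : ∀ K ⊆ ball (0 : Space n) R, IsCompact K → MemLp G 2 (volume.restrict K))
    {r : ℝ} (hrR : r < R) : energy u (ball 0 r) ≠ ⊤ := by
  rw [energy, measure_thinPositivitySet,
    dirichletEnergy_eq (h.mono isOpen_ball (ball_subset_ball hrR.le)) isOpen_ball]
  exact ENNReal.add_ne_top.2 ⟨(IsC1Diffeo.memLp_two_iff.1 (memLp_ball_of_lt hL2 hrR)).2.ne,
    (measure_traceSet_lt_top u r).ne⟩

lemma memLp_of_mem_admissibleRadii (h : HasWeakGradientOn u G (ball 0 R)) {r : ℝ}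
    (hr : r ∈ admissibleRadii R u) : MemLp G 2 (volume.restrict (ball 0 r)) := by
  obtain ⟨-, hrR, hE⟩ := hr
  have h' := h.mono isOpen_ball (ball_subset_ball hrR)
  refine IsC1Diffeo.memLp_two_iff.2 ⟨h'.locInt_grad.aestronglyMeasurable, ?_⟩
  rw [energy, dirichletEnergy_eq h' isOpen_ball] at hE
  exact (ENNReal.add_ne_top.1 hE).1.lt_top

/-- Monotonicity of the Weiss energy. -/
theorem IsMinimizer.monotoneOn_weissEnergy (hn : 1 ≤ n) (hmin : IsMinimizer u (ball 0 R))
    (h : HasWeakGradientOn u G (ball 0 R))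
    (hu2 : ∀ K ⊆ ball (0 : Space n) R, IsCompact K → MemLp u 2 (volume.restrict K))
    (hL2 : ∀ K ⊆ ball (0 : Space n) R, IsCompact K → MemLp G 2 (volume.restrict K)) :
    MonotoneOn (weissEnergy R u) (admissibleRadii R u) := by
  have hlt : ∀ a b, 0 < a → a ≤ b → b < R → weissEnergy R u a ≤ weissEnergy R u b := by
    intro a b ha hab hb
    rcases hab.eq_or_lt with rfl | hab
    · exact le_rfl
    rw [← sub_nonneg, hmin.weissEnergy_sub hn h hu2 hL2 ha hab hb]
    exact integral_nonneg fun X => by positivity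
  intro a ha b hb hab
  rcases hab.eq_or_lt with rfl | hab
  · exact le_rfl
  refine ge_of_tendsto (tendsto_weissEnergy h hu2 hL2 hb.1 hb.2.1
    (memLp_of_mem_admissibleRadii h hb)) ?_
  filter_upwards [(tendsto_innerRadius b).eventually_const_lt hab] with k hk
  exact hlt a _ ha.1 hk.le ((innerRadius_lt hb.1 k).trans_le hb.2.1)

/-- Homogeneous minimizers have constant Weiss energy. -/
theorem IsMinimizer.weissEnergy_eq_of_isHomogeneousHalf (hn : 1 ≤ n)
    (hmin : IsMinimizer u (ball 0 R)) (h : HasWeakGradientOn u G (ball 0 R))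
    (hu2 : ∀ K ⊆ ball (0 : Space n) R, IsCompact K → MemLp u 2 (volume.restrict K))
    (hL2 : ∀ K ⊆ ball (0 : Space n) R, IsCompact K → MemLp G 2 (volume.restrict K))
    (hhom : IsHomogeneousHalf R u) {a b : ℝ} (ha : 0 < a) (hab : a < b) (hbR : b < R) :
    weissEnergy R u b = weissEnergy R u a := by
  have hb : 0 < b := ha.trans hab
  rw [← sub_eq_zero, hmin.weissEnergy_sub hn h hu2 hL2 ha hab hbR, setIntegral_annulus ha.le hab.le
    (integrableOn_sq_eulerDefect ha (memLp_ball_of_lt hu2 hbR) (memLp_ball_of_lt hL2 hbR))]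
  refine integral_eq_zero_of_ae ?_
  filter_upwards [h.ae_isPrimitiveRay hL2 hb hbR.le (memLp_ball_of_lt hL2 hbR),
    h.ae_isRegularRay (lintegral_ne_top_of_memLp hL2)] with θ ⟨h1, _, _⟩ h2
  -- Homogeneity makes `u` a multiple of `√s` on the ray, and differentiating the primitive yields
  -- the vanishing of the Euler defect.
  have hroot : ∀ s ∈ Set.Icc a b, rayValue R u θ s = √s * (rayValue R u θ b / √b) := by
    intro s hs
    have hs0 : 0 < s := ha.trans_le hs.1
    have hsb : (s / b) • b • (θ : Space n) = s • (θ : Space n) := by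
      rw [smul_smul, div_mul_cancel₀ _ hb.ne']
    have h3 := hhom (b • (θ : Space n)) (by rwa [mem_ball_zero_iff, norm_ray hb.le]) (s / b)
      (by positivity)
      (by rw [hsb, mem_ball_zero_iff, norm_ray hs0.le]; exact hs.2.trans_lt hbR)
    rw [hsb, ← Real.sqrt_eq_rpow, Real.sqrt_div hs0.le] at h3
    rw [rayValue_of_lt hs0.le (hs.2.trans_lt hbR), rayValue_of_lt hb.le hbR, h3]
    ring
  refine intervalIntegral.integral_zero_ae ?_
  have hb' : ∀ᵐ s : ℝ, s ≠ b := by simp [ae_iff]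
  filter_upwards [ae_two_mul_eq_of_sqrt ha hab.le (h1 a b ha hab.le le_rfl).1
    (fun s hs => (h1 a s ha hs.1 hs.2).2) hroot, h2.ae_eq, hb'] with s hs hs2 hsb hsI
  rw [Set.uIoc_of_le hab.le] at hsI
  have hs0 : 0 < s := ha.trans hsI.1
  have hsR : s < R := hsI.2.trans_lt hbR
  have e1 := hs ⟨hsI.1, hsI.2.lt_of_ne hsb⟩
  rw [rayValue_of_lt hs0.le hsR, hs2 hs0 hsR, rayDeriv] at e1
  have e2 : eulerDefect u G (s • (θ : Space n)) = 0 := by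
    rw [eulerDefect, real_inner_smul_left, real_inner_comm, ← e1]
    ring
  rw [e2]
  ring

end Weiss

/-! ### Vanishing Euler defect implies homogeneity. -/

section Rigidity

variable {n : ℕ} {u : Space n → ℝ} {G : Space n → Space n} {R : ℝ}

/-- Polar integration of the indicator of the exceptional set gives zero. Measurability is essential
here, since null sections alone do not make a set null. -/
lemma ae_of_ae_ray {P : Space n → Prop} (hm : NullMeasurableSet {X | P X})
    (h : ∀ᵐ θ : sphere (0 : Space n) 1 ∂sphereMeasure n, ∀ᵐ s : ℝ, 0 < s → P (s • (θ : Space n))) :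
    ∀ᵐ X, P X := by
  have h1 := lintegral_polar (f := {X | P X}ᶜ.indicator 1)
    (aemeasurable_one.indicator₀ hm.compl)
  rw [lintegral_indicator_one₀ hm.compl] at h1
  refine h1.trans ?_
  refine (lintegral_congr_ae ?_).trans lintegral_zero
  filter_upwards [h] with θ hθ
  refine (lintegral_congr_ae ?_).trans lintegral_zero
  filter_upwards [ae_restrict_of_ae hθ, self_mem_ae_restrict measurableSet_Ioi] with s hs hs0
  rw [Set.indicator_of_notMem (by simpa using hs hs0), mul_zero]

lemma ae_of_ae_annulus {P : Space n → Prop}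
    (h : ∀ a b, 0 < a → a < b → b < R → ∀ᵐ X, X ∈ annulus (Space n) a b → P X) :
    ∀ᵐ X, X ≠ 0 → ‖X‖ < R → P X := by
  have h1 : ∀ k : ℕ, ∀ᵐ X, X ∈ annulus (Space n) (1 / (k + 1)) (R - 1 / (k + 1)) → P X := by
    intro k
    rcases lt_or_ge (1 / (k + 1 : ℝ)) (R - 1 / (k + 1)) with hk | hk
    · refine h _ _ (by positivity) hk ?_
      have : (0 : ℝ) < 1 / (k + 1) := by positivity
      linarith
    · refine Eventually.of_forall fun X hX => ?_
      have := mem_annulus.1 hX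
      linarith [this.1, this.2]
  filter_upwards [ae_all_iff.2 h1] with X hX hX0 hXR
  have hpos : 0 < min ‖X‖ (R - ‖X‖) := lt_min (norm_pos_iff.2 hX0) (sub_pos.2 hXR)
  obtain ⟨k, hk⟩ := exists_nat_one_div_lt hpos
  have := lt_min_iff.1 hk
  exact hX k (mem_annulus.2 ⟨this.1, by linarith [this.2]⟩)

lemma ae_eulerDefect_eq_zero
    (hu2 : ∀ K ⊆ ball (0 : Space n) R, IsCompact K → MemLp u 2 (volume.restrict K))
    (hL2 : ∀ K ⊆ ball (0 : Space n) R, IsCompact K → MemLp G 2 (volume.restrict K))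
    (h0 : ∀ a b, 0 < a → a < b → b < R →
      ∫ X in annulus (Space n) a b, (‖X‖ ^ (n + 2))⁻¹ * (2 * eulerDefect u G X ^ 2) = 0) :
    ∀ᵐ X, X ≠ 0 → ‖X‖ < R → eulerDefect u G X = 0 := by
  refine ae_of_ae_annulus fun a b ha hab hb => ?_
  have h1 := (setIntegral_eq_zero_iff_of_nonneg_ae
    (Eventually.of_forall fun X => by simp only [Pi.zero_apply]; positivity)
    (integrableOn_sq_eulerDefect ha (memLp_ball_of_lt hu2 hb) (memLp_ball_of_lt hL2 hb))).1
    (h0 a b ha hab hb)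
  filter_upwards [(ae_restrict_iff' measurableSet_annulus).1 h1] with X hX hXa
  have hX0 : 0 < ‖X‖ := ha.trans (mem_annulus.1 hXa).1
  have := hX hXa
  simpa [hX0.ne'] using this

/-- At `sθ` the Euler relation reads `2s ∂ₛu = u`, so `u/√s` is constant along the ray. -/
lemma IsRegularRay.preciseRep_smul {θ : sphere (0 : Space n) 1} (hθ : IsRegularRay u G R θ)
    (h0 : ∀ᵐ s : ℝ, 0 < s → s < R → eulerDefect u G (s • (θ : Space n)) = 0)
    {s t : ℝ} (hs : 0 < s) (hsR : s < R) (ht : 0 < t) (htR : t * s < R) :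
    preciseRep u ((t * s) • (θ : Space n)) = √t * preciseRep u (s • (θ : Space n)) := by
  have key : ∀ a b, 0 < a → a ≤ b → b < R → preciseRep u (b • (θ : Space n)) / √b =
      preciseRep u (a • (θ : Space n)) / √a := by
    intro a b ha hab hb
    refine div_sqrt_eq_of_ae (g := rayDeriv G θ) (F := fun s => preciseRep u (s • (θ : Space n)))
      ha hab ?_ (fun s hs => ?_) ?_
    · rw [intervalIntegrable_iff_integrableOn_Icc_of_le hab]
      exact (hθ.integrableOn a b ha hab hb).inner_const _
    · rw [← sub_eq_iff_eq_add']
      exact hθ.sub_eq a s ha hs.1 (hs.2.trans_lt hb)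
    · filter_upwards [h0, hθ.ae_eq] with s h1 h2 hs
      have hs0 : 0 < s := ha.trans hs.1
      have hsR : s < R := hs.2.trans_lt hb
      have h3 := h1 hs0 hsR
      rw [eulerDefect, real_inner_smul_left, real_inner_comm] at h3
      rw [h2 hs0 hsR, rayDeriv]
      linarith
  have key2 : ∀ a b, 0 < a → 0 < b → a < R → b < R → preciseRep u (b • (θ : Space n)) / √b =
      preciseRep u (a • (θ : Space n)) / √a := by
    intro a b ha hb haR hbR
    rcases le_total a b with hab | hab
    · exact key a b ha hab hbR
    · exact (key b a hb hab haR).symm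
  have h1 := key2 s (t * s) hs (by positivity) hsR htR
  have hs' : √s ≠ 0 := (Real.sqrt_pos.2 hs).ne'
  have ht' : √t ≠ 0 := (Real.sqrt_pos.2 ht).ne'
  rw [Real.sqrt_mul ht.le] at h1
  field_simp at h1
  rw [h1]

lemma ae_smul_eq (h : HasWeakGradientOn u G (ball 0 R))
    (hL2 : ∀ K ⊆ ball (0 : Space n) R, IsCompact K → MemLp G 2 (volume.restrict K))
    (h0 : ∀ᵐ X, X ≠ 0 → ‖X‖ < R → eulerDefect u G X = 0) {t : ℝ} (ht : 0 < t) :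
    ∀ᵐ X, ‖X‖ < R → ‖t • X‖ < R → u (t • X) = √t * u X := by
  -- Only the restriction of `u` to the ball is known to be measurable, so the identity is tested
  -- with the truncation on the set where `X` and `tX` both lie in the ball.
  set w := (ball (0 : Space n) R).indicator u with hw
  have hwm : AEMeasurable w :=
    ((aestronglyMeasurable_indicator_iff measurableSet_ball).2
      h.locInt.aestronglyMeasurable).aemeasurable
  have hq : Measure.QuasiMeasurePreserving (fun X : Space n => t • X) volume volume := by
    refine ⟨by fun_prop, ?_⟩
    rw [Measure.map_addHaar_smul _ ht.ne']
    exact Measure.smul_absolutelyContinuous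
  set S := ball (0 : Space n) R ∩ (fun X : Space n => t • X) ⁻¹' ball 0 R with hS
  have hSm : MeasurableSet S :=
    measurableSet_ball.inter ((measurable_const_smul t) measurableSet_ball)
  have hm : NullMeasurableSet {X : Space n | S.indicator (fun X => w (t • X) - √t * w X) X = 0} :=
    (((hwm.comp_quasiMeasurePreserving hq).sub (hwm.const_mul _)).indicator hSm).nullMeasurable
      (measurableSet_singleton 0)
  have hmem : ∀ X, ‖X‖ < R → X ∈ ball (0 : Space n) R := fun X hX => mem_ball_zero_iff.2 hX
  have key := ae_of_ae_ray hm ?_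
  · filter_upwards [key] with X hX h1 h2
    rw [Set.indicator_of_mem (show X ∈ S from ⟨hmem _ h1, hmem _ h2⟩), hw,
      Set.indicator_of_mem (hmem _ h1), Set.indicator_of_mem (hmem _ h2)] at hX
    linarith
  · filter_upwards [h.ae_isRegularRay (lintegral_ne_top_of_memLp hL2), ae_ray_of_ae h0]
      with θ hθ hθ0
    have hθ1 : ∀ᵐ s : ℝ, 0 < s → s < R → eulerDefect u G (s • (θ : Space n)) = 0 := by
      filter_upwards [hθ0] with s hs hs0 hsR
      refine hs hs0 ?_ (by rwa [norm_ray hs0.le])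
      rw [← norm_pos_iff, norm_ray hs0.le]
      exact hs0
    have hqr : Measure.QuasiMeasurePreserving (fun s : ℝ => t * s) volume volume := by
      refine ⟨by fun_prop, ?_⟩
      rw [Real.map_volume_mul_left ht.ne']
      exact Measure.smul_absolutelyContinuous
    filter_upwards [hθ.ae_eq, hqr.ae hθ.ae_eq] with s hs hts hs0
    by_cases hsS : s • (θ : Space n) ∈ S
    · have hsR : s < R := by
        have := mem_ball_zero_iff.1 hsS.1
        rwa [norm_ray hs0.le] at this
      have htR : t * s < R := by
        have : ‖t • s • (θ : Space n)‖ < R := mem_ball_zero_iff.1 hsS.2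
        rwa [smul_smul, norm_ray (by positivity)] at this
      rw [Set.indicator_of_mem hsS, hw, Set.indicator_of_mem hsS.1,
        Set.indicator_of_mem (show t • s • (θ : Space n) ∈ ball 0 R from hsS.2),
        smul_smul, ← hts (by positivity) htR, ← hs hs0 hsR,
        hθ.preciseRep_smul hθ1 hs0 hsR ht htR, sub_self]
    · rw [Set.indicator_of_notMem hsS]

open scoped Pointwise in
lemma average_ball_smul {t : ℝ} (ht : 0 < t) (X : Space n) (ρ : ℝ) :
    ⨍ Y in ball (t • X) (t * ρ), u Y = ⨍ Y in ball X ρ, u (t • Y) := by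
  have hs : t • ball X ρ = ball (t • X) (t * ρ) := by
    rw [_root_.smul_ball ht.ne', Real.norm_of_nonneg ht.le]
  have hv : volume.real (ball (t • X) (t * ρ)) =
      t ^ Module.finrank ℝ (Space n) * volume.real (ball X ρ) := by
    rw [← hs, Measure.real, Measure.addHaar_smul, ENNReal.toReal_mul,
      abs_of_pos (by positivity), ENNReal.toReal_ofReal (by positivity), Measure.real]
  rw [setAverage_eq, setAverage_eq, Measure.setIntegral_comp_smul_of_pos _ _ _ ht, hs, hv, smul_smul,
    mul_inv, mul_comm]

/-- Dilation identifies averages over `B_{tρ}(tX)` with averages of `u(t·)` over `B_ρ(X)`.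
Homogeneity a.e. therefore passes to the limit at every point where averages converge, exceptional
points for the rays included. -/
lemma tendsto_average_smul {t : ℝ} (ht : 0 < t)
    (hae : ∀ᵐ X, ‖X‖ < R → ‖t • X‖ < R → u (t • X) = √t * u X) {X : Space n} (hX : ‖X‖ < R)
    (htX : ‖t • X‖ < R) {l : ℝ}
    (hl : Tendsto (fun r : ℝ => ⨍ Y in ball X r, u Y) (𝓝[>] 0) (𝓝 l)) :
    Tendsto (fun r : ℝ => ⨍ Y in ball (t • X) r, u Y) (𝓝[>] 0) (𝓝 (√t * l)) := by
  have hscale : Tendsto (fun r : ℝ => t⁻¹ * r) (𝓝[>] 0) (𝓝[>] 0) := by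
    refine tendsto_nhdsWithin_iff.2 ⟨?_, ?_⟩
    · have : Tendsto (fun r : ℝ => t⁻¹ * r) (𝓝 0) (𝓝 (t⁻¹ * 0)) :=
        (continuous_const.mul continuous_id).tendsto 0
      rw [mul_zero] at this
      exact this.mono_left nhdsWithin_le_nhds
    · filter_upwards [self_mem_nhdsWithin] with r hr
      have : 0 < r := hr
      exact Set.mem_Ioi.2 (by positivity)
  have hopen : IsOpen {Y : Space n | ‖Y‖ < R ∧ ‖t • Y‖ < R} :=
    (isOpen_lt continuous_norm continuous_const).inter
      (isOpen_lt (continuous_const_smul t).norm continuous_const)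
  obtain ⟨ε, hε, hball⟩ := Metric.isOpen_iff.1 hopen X ⟨hX, htX⟩
  have hev : ∀ᶠ ρ in 𝓝[>] (0 : ℝ), √t * ⨍ Y in ball X ρ, u Y = ⨍ Y in ball (t • X) (t * ρ), u Y := by
    filter_upwards [Ioc_mem_nhdsGT hε] with ρ hρ
    rw [average_ball_smul ht, setAverage_eq, setAverage_eq, smul_eq_mul, smul_eq_mul,
      mul_left_comm, ← integral_const_mul]
    congr 1
    refine setIntegral_congr_ae measurableSet_ball ?_
    filter_upwards [hae] with Y hY hYm
    have := hball (ball_subset_ball hρ.2 hYm)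
    rw [hY this.1 this.2]
  refine (((hl.const_mul (√t)).congr' hev).comp hscale).congr fun r => ?_
  simp only [Function.comp]
  rw [mul_inv_cancel_left₀ ht.ne']

/-- A function with vanishing Euler defect is homogeneous. -/
theorem isHomogeneousHalf_of_eulerDefect (h : HasWeakGradientOn u G (ball 0 R))
    (hL2 : ∀ K ⊆ ball (0 : Space n) R, IsCompact K → MemLp G 2 (volume.restrict K))
    (h0 : ∀ᵐ X, X ≠ 0 → ‖X‖ < R → eulerDefect u G X = 0) : IsHomogeneousHalf R u := by
  intro X hX t ht htX
  rw [mem_ball_zero_iff] at hX htX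
  rw [← Real.sqrt_eq_rpow]
  by_cases hex : ∃ l : ℝ, Tendsto (fun r : ℝ => ⨍ Y in ball X r, u Y) (𝓝[>] 0) (𝓝 l)
  · obtain ⟨l, hl⟩ := hex
    rw [preciseRep_eq_of_tendsto hl, preciseRep_eq_of_tendsto
      (tendsto_average_smul ht (ae_smul_eq h hL2 h0 ht) hX htX hl)]
  -- Scaling back by `t⁻¹` shows that averages diverge at `X` and `tX` together; both values are
  -- then the default 0, which is consistent with homogeneity.
  · have hex' : ¬ ∃ l : ℝ, Tendsto (fun r : ℝ => ⨍ Y in ball (t • X) r, u Y) (𝓝[>] 0) (𝓝 l) := by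
      rintro ⟨l, hl⟩
      have ht' : 0 < t⁻¹ := inv_pos.2 ht
      have := tendsto_average_smul ht' (ae_smul_eq h hL2 h0 ht') htX
        (by rwa [inv_smul_smul₀ ht.ne']) hl
      rw [inv_smul_smul₀ ht.ne'] at this
      exact hex ⟨_, this⟩
    rw [preciseRep, dif_neg hex', preciseRep, dif_neg hex, mul_zero]

end Rigidity

end ThinOnePhase

end

/-! ### The monotonicity formula. -/

theorem mainTheorem6 (n : ℕ) (hn : 1 ≤ n) (R : ℝ) (hR : 0 < R)
    (u : ThinOnePhase.Space n → ℝ)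
    (hmin : ThinOnePhase.IsMinimizer u (ball 0 R))
    (hnonneg : ∀ᵐ X ∂volume.restrict (ball (0 : ThinOnePhase.Space n) R), 0 ≤ u X)
    (heven : ∀ᵐ X ∂volume.restrict (ball (0 : ThinOnePhase.Space n) R),
      u (ThinOnePhase.reflectLast X) = u X) :
    (∀ r, 0 < r → r < R → r ∈ ThinOnePhase.admissibleRadii R u) ∧
    (∀ r ∈ ThinOnePhase.admissibleRadii R u,
      Integrable (fun θ : sphere (0 : ThinOnePhase.Space n) 1 =>
          ThinOnePhase.closedBallRep R u (r • (θ : ThinOnePhase.Space n)) ^ 2)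
        (volume : Measure (ThinOnePhase.Space n)).toSphere) ∧
    MonotoneOn (ThinOnePhase.weissEnergy R u) (ThinOnePhase.admissibleRadii R u) ∧
    ((∃ c : ℝ, ∀ r ∈ ThinOnePhase.admissibleRadii R u, ThinOnePhase.weissEnergy R u r = c) ↔
      ThinOnePhase.IsHomogeneousHalf R u) := by
  obtain ⟨G, h, hK⟩ := hmin.1
  have hu2 := fun K (hsub : K ⊆ ball (0 : ThinOnePhase.Space n) R) (hc : IsCompact K) =>
    (hK K hc hsub).1
  have hL2 := fun K (hsub : K ⊆ ball (0 : ThinOnePhase.Space n) R) (hc : IsCompact K) =>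
    (hK K hc hsub).2
  have hadm : ∀ r, 0 < r → r < R → r ∈ ThinOnePhase.admissibleRadii R u := fun r hr hrR =>
    ⟨hr, hrR.le, ThinOnePhase.energy_ne_top h hL2 hrR⟩
  refine ⟨hadm, fun r hr => ThinOnePhase.integrable_sq_rayValue h hu2 hL2 hr.1 hr.2.1
    (ThinOnePhase.memLp_of_mem_admissibleRadii h hr),
    hmin.monotoneOn_weissEnergy hn h hu2 hL2, ?_, fun hhom => ?_⟩
  · rintro ⟨c, hc⟩
    refine ThinOnePhase.isHomogeneousHalf_of_eulerDefect h hL2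
      (ThinOnePhase.ae_eulerDefect_eq_zero hu2 hL2 fun a b ha hab hb => ?_)
    rw [← hmin.weissEnergy_sub hn h hu2 hL2 ha hab hb, hc b (hadm b (ha.trans hab) hb),
      hc a (hadm a ha (hab.trans hb)), sub_self]
  · have hconst : ∀ r, 0 < r → r < R →
        ThinOnePhase.weissEnergy R u r = ThinOnePhase.weissEnergy R u (R / 2) := by
      intro r hr hrR
      rcases lt_trichotomy r (R / 2) with hlt | rfl | hlt
      · exact (hmin.weissEnergy_eq_of_isHomogeneousHalf hn h hu2 hL2 hhom hr hlt
          (by linarith)).symm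
      · rfl
      · exact hmin.weissEnergy_eq_of_isHomogeneousHalf hn h hu2 hL2 hhom (by positivity) hlt hrR
    refine ⟨ThinOnePhase.weissEnergy R u (R / 2), fun r hr => ?_⟩
    -- An admissible `r` may equal `R`; the inner radii lie strictly below `R`, where constancy is
    -- known, and left continuity gives the value at `r`.
    refine tendsto_nhds_unique (ThinOnePhase.tendsto_weissEnergy h hu2 hL2 hr.1 hr.2.1
      (ThinOnePhase.memLp_of_mem_admissibleRadii h hr)) ?_
    refine tendsto_const_nhds.congr fun k => ?_
    have hr0 := hr.1
    exact (hconst _ (lt_of_lt_of_le (by positivity) (ThinOnePhase.half_le_innerRadius hr0 k))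
      ((ThinOnePhase.innerRadius_lt hr0 k).trans_le hr.2.1)).symm
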